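/- Setting. Let $H\in(1/2,1)$. Let $(W_t)_{t\in\mathbb R}$ be a standard Brownian motion over $\mathbb R$ (with $W_0=0$), let $(B_t)_{t\ge0}$ be a standard Brownian motion independent of $W$, and let $\mathcal F_t$ be the $\sigma$-algebra generated by $W_s$, $s\le t$, and $B_s$, $0\le s\le t$. Let $$W^H_t=\frac1{\Gamma(H+\frac12)}\int_{\mathbb R}\big[(t-s)_+^{H-\frac12}-(-s)_+^{H-\frac12}\big]\,dW_s$$ (with continuous paths) be the fractional Brownian motion driven by $W$ and, for $\varepsilon>0$, let $$Z^\varepsilon_t=\varepsilon^{-H}W^H_t-\varepsilon^{-1-H}\int_{-\infty}^te^{-(t-s)/\varepsilon}\,W^H_s\,ds$$ be the $\varepsilon$-scaled fractional Ornstein–Uhlenbeck process. Put $\sigma_H^2=\frac1{\Gamma(2H+1)\sin(\pi H)}$, $\sigma_{\rm ou}^2=\frac12\Gamma(2H+1)\sigma_H^2$, $p(z)=e^{-z^2/2}/\sqrt{2\pi}$. Let $F:\mathbb R\to\mathbb R$ be one-to-one, positive, smooth, bounded and with bounded derivatives of all orders, such that for some $\alpha>2$ one has $\sum_{k\ge0}\alpha^kC_k^2/k!<\infty$,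 where $C_k=\int_{\mathbb R}H_k(z)F(\sigma_{\rm ou}z)^2p(z)\,dz$ and $H_k(z)=(-1)^ke^{z^2/2}\frac{d^k}{dz^k}e^{-z^2/2}$. Put $\overline\sigma^2=\int_{\mathbb R}F(\sigma_{\rm ou}z)^2p(z)\,dz$, $\langle FF'\rangle=\int_{\mathbb R}F(\sigma_{\rm ou}z)F'(\sigma_{\rm ou}z)p(z)\,dz$, $G(z)=\frac12\big(F(z)^2-\overline\sigma^2\big)$, $$\sigma_\phi^2=\langle FF'\rangle^2\Big(\frac1{\Gamma(2H+1)\sin(\pi H)}-\frac1{2H\,\Gamma(H+\frac12)^2}\Big),$$ and, for $0\le t\le T$, $$\phi^\varepsilon_{t,T}=\mathbb E\Big[\int_t^TG(Z^\varepsilon_s)\,ds\,\Big|\,\mathcal F_t\Big].$$ Statement. 1. For all $0\le t\le T$ and $\varepsilon>0$, $\phi^\varepsilon_{t,T}$ is a square-integrable random variable with mean zero, and $\varepsilon^{2H-2}\,\mathbb E[(\phi^\varepsilon_{t,T})^2]\to\sigma_\phi^2(T-t)^{2H}$ as $\varepsilon\to0^+$. 2. For all $0\le t\le T$, $0\le t'\le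 T'$ with $t\le t'$, as $\varepsilon\to0^+$, $$\varepsilon^{2H-2}\,\mathbb E[\phi^\varepsilon_{t,T}\phi^\varepsilon_{t',T'}]\to\sigma_\phi^2(T-t)^H(T'-t')^H\,\mathcal C_\phi(t,t';T,T'),$$ where $$\mathcal C_\phi(t,t';T,T')=\frac{\int_0^\infty\big[(u+r)^{H-\frac12}-u^{H-\frac12}\big]\big[(u+s)^{H-\frac12}-(u+q)^{H-\frac12}\big]du}{\int_0^\infty\big[(1+u)^{H-\frac12}-u^{H-\frac12}\big]^2du},$$ $$q=\frac{t'-t}{\sqrt{(T-t)(T'-t')}},\qquad r=\frac{\sqrt{T-t}}{\sqrt{T'-t'}},\qquad s=\frac{T'-t}{\sqrt{(T-t)(T'-t')}};$$ if $t=T$ or $t'=T'$ the right-hand side of the limit is read as $0$. 3. As $\varepsilon\to0^+$, the random field $(\varepsilon^{H-1}\phi^\varepsilon_{t,T})_{0\le t\le T}$, indexed by the pairs $(t,T)$, converges in the sense of finite-dimensional distributions to a Gaussian random field $(\phi_{t,T})_{0\le t\le T}$ with mean zero and covariance $$\mathbb E[\phi_{t,T}\phi_{t',T'}]=\sigma_\phi^2(T-t)^H(T'-t')^H\,\mathcal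 C_\phi(t,t';T,T')\qquad\text{for }0\le t\le T,\ 0\le t'\le T',\ t\le t'$$ (with the same reading when $t=T$ or $t'=T'$). 4. For every $T\ge0$ there is a constant $K_T$ independent of $\varepsilon$ such that, for all $\varepsilon>0$, $$\sup_{t\in[0,T]}\mathbb E[(\phi^\varepsilon_{t,T})^4]^{1/4}\le K_T\,\varepsilon^{1-H}.$$ -/

import Mathlib

open MeasureTheory ProbabilityTheory Filter Topology Set
open scoped NNReal ENNReal

universe u

namespace FractionalVol

noncomputable section

/-- A standard Brownian motion over the whole line: a centered Gaussian process with covariance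
`(|s| + |t| - |t - s|) / 2` (so that it vanishes at time `0`) and continuous paths. -/
structure IsTwoSidedBrownian {Ω : Type u} [MeasurableSpace Ω] (W : ℝ → Ω → ℝ)
    (P : Measure Ω) : Prop where
  measurable : ∀ t, Measurable (W t)
  gaussian : IsGaussianProcess W P
  mean_zero : ∀ t, ∫ ω, W t ω ∂P = 0
  covariance : ∀ s t, ∫ ω, W s ω * W t ω ∂P = (|s| + |t| - |t - s|) / 2
  continuous_paths : ∀ᵐ ω ∂P, Continuous fun t => W t ω

/-- Data of a deterministic step function `∑ i, coeff i * 1_{(left i, right i]}`. -/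
structure StepData where
  n : ℕ
  coeff : Fin n → ℝ
  left : Fin n → ℝ
  right : Fin n → ℝ
  left_le_right : ∀ i, left i ≤ right i

/-- The step function itself. -/
def StepData.toFun (φ : StepData) (s : ℝ) : ℝ :=
  ∑ i, (Ioc (φ.left i) (φ.right i)).indicator (fun _ => φ.coeff i) s

/-- The elementary stochastic integral of a step function. -/
def StepData.integral {Ω : Type u} (φ : StepData) (W : ℝ → Ω → ℝ) (ω : Ω) : ℝ :=
  ∑ i, φ.coeff i * (W (φ.right i) ω - W (φ.left i) ω)

/-- `X` is (a version of) the Wiener integral `∫_ℝ f(s) dW_s` of the deterministic function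
`f ∈ L²(ℝ)`: it is the `L²(P)`-limit of the elementary integrals of step functions that converge
to `f` in `L²(ℝ)`. -/
def IsWienerIntegral {Ω : Type u} [MeasurableSpace Ω] (P : Measure Ω) (W : ℝ → Ω → ℝ)
    (f : ℝ → ℝ) (X : Ω → ℝ) : Prop :=
  MemLp f 2 volume ∧ MemLp X 2 P ∧
    ∃ φ : ℕ → StepData,
      Tendsto (fun n => eLpNorm (fun s => (φ n).toFun s - f s) 2 volume) atTop (𝓝 0) ∧
      Tendsto (fun n => eLpNorm (fun ω => (φ n).integral W ω - X ω) 2 P) atTop (𝓝 0)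

/-- The Mandelbrot--Van Ness kernel
`((t - s)_+ ^ (H - 1/2) - (-s)_+ ^ (H - 1/2)) / Γ(H + 1/2)` (used for `H > 1/2`). -/
def mandelbrotKernel (H t s : ℝ) : ℝ :=
  (Real.Gamma (H + 1 / 2))⁻¹ * ((max (t - s) 0) ^ (H - 1 / 2) - (max (-s) 0) ^ (H - 1 / 2))

/-- `WH` is the fractional Brownian motion with Hurst index `H` driven by `W`, through its
moving-average representation, with continuous paths. -/
structure IsFractionalBrownian {Ω : Type u} [MeasurableSpace Ω] (P : Measure Ω) (H : ℝ)
    (W WH : ℝ → Ω → ℝ) : Prop where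
  wienerIntegral : ∀ t, IsWienerIntegral P W (mandelbrotKernel H t) (WH t)
  continuous_paths : ∀ᵐ ω ∂P, Continuous fun t => WH t ω

/-- The `ε`-scaled fractional Ornstein--Uhlenbeck process
`ε^{-H} W^H_t - ε^{-1-H} ∫_{-∞}^t e^{-(t-s)/ε} W^H_s ds`. -/
def fOU {Ω : Type u} (H : ℝ) (WH : ℝ → Ω → ℝ) (ε t : ℝ) (ω : Ω) : ℝ :=
  ε ^ (-H) * WH t ω - ε ^ (-1 - H) * ∫ s in Iic t, Real.exp (-(t - s) / ε) * WH s ω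

/-- `σ_H² = 1 / (Γ(2H+1) sin(πH))`, the variance of fractional Brownian motion at time `1`. -/
def sigmaHSq (H : ℝ) : ℝ := 1 / (Real.Gamma (2 * H + 1) * Real.sin (Real.pi * H))

/-- `σ_ou`, the stationary standard deviation of the fractional OU process:
`σ_ou² = Γ(2H+1) σ_H² / 2`. -/
def sigmaOU (H : ℝ) : ℝ := Real.sqrt (1 / 2 * Real.Gamma (2 * H + 1) * sigmaHSq H)

/-- The Hermite coefficient `C_k = ∫ H_k(z) F(σ_ou z)² p(z) dz`, with the probabilists' Hermite
polynomials and `p` the standard normal density. -/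
def hermiteCoeff (H : ℝ) (F : ℝ → ℝ) (k : ℕ) : ℝ :=
  ∫ z, Polynomial.aeval z (Polynomial.hermite k) * F (sigmaOU H * z) ^ 2 ∂(gaussianReal 0 1)

/-- The admissible volatility functions. -/
structure IsVolatilityFunction (H : ℝ) (F : ℝ → ℝ) : Prop where
  injective : Function.Injective F
  pos : ∀ x, 0 < F x
  smooth : ContDiff ℝ ((⊤ : ℕ∞) : WithTop ℕ∞) F
  /-- `F` (case `k = 0`) and all its derivatives are bounded. -/
  bounded : ∀ k : ℕ, ∃ C : ℝ, ∀ x, |iteratedDeriv k F x| ≤ C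
  hermite_summable : ∃ α : ℝ, 2 < α ∧
    Summable fun k : ℕ => α ^ k * hermiteCoeff H F k ^ 2 / (k.factorial : ℝ)

/-- `σ̄² = ⟨F²⟩ = ∫ F(σ_ou z)² p(z) dz`. -/
def sigmaBarSq (H : ℝ) (F : ℝ → ℝ) : ℝ := ∫ z, F (sigmaOU H * z) ^ 2 ∂(gaussianReal 0 1)

/-- `⟨F F'⟩ = ∫ F(σ_ou z) F'(σ_ou z) p(z) dz`. -/
def meanFF' (H : ℝ) (F : ℝ → ℝ) : ℝ :=
  ∫ z, F (sigmaOU H * z) * deriv F (sigmaOU H * z) ∂(gaussianReal 0 1)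

/-- `G(z) = (F(z)² - σ̄²) / 2`. -/
def G (H : ℝ) (F : ℝ → ℝ) (z : ℝ) : ℝ := 1 / 2 * (F z ^ 2 - sigmaBarSq H F)

/-- `F_t`: the sigma-algebra generated by `W` up to time `t` and by `B` on `[0, t]`. -/
@[reducible] def past {Ω : Type u} (W : ℝ → Ω → ℝ) (B : ℝ≥0 → Ω → ℝ) (t : ℝ) : MeasurableSpace Ω :=
  (⨆ (s : ℝ) (_ : s ≤ t), MeasurableSpace.comap (W s) inferInstance) ⊔
    (⨆ (s : ℝ≥0) (_ : (s : ℝ) ≤ t), MeasurableSpace.comap (B s) inferInstance)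

/-- `∫_t^T G(Z^ε_s) ds`. -/
def intG {Ω : Type u} (H : ℝ) (F : ℝ → ℝ) (WH : ℝ → Ω → ℝ) (ε t T : ℝ) (ω : Ω) : ℝ :=
  ∫ s in t..T, G H F (fOU H WH ε s ω)

/-- `φ^ε_{t,T} = E[∫_t^T G(Z^ε_s) ds | F_t]`. -/
def phi {Ω : Type u} [MeasurableSpace Ω] (P : Measure Ω) (H : ℝ) (F : ℝ → ℝ)
    (W : ℝ → Ω → ℝ) (B : ℝ≥0 → Ω → ℝ) (WH : ℝ → Ω → ℝ) (ε t T : ℝ) : Ω → ℝ :=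
  P[intG H F WH ε t T | past W B t]

/-- `σ_φ² = ⟨F F'⟩² (1 / (Γ(2H+1) sin(πH)) - 1 / (2H Γ(H+1/2)²))`. -/
def sigmaPhiSq (H : ℝ) (F : ℝ → ℝ) : ℝ :=
  meanFF' H F ^ 2 *
    (1 / (Real.Gamma (2 * H + 1) * Real.sin (Real.pi * H))
      - 1 / (2 * H * Real.Gamma (H + 1 / 2) ^ 2))

/-- The limit correlation `C_φ(t, t'; T, T')`, for `t ≤ t'`, `t < T`, `t' < T'`. -/
def corrPhi (H t t' T T' : ℝ) : ℝ :=
  let q := (t' - t) / Real.sqrt ((T - t) * (T' - t'))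
  let r := Real.sqrt (T - t) / Real.sqrt (T' - t')
  let s := (T' - t) / Real.sqrt ((T - t) * (T' - t'))
  (∫ u in Ioi (0 : ℝ), ((u + r) ^ (H - 1 / 2) - u ^ (H - 1 / 2)) *
      ((u + s) ^ (H - 1 / 2) - (u + q) ^ (H - 1 / 2))) /
    ∫ u in Ioi (0 : ℝ), ((1 + u) ^ (H - 1 / 2) - u ^ (H - 1 / 2)) ^ 2

/-- The limit covariance `σ_φ² (T-t)^H (T'-t')^H C_φ(t,t';T,T')`, for `t ≤ t'`. When `t = T` or
`t' = T'` the factor `0 ^ H = 0` makes it zero, whatever the value of `C_φ`. -/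
def limitCov (H : ℝ) (F : ℝ → ℝ) (t t' T T' : ℝ) : ℝ :=
  sigmaPhiSq H F * (T - t) ^ H * (T' - t') ^ H * corrPhi H t t' T T'

/-- Pairs `(t, T)` of a current time and a maturity, `0 ≤ t ≤ T`. -/
def TimeMaturity : Type := {p : ℝ × ℝ // 0 ≤ p.1 ∧ p.1 ≤ p.2}

/-- The current time `t`. -/
def TimeMaturity.t (τ : TimeMaturity) : ℝ := τ.1.1

/-- The maturity `T`. -/
def TimeMaturity.T (τ : TimeMaturity) : ℝ := τ.1.2

end

end FractionalVol

open FractionalVol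

set_option linter.unusedSectionVars false

namespace FractionalVol

/-! The point is a conditional linearization. Fix `t` and `s > t`, and split `Z_s = M + N` with `M =
E[Z_s | F_t]`. Inside the Gaussian Hilbert space of `W` the innovation `N` is orthogonal to `W`
before `t`, hence independent of `F_t`. Expanding `G(N + M)` to second order around `N` and
conditioning gives `E[G(N)] + E[G'(N)] M + O(M²)`. The law of `Z_s` is `N(0, σ_ou²)` and `G` is
centered for it, so `E[G(N)]` is itself `O(E M²)`, while `E[G'(N)]` differs from `⟨FF'⟩` by
`O(E|M|)`. Thus `E[G(Z_s) | F_t] = ⟨FF'⟩ M + O(M² + E M²)` (`ae_abs_condExp_comp_add_sub_le`,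
`ae_abs_condExp_G_sub_le`). The predictable part is small: `‖M‖ ≤ K ε^(1-H) (s-t)^(H-1)`
(`exists_norm_condPast_fouLp_le`). The quadratic error is therefore of order `ε^(2-2H)
(s-t)^(2H-2)`, integrable at `s = t` because `H > 1/2`, and Minkowski's inequality in `L⁴` bounds
its time integral by a multiple of `ε^(2-2H)`, which is negligible against `ε^(1-H)`. The linear
term is explicit: the Langevin equation integrates to `∫_t^T Z = ε^(1-H) (W^H_T - W^H_t) - ε (Z_T -
Z_t)` (`integral_fOU`). Hence `ε^(H-1) φ` converges in `L²` to `⟨FF'⟩ E[W^H_T - W^H_t | F_t]`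
(`tendsto_phiLp`). This limit lives on the same probability space and is Gaussian: it is the Wiener
integral of the kernel increment cut off at time `t`. Covariances converge by continuity of the
inner product, finite-dimensional laws because `L²` convergence implies convergence in distribution,
and the fourth moments come from the same `L⁴` estimate. What remains is calculus: the `L²` norm of
the Mandelbrot–Van Ness kernel, its tail before `t`, the variance `σ_ou²`, and a change of variables
turning truncated kernel products into `C_φ` (`limitCov_eq`). -/

/-! ### Gamma and Beta integrals for the norm of the unit kernel -/

lemma lintegral_rpow_mul_exp_neg {s r : ℝ} (hs : 0 < s) (hr : 0 < r) :
    ∫⁻ x in Ioi (0 : ℝ), ENNReal.ofReal (x ^ (s - 1) * Real.exp (-(r * x)))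
      = ENNReal.ofReal ((1 / r) ^ s * Real.Gamma s) := by
  rw [← Real.integral_rpow_mul_exp_neg_mul_Ioi hs hr, ofReal_integral_eq_lintegral_ofReal]
  · have := integrableOn_rpow_mul_exp_neg_mul_rpow (p := 1) (s := s - 1) (by linarith) one_pos hr
    simpa [IntegrableOn] using this
  · filter_upwards [ae_restrict_mem measurableSet_Ioi] with x hx
    have : (0 : ℝ) < x := hx
    simp only [Pi.zero_apply]
    positivity

/-- Multiply by `Γ(1-a)` and write `Γ(1-a) (x+h)^(a-1)` as the Laplace integral of `y^(-a)
e^(-(x+h)y)`. By Tonelli the `x`-integral gives `Γ(a) y^(-a)`, leaving `∫ y^(-2a) e^(-hy) dy`, which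
converges at `0` exactly because `a < 1/2`. -/
lemma lintegral_rpow_mul_add_rpow {a h : ℝ} (ha : 0 < a) (ha' : a < 1 / 2) (hh : 0 < h) :
    ∫⁻ x in Ioi (0 : ℝ), ENNReal.ofReal (x ^ (a - 1) * (x + h) ^ (a - 1))
      = ENNReal.ofReal (Real.Gamma a * Real.Gamma (1 - 2 * a) / Real.Gamma (1 - a)
          * h ^ (2 * a - 1)) := by
  have hG : 0 < Real.Gamma (1 - a) := Real.Gamma_pos_of_pos (by linarith)
  have hGa : 0 < Real.Gamma a := Real.Gamma_pos_of_pos (by linarith)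
  have hG2 : 0 < Real.Gamma (1 - 2 * a) := Real.Gamma_pos_of_pos (by linarith)
  have key : ∫⁻ x in Ioi (0 : ℝ), ENNReal.ofReal (x ^ (a - 1) * (x + h) ^ (a - 1))
      * ENNReal.ofReal (Real.Gamma (1 - a))
      = ENNReal.ofReal (Real.Gamma a * Real.Gamma (1 - 2 * a) * h ^ (2 * a - 1)) := by
    calc _ = ∫⁻ x in Ioi (0 : ℝ), ∫⁻ y in Ioi (0 : ℝ),
          ENNReal.ofReal (x ^ (a - 1) * (y ^ ((1 - a) - 1) * Real.exp (-((x + h) * y)))) := by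
          refine setLIntegral_congr_fun measurableSet_Ioi fun x hx => ?_
          have hx : (0 : ℝ) < x := hx
          have hx1 : 0 ≤ x ^ (a - 1) := by positivity
          simp_rw [ENNReal.ofReal_mul hx1]
          rw [lintegral_const_mul _ (by fun_prop),
            lintegral_rpow_mul_exp_neg (s := 1 - a) (r := x + h) (by linarith) (by linarith),
            ENNReal.ofReal_mul (by positivity), mul_assoc]
          congr 3
          rw [one_div, Real.inv_rpow (by linarith), ← Real.rpow_neg (by linarith)]
          congr 1; ring
      _ = ∫⁻ y in Ioi (0 : ℝ), ∫⁻ x in Ioi (0 : ℝ),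
          ENNReal.ofReal (x ^ (a - 1) * (y ^ ((1 - a) - 1) * Real.exp (-((x + h) * y)))) := by
          apply lintegral_lintegral_swap
          fun_prop
      _ = ∫⁻ y in Ioi (0 : ℝ), ENNReal.ofReal (Real.Gamma a) *
            ENNReal.ofReal (y ^ ((1 - 2 * a) - 1) * Real.exp (-(h * y))) := by
          refine setLIntegral_congr_fun measurableSet_Ioi fun y hy => ?_
          have hy : (0 : ℝ) < y := hy
          have e : ∀ x : ℝ, x ^ (a - 1) * (y ^ ((1 - a) - 1) * Real.exp (-((x + h) * y)))
              = (y ^ (-a) * Real.exp (-(h * y))) * (x ^ (a - 1) * Real.exp (-(y * x))) := by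
            intro x
            rw [show -((x + h) * y) = -(h * y) + -(y * x) by ring, Real.exp_add,
              show (1 - a) - 1 = -a by ring]
            ring
          have hy1 : 0 ≤ y ^ (-a) * Real.exp (-(h * y)) := by positivity
          simp_rw [e, ENNReal.ofReal_mul hy1]
          rw [lintegral_const_mul _ (by fun_prop), lintegral_rpow_mul_exp_neg ha hy,
            ← ENNReal.ofReal_mul hy1, ← ENNReal.ofReal_mul hGa.le]
          congr 1
          rw [show (1 - 2 * a) - 1 = -a + -a by ring, Real.rpow_add hy, one_div,
            Real.inv_rpow hy.le, Real.rpow_neg hy.le]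
          ring
      _ = _ := by
          rw [lintegral_const_mul _ (by fun_prop),
            lintegral_rpow_mul_exp_neg (s := 1 - 2 * a) (by linarith) hh, ← ENNReal.ofReal_mul hGa.le]
          congr 1
          rw [one_div, Real.inv_rpow hh.le, ← Real.rpow_neg hh.le,
            show -(1 - 2 * a) = 2 * a - 1 by ring]
          ring
  rw [lintegral_mul_const _ (by fun_prop)] at key
  rw [← ENNReal.mul_left_inj (c := ENNReal.ofReal (Real.Gamma (1 - a))) (by simpa using hG)
    (by simp), key, ← ENNReal.ofReal_mul (by positivity)]
  congr 1
  field_simp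

lemma lintegral_posPart_rpow_mul {a u w : ℝ} (ha : 0 < a) (ha' : a < 1 / 2) (huw : u < w) :
    ∫⁻ v, ENNReal.ofReal (max (u - v) 0 ^ (a - 1)) * ENNReal.ofReal (max (w - v) 0 ^ (a - 1))
      = ENNReal.ofReal (Real.Gamma a * Real.Gamma (1 - 2 * a) / Real.Gamma (1 - a)
          * (w - u) ^ (2 * a - 1)) := by
  rw [← lintegral_rpow_mul_add_rpow ha ha' (sub_pos.2 huw), ← lintegral_indicator measurableSet_Ioi]
  rw [← lintegral_sub_left_eq_self _ u]
  refine lintegral_congr fun v => ?_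
  rw [show u - (u - v) = v by ring, show w - (u - v) = v + (w - u) by ring]
  by_cases hv : 0 < v
  · rw [indicator_of_mem (show v ∈ Ioi (0 : ℝ) from hv), ← ENNReal.ofReal_mul
      (by positivity), max_eq_left (by linarith), max_eq_left (by linarith)]
  -- `Real.rpow` gives `0 ^ (a - 1) = 0` for `a ≠ 1`, so the truncated power vanishes off its
  -- support although its exponent is negative.
  · rw [indicator_of_notMem (by simpa using hv), max_eq_right (a := v) (by linarith),
      Real.zero_rpow (by linarith)]
    simp

lemma intervalIntegrable_posPart_rpow {a : ℝ} (ha : 0 < a) (α β : ℝ) :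
    IntervalIntegrable (fun x : ℝ => max x 0 ^ (a - 1)) volume α β := by
  have h0 : ∀ β : ℝ, IntervalIntegrable (fun x : ℝ => max x 0 ^ (a - 1)) volume 0 β := by
    intro β
    rcases le_total 0 β with h | h
    · refine (intervalIntegral.intervalIntegrable_rpow' (a := 0) (b := β)
        (by linarith : -1 < a - 1)).congr ?_
      intro x hx
      rw [uIoc_of_le h] at hx
      simp only
      rw [max_eq_left hx.1.le]
    · refine (_root_.intervalIntegrable_const (c := (0 : ℝ) ^ (a - 1))).congr ?_
      intro x hx
      rw [uIoc_of_ge h] at hx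
      simp only
      rw [max_eq_right hx.2]
  exact (h0 α).symm.trans (h0 β)

lemma integral_posPart_rpow {a : ℝ} (ha : 0 < a) (ha' : a < 1) (α β : ℝ) :
    ∫ x in α..β, max x 0 ^ (a - 1) = (max β 0 ^ a - max α 0 ^ a) / a := by
  have h0 : ∀ β : ℝ, ∫ x in (0 : ℝ)..β, max x 0 ^ (a - 1) = max β 0 ^ a / a := by
    intro β
    rcases le_total 0 β with h | h
    · rw [intervalIntegral.integral_congr (g := fun x => x ^ (a - 1)), integral_rpow]
      · rw [max_eq_left h, sub_add_cancel, Real.zero_rpow ha.ne', sub_zero]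
      · left; linarith
      · intro x hx
        rw [uIcc_of_le h] at hx
        simp only
        rw [max_eq_left hx.1]
    · rw [intervalIntegral.integral_congr (g := fun x => 0)]
      · rw [max_eq_right h, Real.zero_rpow ha.ne']; simp
      · intro x hx
        rw [uIcc_of_ge h] at hx
        simp only
        rw [max_eq_right hx.2, Real.zero_rpow (by linarith)]
  rw [← intervalIntegral.integral_interval_sub_left (intervalIntegrable_posPart_rpow ha 0 β)
    (intervalIntegrable_posPart_rpow ha 0 α), h0, h0]
  ring

/-- Writing the kernel as an integral of its derivative makes its square a double integral of
nonnegative terms, to which Tonelli applies. -/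
lemma lintegral_posPart_rpow_sub {a : ℝ} (ha : 0 < a) (ha' : a < 1) (v : ℝ) :
    ENNReal.ofReal (max (1 - v) 0 ^ a - max (-v) 0 ^ a)
      = ENNReal.ofReal a * ∫⁻ u in Ioc (0 : ℝ) 1, ENNReal.ofReal (max (u - v) 0 ^ (a - 1)) := by
  have hi : IntervalIntegrable (fun u : ℝ => max (u - v) 0 ^ (a - 1)) volume 0 1 := by
    have := (intervalIntegrable_posPart_rpow ha (0 - v) (1 - v)).comp_sub_right v
    simpa using this
  rw [← ofReal_integral_eq_lintegral_ofReal, ← ENNReal.ofReal_mul ha.le,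
    ← intervalIntegral.integral_of_le zero_le_one,
    intervalIntegral.integral_comp_sub_right (fun x => max x 0 ^ (a - 1)),
    integral_posPart_rpow ha ha', zero_sub, mul_div_cancel₀ _ ha.ne']
  · exact (intervalIntegrable_iff_integrableOn_Ioc_of_le zero_le_one).1 hi
  · exact Eventually.of_forall fun x => by simp only [Pi.zero_apply]; positivity

lemma lintegral_abs_sub_rpow {r u : ℝ} (hr : -1 < r) (hu : u ∈ Icc (0 : ℝ) 1) :
    ∫⁻ w in Ioc (0 : ℝ) 1, ENNReal.ofReal (|w - u| ^ r)
      = ENNReal.ofReal ((u ^ (r + 1) + (1 - u) ^ (r + 1)) / (r + 1)) := by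
  have i1 : IntervalIntegrable (fun x : ℝ => |x| ^ r) volume (-u) 0 := by
    have : IntervalIntegrable (fun x : ℝ => x ^ r) volume u 0 :=
      intervalIntegral.intervalIntegrable_rpow' hr
    have := (IntervalIntegrable.iff_comp_neg).1 this
    rw [neg_zero] at this
    refine this.congr fun x hx => ?_
    rw [uIoc_of_le (by linarith [hu.1])] at hx
    rw [abs_of_nonpos hx.2]
  have i2 : IntervalIntegrable (fun x : ℝ => |x| ^ r) volume 0 (1 - u) := by
    have : IntervalIntegrable (fun x : ℝ => x ^ r) volume 0 (1 - u) :=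
      intervalIntegral.intervalIntegrable_rpow' hr
    refine this.congr fun x hx => ?_
    rw [uIoc_of_le (by linarith [hu.2])] at hx
    rw [abs_of_nonneg hx.1.le]
  have hi : IntervalIntegrable (fun w : ℝ => |w - u| ^ r) volume 0 1 := by
    have := (i1.trans i2).comp_sub_right u
    simpa using this
  rw [← ofReal_integral_eq_lintegral_ofReal, ← intervalIntegral.integral_of_le zero_le_one,
    intervalIntegral.integral_comp_sub_right (fun x => |x| ^ r), zero_sub,
    ← intervalIntegral.integral_add_adjacent_intervals i1 i2]
  · congr 1
    rw [intervalIntegral.integral_congr (a := 0) (b := 1 - u) (g := fun x => x ^ r),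
      integral_rpow (Or.inl hr), Real.zero_rpow (by linarith)]
    · have : ∫ x in (-u)..0, |x| ^ r = ∫ x in (-u)..(-0), (fun y : ℝ => y ^ r) (-x) := by
        rw [neg_zero]
        refine intervalIntegral.integral_congr fun x hx => ?_
        rw [uIcc_of_le (by linarith [hu.1])] at hx
        simp only
        rw [abs_of_nonpos hx.2]
      rw [this, intervalIntegral.integral_comp_neg (fun y : ℝ => y ^ r), neg_neg, integral_rpow (Or.inl hr),
        Real.zero_rpow (by linarith)]
      ring_nf
    · intro x hx
      rw [uIcc_of_le (by linarith [hu.2])] at hx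
      simp only
      rw [abs_of_nonneg hx.1]
  · exact (intervalIntegrable_iff_integrableOn_Ioc_of_le zero_le_one).1 hi
  · exact Eventually.of_forall fun x => by simp only [Pi.zero_apply]; positivity

/-- The squared `L²` norm of the unnormalized unit Mandelbrot--Van Ness kernel. -/
lemma lintegral_unit_kernel_sq {a : ℝ} (ha : 0 < a) (ha' : a < 1 / 2) :
    ∫⁻ v, ENNReal.ofReal (max (1 - v) 0 ^ a - max (-v) 0 ^ a) ^ 2
      = ENNReal.ofReal (a * (Real.Gamma a * Real.Gamma (1 - 2 * a) / Real.Gamma (1 - a))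
          / (2 * a + 1)) := by
  have hB : 0 ≤ Real.Gamma a * Real.Gamma (1 - 2 * a) / Real.Gamma (1 - a) := by
    have := Real.Gamma_pos_of_pos ha
    have := Real.Gamma_pos_of_pos (show 0 < 1 - 2 * a by linarith)
    have := Real.Gamma_pos_of_pos (show 0 < 1 - a by linarith)
    positivity
  set Bc := Real.Gamma a * Real.Gamma (1 - 2 * a) / Real.Gamma (1 - a) with hBc
  let p : ℝ → ℝ≥0∞ := fun x => ENNReal.ofReal (max x 0 ^ (a - 1))
  have hp : Measurable p := by fun_prop
  -- Square the integral representation and integrate over `v` before `u` and `w`: the `v`-integral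
  -- is a multiple of `|w - u|^(2a-1)`, which is integrable on the unit square.
  calc _ = ∫⁻ v, ENNReal.ofReal a ^ 2 *
        ∫⁻ u in Ioc (0 : ℝ) 1, ∫⁻ w in Ioc (0 : ℝ) 1, p (u - v) * p (w - v) := by
        refine lintegral_congr fun v => ?_
        rw [lintegral_posPart_rpow_sub ha (by linarith) v, mul_pow]
        congr 1
        rw [lintegral_lintegral_mul (by fun_prop) (by fun_prop), sq]
    _ = ENNReal.ofReal a ^ 2 * ∫⁻ u in Ioc (0 : ℝ) 1, ∫⁻ w in Ioc (0 : ℝ) 1, ∫⁻ v,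
          p (u - v) * p (w - v) := by
        rw [lintegral_const_mul, lintegral_lintegral_swap]
        · congr 1
          refine lintegral_congr fun u => ?_
          rw [lintegral_lintegral_swap]
          fun_prop
        · refine Measurable.aemeasurable ?_
          exact Measurable.lintegral_prod_right' (f := fun q : (ℝ × ℝ) × ℝ =>
            p (q.1.2 - q.1.1) * p (q.2 - q.1.1)) (by fun_prop)
        · refine Measurable.lintegral_prod_right' (f := fun q : ℝ × ℝ =>
            ∫⁻ w in Ioc (0 : ℝ) 1, p (q.2 - q.1) * p (w - q.1)) ?_
          exact Measurable.lintegral_prod_right' (f := fun q : (ℝ × ℝ) × ℝ =>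
            p (q.1.2 - q.1.1) * p (q.2 - q.1.1)) (by fun_prop)
    _ = ENNReal.ofReal a ^ 2 * ∫⁻ u in Ioc (0 : ℝ) 1,
          ENNReal.ofReal (Bc * ((u ^ (2 * a) + (1 - u) ^ (2 * a)) / (2 * a))) := by
        congr 1
        refine setLIntegral_congr_fun measurableSet_Ioc fun u hu => ?_
        rw [ENNReal.ofReal_mul hB]
        have := lintegral_abs_sub_rpow (r := 2 * a - 1) (by linarith) (Ioc_subset_Icc_self hu)
        rw [sub_add_cancel] at this
        rw [← this, ← lintegral_const_mul _ (by fun_prop)]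
        refine lintegral_congr_ae (ae_restrict_of_ae ?_)
        -- On the diagonal the `v`-integral diverges and the closed form fails, but for fixed `u`
        -- this is a single point.
        have hne : ∀ᵐ w : ℝ, w ≠ u := by
          simp [ae_iff, measure_singleton]
        filter_upwards [hne] with w hw
        rw [← ENNReal.ofReal_mul hB]
        rcases lt_or_gt_of_ne hw with h | h
        · have := lintegral_posPart_rpow_mul ha ha' h
          rw [abs_of_neg (by linarith), neg_sub, hBc, ← this]
          refine lintegral_congr fun v => mul_comm _ _
        · rw [abs_of_pos (by linarith), hBc, ← lintegral_posPart_rpow_mul ha ha' h]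
    _ = _ := by
        have i1 : IntervalIntegrable (fun x : ℝ => x ^ (2 * a)) volume 0 1 :=
          intervalIntegral.intervalIntegrable_rpow' (by linarith)
        have i2 : IntervalIntegrable (fun x : ℝ => (1 - x) ^ (2 * a)) volume 0 1 := by
          have : IntervalIntegrable (fun x : ℝ => x ^ (2 * a)) volume (1 - 0) (1 - 1) :=
            intervalIntegral.intervalIntegrable_rpow' (by linarith)
          simpa using this.comp_sub_left 1
        have hi := ((i1.add i2).div_const (2 * a)).const_mul Bc
        rw [← ofReal_integral_eq_lintegral_ofReal, ← ENNReal.ofReal_pow ha.le,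
          ← ENNReal.ofReal_mul (by positivity), ← intervalIntegral.integral_of_le zero_le_one,
          intervalIntegral.integral_const_mul, intervalIntegral.integral_div,
          intervalIntegral.integral_add i1 i2,
          intervalIntegral.integral_comp_sub_left (fun x => x ^ (2 * a)),
          integral_rpow (Or.inl (by linarith))]
        · congr 1
          rw [sub_self, sub_zero, integral_rpow (Or.inl (by linarith)),
            Real.zero_rpow (by linarith), Real.one_rpow]
          field_simp
          ring
        · exact (intervalIntegrable_iff_integrableOn_Ioc_of_le zero_le_one).1 hi
        · filter_upwards [ae_restrict_mem measurableSet_Ioc] with u hu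
          have := hu.1
          have : 0 ≤ 1 - u := by linarith [hu.2]
          simp only [Pi.zero_apply]
          positivity

/-- Euler's reflection formula at `a` and at `2a`, together with `sin 2x = 2 sin x cos x`,
eliminates `Γ(1-a)` and `Γ(1-2a)`. -/
lemma unit_kernel_const {a : ℝ} (ha : 0 < a) (ha' : a < 1 / 2) :
    a * (Real.Gamma a * Real.Gamma (1 - 2 * a) / Real.Gamma (1 - a)) / (2 * a + 1)
      = Real.Gamma (a + 1) ^ 2 / (Real.Gamma (2 * a + 2) * Real.cos (Real.pi * a)) := by
  have hpi := Real.pi_pos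
  have g1 := Real.Gamma_mul_Gamma_one_sub a
  have g2 := Real.Gamma_mul_Gamma_one_sub (2 * a)
  have p1 := Real.Gamma_pos_of_pos ha
  have p2 := Real.Gamma_pos_of_pos (show 0 < 2 * a by linarith)
  have p3 := Real.Gamma_pos_of_pos (show 0 < 1 - a by linarith)
  have hc : 0 < Real.cos (Real.pi * a) :=
    Real.cos_pos_of_mem_Ioo ⟨by nlinarith, by nlinarith⟩
  have hs : 0 < Real.sin (Real.pi * a) := Real.sin_pos_of_pos_of_lt_pi (by nlinarith) (by nlinarith)
  have e1 : Real.Gamma (a + 1) = a * Real.Gamma a := Real.Gamma_add_one ha.ne'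
  have e2 : Real.Gamma (2 * a + 2) = (2 * a + 1) * (2 * a * Real.Gamma (2 * a)) := by
    rw [show 2 * a + 2 = (2 * a + 1) + 1 by ring, Real.Gamma_add_one (by linarith),
      Real.Gamma_add_one (by linarith)]
  have s2 : Real.sin (Real.pi * (2 * a)) = 2 * Real.sin (Real.pi * a) * Real.cos (Real.pi * a) := by
    rw [← Real.sin_two_mul]; congr 1; ring
  have q1 : Real.Gamma (1 - a) = Real.pi / Real.sin (Real.pi * a) / Real.Gamma a := by
    rw [← g1]; field_simp
  have q2 : Real.Gamma (1 - 2 * a)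
      = Real.pi / (2 * Real.sin (Real.pi * a) * Real.cos (Real.pi * a)) / Real.Gamma (2 * a) := by
    rw [← s2, ← g2]; field_simp
  rw [e1, e2, q1, q2]
  generalize Real.sin (Real.pi * a) = S at *
  generalize Real.cos (Real.pi * a) = C at *
  field_simp

/-! ### Increments of the Mandelbrot–Van Ness kernel and the limit covariance -/

variable {H : ℝ}

lemma unit_kernel_nonneg {a : ℝ} (ha : 0 < a) (v : ℝ) :
    0 ≤ max (1 - v) 0 ^ a - max (-v) 0 ^ a := by
  rw [sub_nonneg]
  exact Real.rpow_le_rpow (le_max_right _ _) (max_le_max (by linarith) le_rfl) ha.le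

lemma sin_pi_mul_eq_cos (H : ℝ) : Real.sin (Real.pi * H) = Real.cos (Real.pi * (H - 1 / 2)) := by
  rw [← Real.sin_add_pi_div_two]; congr 1; ring

lemma sin_pi_mul_pos (hH : H ∈ Ioo (1 / 2 : ℝ) 1) : 0 < Real.sin (Real.pi * H) :=
  Real.sin_pos_of_pos_of_lt_pi (by nlinarith [Real.pi_pos, hH.1])
    (by nlinarith [Real.pi_pos, hH.2])

lemma Gamma_add_half_pos (hH : H ∈ Ioo (1 / 2 : ℝ) 1) : 0 < Real.Gamma (H + 1 / 2) :=
  Real.Gamma_pos_of_pos (by linarith [hH.1])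

lemma sigmaHSq_pos (hH : H ∈ Ioo (1 / 2 : ℝ) 1) : 0 < sigmaHSq H := by
  have := sin_pi_mul_pos hH
  have := Real.Gamma_pos_of_pos (show 0 < 2 * H + 1 by linarith [hH.1])
  rw [sigmaHSq]; positivity

lemma lintegral_unit_kernel_sq' (hH : H ∈ Ioo (1 / 2 : ℝ) 1) :
    ∫⁻ v, ENNReal.ofReal ((max (1 - v) 0 ^ (H - 1 / 2) - max (-v) 0 ^ (H - 1 / 2)) ^ 2)
      = ENNReal.ofReal (Real.Gamma (H + 1 / 2) ^ 2 * sigmaHSq H) := by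
  have ha : 0 < H - 1 / 2 := by linarith [hH.1]
  simp_rw [ENNReal.ofReal_pow (unit_kernel_nonneg ha _)]
  rw [lintegral_unit_kernel_sq ha (by linarith [hH.2]), unit_kernel_const ha (by linarith [hH.2]),
    sigmaHSq, sin_pi_mul_eq_cos]
  congr 1
  rw [show H - 1 / 2 + 1 = H + 1 / 2 by ring, show 2 * (H - 1 / 2) + 2 = 2 * H + 1 by ring]
  ring

lemma measurable_unit_kernel (a : ℝ) :
    Measurable fun v : ℝ => max (1 - v) 0 ^ a - max (-v) 0 ^ a := by
  fun_prop

lemma integrable_unit_kernel_sq (hH : H ∈ Ioo (1 / 2 : ℝ) 1) :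
    Integrable fun v : ℝ => (max (1 - v) 0 ^ (H - 1 / 2) - max (-v) 0 ^ (H - 1 / 2)) ^ 2 := by
  refine ⟨((measurable_unit_kernel _).pow_const 2).aestronglyMeasurable, ?_⟩
  rw [hasFiniteIntegral_iff_ofReal (Eventually.of_forall fun v => sq_nonneg _),
    lintegral_unit_kernel_sq' hH]
  exact ENNReal.ofReal_lt_top

lemma integral_unit_kernel_sq (hH : H ∈ Ioo (1 / 2 : ℝ) 1) :
    ∫ v, (max (1 - v) 0 ^ (H - 1 / 2) - max (-v) 0 ^ (H - 1 / 2)) ^ 2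
      = Real.Gamma (H + 1 / 2) ^ 2 * sigmaHSq H := by
  rw [integral_eq_lintegral_of_nonneg_ae (Eventually.of_forall fun v => sq_nonneg _)
    ((measurable_unit_kernel _).pow_const 2).aestronglyMeasurable, lintegral_unit_kernel_sq' hH,
    ENNReal.toReal_ofReal]
  have := sigmaHSq_pos hH
  positivity

lemma mandelbrotKernel_sub (H t T v : ℝ) : mandelbrotKernel H T v - mandelbrotKernel H t v
    = (Real.Gamma (H + 1 / 2))⁻¹
      * (max (T - v) 0 ^ (H - 1 / 2) - max (t - v) 0 ^ (H - 1 / 2)) := by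
  simp only [mandelbrotKernel]; ring

lemma integral_mandelbrotKernel_sub_sq (hH : H ∈ Ioo (1 / 2 : ℝ) 1) {t T : ℝ} (htT : t ≤ T) :
    ∫ v, (mandelbrotKernel H T v - mandelbrotKernel H t v) ^ 2
      = sigmaHSq H * (T - t) ^ (2 * H) := by
  have hH0 : 0 < H := by linarith [hH.1]
  rcases htT.eq_or_lt with rfl | h
  · simp [Real.zero_rpow (by positivity : 2 * H ≠ 0)]
  have hh : 0 < T - t := sub_pos.2 h
  set h := T - t with hdef
  -- Self-similarity: with `v = h w + t`, the increment over `[t, T]` is `h^(H-1/2)` times the unit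
  -- kernel, up to the Gamma factor.
  have e : ∀ w : ℝ, (mandelbrotKernel H T (h * w + t) - mandelbrotKernel H t (h * w + t)) ^ 2
      = ((Real.Gamma (H + 1 / 2))⁻¹ ^ 2 * h ^ (2 * H - 1)) *
        (max (1 - w) 0 ^ (H - 1 / 2) - max (-w) 0 ^ (H - 1 / 2)) ^ 2 := by
    intro w
    have e1 : max (T - (h * w + t)) 0 = h * max (1 - w) 0 := by
      rw [mul_max_of_nonneg _ _ hh.le]; congr 1 <;> rw [hdef] <;> ring
    have e2 : max (t - (h * w + t)) 0 = h * max (-w) 0 := by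
      rw [mul_max_of_nonneg _ _ hh.le]; congr 1 <;> ring
    have e3 : h ^ (2 * H - 1) = h ^ (H - 1 / 2) * h ^ (H - 1 / 2) := by
      rw [← Real.rpow_add hh]; congr 1; ring
    rw [mandelbrotKernel_sub, e1, e2, Real.mul_rpow hh.le (le_max_right _ _),
      Real.mul_rpow hh.le (le_max_right _ _), e3]
    ring
  have e4 := Measure.integral_comp_mul_left
    (fun x => (mandelbrotKernel H T (x + t) - mandelbrotKernel H t (x + t)) ^ 2) h
  simp only [e] at e4
  rw [integral_const_mul, integral_unit_kernel_sq hH,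
    integral_add_right_eq_self (fun x => (mandelbrotKernel H T x - mandelbrotKernel H t x) ^ 2),
    abs_of_pos (inv_pos.2 hh), smul_eq_mul] at e4
  have hG := Gamma_add_half_pos hH
  have e5 : h ^ (2 * H) = h ^ (2 * H - 1) * h := by
    rw [← Real.rpow_add_one hh.ne']; congr 1; ring
  rw [e5]
  generalize h ^ (2 * H - 1) = p at e4
  field_simp at e4
  linarith

/-- The tail of the squared increment of the kernel, before a time `t`. -/
lemma setIntegral_mandelbrotKernel_sub_sq_le (hH : H ∈ Ioo (1 / 2 : ℝ) 1) {t r s : ℝ} (htr : t < r)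
    (hrs : r ≤ s) :
    ∫ v in Iic t, (mandelbrotKernel H s v - mandelbrotKernel H r v) ^ 2
      ≤ (Real.Gamma (H + 1 / 2))⁻¹ ^ 2 * (H - 1 / 2) ^ 2 / (2 - 2 * H)
        * ((s - r) ^ 2 * (r - t) ^ (2 * H - 2)) := by
  have hG := Gamma_add_half_pos hH
  have ha : 0 < H - 1 / 2 := by linarith [hH.1]
  have ha1 : H - 1 / 2 < 1 := by linarith [hH.2]
  have bound : ∀ v ∈ Iic t, (mandelbrotKernel H s v - mandelbrotKernel H r v) ^ 2
      ≤ (Real.Gamma (H + 1 / 2))⁻¹ ^ 2 * (H - 1 / 2) ^ 2 * (s - r) ^ 2 * (r - v) ^ (2 * H - 3) := by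
    intro v hv
    have hv : v ≤ t := hv
    have hrv : 0 < r - v := by linarith
    have hsv : 0 < s - v := by linarith
    rw [mandelbrotKernel_sub, max_eq_left hrv.le, max_eq_left hsv.le]
    have lo : 0 ≤ (s - v) ^ (H - 1 / 2) - (r - v) ^ (H - 1 / 2) :=
      sub_nonneg.2 (Real.rpow_le_rpow hrv.le (by linarith) ha.le)
    -- Bernoulli's inequality: the power `H - 1/2` lies in `(0, 1)`, so the function is concave and
    -- stays below its tangent at `r - v`.
    have up : (s - v) ^ (H - 1 / 2) - (r - v) ^ (H - 1 / 2)
        ≤ (H - 1 / 2) * (r - v) ^ (H - 1 / 2 - 1) * (s - r) := by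
      have h1 : (s - v) = (r - v) * (1 + (s - r) / (r - v)) := by field_simp; ring
      have h2 : (1 + (s - r) / (r - v)) ^ (H - 1 / 2) ≤ 1 + (H - 1 / 2) * ((s - r) / (r - v)) :=
        rpow_one_add_le_one_add_mul_self (by
          have : 0 ≤ (s - r) / (r - v) := div_nonneg (by linarith) hrv.le
          linarith) ha.le ha1.le
      have h3 : 0 ≤ 1 + (s - r) / (r - v) := by
        have : 0 ≤ (s - r) / (r - v) := div_nonneg (by linarith) hrv.le
        linarith
      rw [h1, Real.mul_rpow hrv.le h3, Real.rpow_sub_one hrv.ne']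
      have := mul_le_mul_of_nonneg_left h2 (Real.rpow_nonneg hrv.le (H - 1 / 2))
      calc _ ≤ (r - v) ^ (H - 1 / 2) * (1 + (H - 1 / 2) * ((s - r) / (r - v)))
            - (r - v) ^ (H - 1 / 2) := by linarith
        _ = _ := by field_simp; ring
    have hsq : ((s - v) ^ (H - 1 / 2) - (r - v) ^ (H - 1 / 2)) ^ 2
        ≤ ((H - 1 / 2) * (r - v) ^ (H - 1 / 2 - 1) * (s - r)) ^ 2 :=
      pow_le_pow_left₀ lo up 2
    have e3 : (r - v) ^ (2 * H - 3) = (r - v) ^ (H - 1 / 2 - 1) * (r - v) ^ (H - 1 / 2 - 1) := by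
      rw [← Real.rpow_add hrv]; congr 1; ring
    rw [mul_pow, e3]
    calc _ ≤ (Real.Gamma (H + 1 / 2))⁻¹ ^ 2 *
          ((H - 1 / 2) * (r - v) ^ (H - 1 / 2 - 1) * (s - r)) ^ 2 := by gcongr
      _ = _ := by ring
  have hint0 : IntegrableOn (fun x : ℝ => x ^ (2 * H - 3)) (Ioi (r - t)) :=
    integrableOn_Ioi_rpow_of_lt (by linarith [hH.2]) (sub_pos.2 htr)
  have hmp : MeasurePreserving (fun v : ℝ => r - v) volume volume :=
    Measure.measurePreserving_sub_left volume r
  have hpre : (fun v : ℝ => r - v) ⁻¹' (Ici (r - t)) = Iic t := by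
    ext v; simp
  have hemb : MeasurableEmbedding (fun v : ℝ => r - v) :=
    (Homeomorph.subLeft r).measurableEmbedding
  have hint : IntegrableOn (fun v : ℝ => (r - v) ^ (2 * H - 3)) (Iic t) := by
    have := (hmp.integrableOn_comp_preimage hemb (f := fun x : ℝ => x ^ (2 * H - 3))
      (s := Ici (r - t))).2 ((integrableOn_Ici_iff_integrableOn_Ioi).2 hint0)
    rwa [hpre] at this
  have hval : ∫ v in Iic t, (r - v) ^ (2 * H - 3) = (r - t) ^ (2 * H - 2) / (2 - 2 * H) := by
    have := hmp.setIntegral_preimage_emb hemb (fun x : ℝ => x ^ (2 * H - 3)) (Ici (r - t))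
    rw [hpre] at this
    rw [this, integral_Ici_eq_integral_Ioi,
      integral_Ioi_rpow_of_lt (by linarith [hH.2]) (sub_pos.2 htr),
      show 2 * H - 3 + 1 = 2 * H - 2 by ring, neg_div, ← div_neg, neg_sub]
  calc _ ≤ ∫ v in Iic t, (Real.Gamma (H + 1 / 2))⁻¹ ^ 2 * (H - 1 / 2) ^ 2 * (s - r) ^ 2
        * (r - v) ^ (2 * H - 3) := by
        refine integral_mono_of_nonneg (Eventually.of_forall fun v => sq_nonneg _)
          (hint.const_mul _) ?_
        filter_upwards [ae_restrict_mem measurableSet_Iic] with v hv using bound v hv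
    _ = _ := by rw [integral_const_mul, hval]; ring

/-- Split the squared unit kernel at `0`. For `v > 0` only `(1-v)_+^(2H-1)` survives and contributes
`1/(2H)`; what is left is the part carried by the past. This is the origin of the subtracted term in
`sigmaPhiSq`. -/
lemma setIntegral_Ioi_unit_kernel_sq (hH : H ∈ Ioo (1 / 2 : ℝ) 1) :
    ∫ u in Ioi (0 : ℝ), ((1 + u) ^ (H - 1 / 2) - u ^ (H - 1 / 2)) ^ 2
      = Real.Gamma (H + 1 / 2) ^ 2 * sigmaHSq H - 1 / (2 * H) := by
  have ha : 0 < H - 1 / 2 := by linarith [hH.1]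
  set f : ℝ → ℝ := fun v => (max (1 - v) 0 ^ (H - 1 / 2) - max (-v) 0 ^ (H - 1 / 2)) ^ 2 with hf
  have hfi : Integrable f := integrable_unit_kernel_sq hH
  have h1 : ∫ v in Iic (0 : ℝ), f v
      = ∫ u in Ioi (0 : ℝ), ((1 + u) ^ (H - 1 / 2) - u ^ (H - 1 / 2)) ^ 2 := by
    have := integral_comp_neg_Ioi (0 : ℝ) f
    rw [neg_zero] at this
    rw [← this]
    refine setIntegral_congr_fun measurableSet_Ioi fun u hu => ?_
    have hu : (0 : ℝ) < u := hu
    simp only [hf, neg_neg, sub_neg_eq_add]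
    rw [max_eq_left (by linarith), max_eq_left hu.le]
  have h2 : ∫ v in Ioi (0 : ℝ), f v = 1 / (2 * H) := by
    have e : ∀ v ∈ Ioi (0 : ℝ), f v = (Ioc (0 : ℝ) 1).indicator (fun v => (1 - v) ^ (2 * H - 1)) v := by
      intro v hv
      have hv : (0 : ℝ) < v := hv
      simp only [hf]
      rw [max_eq_right (by linarith : -v ≤ 0), Real.zero_rpow ha.ne', sub_zero]
      by_cases h : v ≤ 1
      · rw [indicator_of_mem (show v ∈ Ioc (0 : ℝ) 1 from ⟨hv, h⟩), max_eq_left (by linarith), ← Real.rpow_natCast,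
          ← Real.rpow_mul (by linarith)]
        congr 1; push_cast; ring
      · rw [indicator_of_notMem (fun h' => h h'.2), max_eq_right (by linarith),
          Real.zero_rpow ha.ne']
        simp
    rw [setIntegral_congr_fun measurableSet_Ioi e, setIntegral_indicator measurableSet_Ioc,
      inter_eq_self_of_subset_right Ioc_subset_Ioi_self, ← intervalIntegral.integral_of_le zero_le_one,
      intervalIntegral.integral_comp_sub_left (fun x => x ^ (2 * H - 1)), sub_self, sub_zero,
      integral_rpow (Or.inl (by linarith [hH.1])), sub_add_cancel, Real.one_rpow,
      Real.zero_rpow (by linarith [hH.1]), sub_zero]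
  have h3 : (∫ v in Iic (0 : ℝ), f v) + (∫ v in Ioi (0 : ℝ), f v) = ∫ v, f v := by
    exact intervalIntegral.integral_Iic_add_Ioi (b := (0 : ℝ)) hfi.integrableOn hfi.integrableOn
  rw [← h1, ← integral_unit_kernel_sq hH]
  linarith

lemma setIntegral_Ioi_unit_kernel_sq_pos (hH : H ∈ Ioo (1 / 2 : ℝ) 1) :
    0 < ∫ u in Ioi (0 : ℝ), ((1 + u) ^ (H - 1 / 2) - u ^ (H - 1 / 2)) ^ 2 := by
  have ha : 0 < H - 1 / 2 := by linarith [hH.1]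
  have hi : IntegrableOn (fun u : ℝ => ((1 + u) ^ (H - 1 / 2) - u ^ (H - 1 / 2)) ^ 2) (Ioi 0) := by
    have := ((integrable_unit_kernel_sq hH).comp_neg).integrableOn (s := Ioi 0)
    refine this.congr_fun (fun u hu => ?_) measurableSet_Ioi
    have hu : (0 : ℝ) < u := hu
    simp only [neg_neg, sub_neg_eq_add]
    rw [max_eq_left (by linarith), max_eq_left hu.le]
  rw [setIntegral_pos_iff_support_of_nonneg_ae (Eventually.of_forall fun v => sq_nonneg _) hi]
  have : Ioi (0 : ℝ) ⊆ (Function.support fun u : ℝ =>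
      ((1 + u) ^ (H - 1 / 2) - u ^ (H - 1 / 2)) ^ 2) ∩ Ioi 0 := by
    intro u hu
    refine ⟨?_, hu⟩
    have hu' : (0 : ℝ) < u := hu
    have : u ^ (H - 1 / 2) < (1 + u) ^ (H - 1 / 2) :=
      Real.rpow_lt_rpow hu'.le (by linarith) ha
    simp only [Function.mem_support]
    have : 0 < (1 + u) ^ (H - 1 / 2) - u ^ (H - 1 / 2) := by linarith
    positivity
  refine lt_of_lt_of_le ?_ (measure_mono this)
  simp

lemma sigmaPhiSq_eq (hH : H ∈ Ioo (1 / 2 : ℝ) 1) (F : ℝ → ℝ) :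
    sigmaPhiSq H F = meanFF' H F ^ 2 * ((Real.Gamma (H + 1 / 2))⁻¹ ^ 2
      * ∫ u in Ioi (0 : ℝ), ((1 + u) ^ (H - 1 / 2) - u ^ (H - 1 / 2)) ^ 2) := by
  have hG := Gamma_add_half_pos hH
  have hH0 : 0 < H := by linarith [hH.1]
  rw [setIntegral_Ioi_unit_kernel_sq hH, sigmaPhiSq, ← sigmaHSq]
  field_simp

/-- The covariance of the limit field is a truncated inner product of kernel increments. -/
lemma limitCov_eq (hH : H ∈ Ioo (1 / 2 : ℝ) 1) (F : ℝ → ℝ) {t t' T T' : ℝ} (htt' : t ≤ t')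
    (htT : t ≤ T) (htT' : t' ≤ T') :
    limitCov H F t t' T T' = meanFF' H F ^ 2 * ∫ v in Iic t,
      (mandelbrotKernel H T v - mandelbrotKernel H t v)
        * (mandelbrotKernel H T' v - mandelbrotKernel H t' v) := by
  have hH0 : 0 < H := by linarith [hH.1]
  rcases htT.eq_or_lt with rfl | h
  · simp [limitCov, Real.zero_rpow hH0.ne']
  rcases htT'.eq_or_lt with rfl | h'
  · simp [limitCov, Real.zero_rpow hH0.ne']
  have hx : 0 < T - t := sub_pos.2 h
  have hy : 0 < T' - t' := sub_pos.2 h'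
  have hxy : 0 < (T - t) * (T' - t') := mul_pos hx hy
  -- The scale is the geometric mean of the two durations. The substitution `v = t - l u` produces
  -- the ratios `q`, `r`, `s` of `corrPhi`, and the total power `l^(2H)` factors as `(T-t)^H
  -- (T'-t')^H`.
  set l := √((T - t) * (T' - t')) with hl
  have hl0 : 0 < l := Real.sqrt_pos.2 hxy
  have hDpos := setIntegral_Ioi_unit_kernel_sq_pos hH
  have hpow : l ^ (2 * (H - 1 / 2) + 1) = (T - t) ^ H * (T' - t') ^ H := by
    rw [hl, Real.sqrt_eq_rpow, ← Real.rpow_mul hxy.le, ← Real.mul_rpow hx.le hy.le]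
    congr 1; ring
  have hr : T - t = l * (√(T - t) / √(T' - t')) := by
    rw [hl, Real.sqrt_mul hx.le]
    have := Real.mul_self_sqrt hx.le
    have : 0 < √(T' - t') := Real.sqrt_pos.2 hy
    field_simp
    linarith
  have hchange : ∫ v in Iic t, (mandelbrotKernel H T v - mandelbrotKernel H t v)
        * (mandelbrotKernel H T' v - mandelbrotKernel H t' v)
      = l * ∫ u in Ioi (0 : ℝ), (mandelbrotKernel H T (t - l * u) - mandelbrotKernel H t (t - l * u))
        * (mandelbrotKernel H T' (t - l * u) - mandelbrotKernel H t' (t - l * u)) := by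
    set g : ℝ → ℝ := fun v => (mandelbrotKernel H T v - mandelbrotKernel H t v)
        * (mandelbrotKernel H T' v - mandelbrotKernel H t' v) with hg
    have hmp : MeasurePreserving (fun v : ℝ => t - v) volume volume :=
      Measure.measurePreserving_sub_left volume t
    have hpre : (fun v : ℝ => t - v) ⁻¹' (Iic t) = Ici 0 := by
      ext v; simp
    have hemb : MeasurableEmbedding (fun v : ℝ => t - v) :=
      (Homeomorph.subLeft t).measurableEmbedding
    have e1 := hmp.setIntegral_preimage_emb hemb g (Iic t)
    rw [hpre, integral_Ici_eq_integral_Ioi] at e1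
    have e2 := integral_comp_mul_left_Ioi (fun x => g (t - x)) 0 hl0
    rw [mul_zero, smul_eq_mul] at e2
    rw [← e1, e2, mul_inv_cancel_left₀ hl0.ne']
  rw [hchange, limitCov, corrPhi, sigmaPhiSq_eq hH]
  set D := ∫ u in Ioi (0 : ℝ), ((1 + u) ^ (H - 1 / 2) - u ^ (H - 1 / 2)) ^ 2 with hD
  simp only [← hl]
  have hinner : ∀ u ∈ Ioi (0 : ℝ), (mandelbrotKernel H T (t - l * u) - mandelbrotKernel H t (t - l * u))
        * (mandelbrotKernel H T' (t - l * u) - mandelbrotKernel H t' (t - l * u))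
      = ((Real.Gamma (H + 1 / 2))⁻¹ ^ 2 * l ^ (2 * (H - 1 / 2))) *
        (((u + √(T - t) / √(T' - t')) ^ (H - 1 / 2) - u ^ (H - 1 / 2)) *
          ((u + (T' - t) / l) ^ (H - 1 / 2) - (u + (t' - t) / l) ^ (H - 1 / 2))) := by
    intro u hu
    have hu : (0 : ℝ) < u := hu
    have hlu := mul_pos hl0 hu
    have e1 : max (T - (t - l * u)) 0 = l * (u + √(T - t) / √(T' - t')) := by
      rw [max_eq_left (by linarith), mul_add, ← hr]; ring
    have e2 : max (t - (t - l * u)) 0 = l * u := by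
      rw [max_eq_left (by linarith)]; ring
    have e3 : max (T' - (t - l * u)) 0 = l * (u + (T' - t) / l) := by
      rw [max_eq_left (by linarith)]; field_simp; ring
    have e4 : max (t' - (t - l * u)) 0 = l * (u + (t' - t) / l) := by
      rw [max_eq_left (by linarith)]; field_simp; ring
    have q1 : 0 ≤ u + √(T - t) / √(T' - t') := by positivity
    have q3 : 0 ≤ u + (T' - t) / l := by
      have : 0 ≤ (T' - t) / l := div_nonneg (by linarith) hl0.le
      linarith
    have q4 : 0 ≤ u + (t' - t) / l := by
      have : 0 ≤ (t' - t) / l := div_nonneg (by linarith) hl0.le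
      linarith
    rw [mandelbrotKernel_sub, mandelbrotKernel_sub, e1, e2, e3, e4, Real.mul_rpow hl0.le q1,
      Real.mul_rpow hl0.le hu.le, Real.mul_rpow hl0.le q3, Real.mul_rpow hl0.le q4,
      two_mul, Real.rpow_add hl0]
    ring
  rw [setIntegral_congr_fun measurableSet_Ioi hinner, integral_const_mul]
  rw [Real.rpow_add_one hl0.ne'] at hpow
  have := hDpos.ne'
  rw [mul_assoc _ ((T - t) ^ H) ((T' - t') ^ H), ← hpow]
  generalize (∫ u in Ioi (0 : ℝ), ((u + √(T - t) / √(T' - t')) ^ (H - 1 / 2) - u ^ (H - 1 / 2)) *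
          ((u + (T' - t) / l) ^ (H - 1 / 2) - (u + (t' - t) / l) ^ (H - 1 / 2))) = N
  field_simp

/-! ### The Gaussian Hilbert space of a centered Gaussian process -/

section GaussianSpace

variable {Ω : Type u} [MeasurableSpace Ω] {P : Measure Ω}

lemma inner_Lp_eq_integral (f g : Lp ℝ 2 P) : inner ℝ f g = ∫ ω, f ω * g ω ∂P := by
  rw [L2.inner_def]
  exact integral_congr_ae (Eventually.of_forall fun ω => by simp [mul_comm])

lemma inner_toLp_toLp {X Y : Ω → ℝ} (hX : MemLp X 2 P) (hY : MemLp Y 2 P) :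
    inner ℝ (hX.toLp X) (hY.toLp Y) = ∫ ω, X ω * Y ω ∂P := by
  rw [inner_Lp_eq_integral]
  refine integral_congr_ae ?_
  filter_upwards [hX.coeFn_toLp, hY.coeFn_toLp] with ω h1 h2
  rw [h1, h2]

lemma norm_sq_Lp_eq_integral (f : Lp ℝ 2 P) : ‖f‖ ^ 2 = ∫ ω, f ω ^ 2 ∂P := by
  rw [← real_inner_self_eq_norm_sq, inner_Lp_eq_integral]
  simp_rw [sq]

/-- The class in `L²(P)` of a member of a Gaussian process. -/
noncomputable def gaussianLp {T : Type*} {X : T → Ω → ℝ} (hX : IsGaussianProcess X P) (t : T) :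
    Lp ℝ 2 P := (hX.hasGaussianLaw_eval t).memLp_two.toLp (X t)

/-- The Gaussian Hilbert space generated by a Gaussian process. -/
noncomputable def gaussianSpace {T : Type*} {X : T → Ω → ℝ} (hX : IsGaussianProcess X P) :
    Submodule ℝ (Lp ℝ 2 P) := (Submodule.span ℝ (range (gaussianLp hX))).topologicalClosure

variable {T : Type*} {X : T → Ω → ℝ}

lemma isClosed_gaussianSpace (hX : IsGaussianProcess X P) :
    IsClosed (gaussianSpace hX : Set (Lp ℝ 2 P)) :=
  Submodule.isClosed_topologicalClosure _

lemma gaussianLp_mem (hX : IsGaussianProcess X P) (t : T) : gaussianLp hX t ∈ gaussianSpace hX :=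
  Submodule.le_topologicalClosure _ (Submodule.subset_span ⟨t, rfl⟩)

lemma coeFn_gaussianLp (hX : IsGaussianProcess X P) (t : T) : gaussianLp hX t =ᵐ[P] X t :=
  MemLp.coeFn_toLp _

/-- A closed property of the closure, proved on linear combinations. -/
lemma gaussianSpace_induction (hX : IsGaussianProcess X P) {p : Lp ℝ 2 P → Prop}
    (hp : IsClosed {f | p f})
    (h : ∀ f ∈ Submodule.span ℝ (range (gaussianLp hX)), p f) {f : Lp ℝ 2 P}
    (hf : f ∈ gaussianSpace hX) : p f :=
  closure_minimal (s := (Submodule.span ℝ (range (gaussianLp hX)) : Set (Lp ℝ 2 P)))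
    (t := {f | p f}) h hp hf

lemma coeFn_finsupp_sum {ι : Type*} (c : ι →₀ ℝ) (g : ι → Lp ℝ 2 P) :
    (c.sum fun i a => a • g i : Lp ℝ 2 P) =ᵐ[P] fun ω => ∑ i ∈ c.support, c i * g i ω := by
  have h1 : ∀ᵐ ω ∂P, ∀ i ∈ c.support, (c i • g i : Lp ℝ 2 P) ω = c i * g i ω := by
    rw [eventually_all_finset]
    intro i _
    filter_upwards [Lp.coeFn_smul (c i) (g i)] with ω hω
    rw [hω]; rfl
  filter_upwards [h1, Lp.coeFn_finsetSum c.support (fun i => c i • g i)] with ω h1 h2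
  rw [Finsupp.sum, h2]
  simp only [Finset.sum_apply]
  exact Finset.sum_congr rfl h1

lemma hasGaussianLaw_of_mem_span (hX : IsGaussianProcess X P) {f : Lp ℝ 2 P}
    (hf : f ∈ Submodule.span ℝ (range (gaussianLp hX))) : HasGaussianLaw f P := by
  classical
  obtain ⟨c, rfl⟩ := Finsupp.mem_span_range_iff_exists_finsupp.1 hf
  let L : (c.support → ℝ) →L[ℝ] ℝ := ∑ i : c.support, c i • ContinuousLinearMap.proj i
  refine ((hX.hasGaussianLaw c.support).map L).congr ?_
  have h2 : ∀ᵐ ω ∂P, ∀ i ∈ c.support, gaussianLp hX i ω = X i ω := by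
    rw [eventually_all_finset]
    intro i _
    exact coeFn_gaussianLp hX i
  filter_upwards [coeFn_finsupp_sum c (gaussianLp hX), h2] with ω h1 h2
  rw [h1, Finset.sum_congr rfl fun i hi => by rw [h2 i hi]]
  simp only [L, Function.comp, _root_.sum_apply, _root_.smul_apply,
    ContinuousLinearMap.proj_apply, smul_eq_mul, Finset.restrict]
  rw [Finset.sum_coe_sort c.support (fun i => c i * X i ω)]

/-- The mean is the inner product with the constant `1`, so vanishing of the mean is a closed linear
condition that need only be checked on generators. -/
lemma integral_eq_zero_of_mem_gaussianSpace [IsProbabilityMeasure P] (hX : IsGaussianProcess X P)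
    (h0 : ∀ t, ∫ ω, X t ω ∂P = 0) {f : Lp ℝ 2 P} (hf : f ∈ gaussianSpace hX) :
    ∫ ω, f ω ∂P = 0 := by
  have h1 : MemLp (fun _ : Ω => (1 : ℝ)) 2 P := memLp_const 1
  have key : ∀ g : Lp ℝ 2 P, inner ℝ (h1.toLp _) g = ∫ ω, g ω ∂P := by
    intro g
    rw [inner_Lp_eq_integral]
    refine integral_congr_ae ?_
    filter_upwards [h1.coeFn_toLp] with ω hω
    rw [hω, one_mul]
  rw [← key]
  refine gaussianSpace_induction hX (p := fun f => inner ℝ (h1.toLp _) f = 0) ?_ ?_ hf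
  · exact isClosed_eq (by fun_prop) continuous_const
  · intro f hf
    induction hf using Submodule.span_induction with
    | mem f hf =>
      obtain ⟨t, rfl⟩ := hf
      rw [key, ← h0 t]
      exact integral_congr_ae (coeFn_gaussianLp hX t)
    | zero => simp
    | add f g _ _ hf hg => rw [inner_add_right, hf, hg, add_zero]
    | smul c f _ hf => rw [inner_smul_right, hf, mul_zero]

lemma map_eq_gaussianReal_of_hasGaussianLaw {f : Lp ℝ 2 P} (hf : HasGaussianLaw f P)
    (h0 : ∫ ω, f ω ∂P = 0) : P.map f = gaussianReal 0 (‖f‖ ^ 2).toNNReal := by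
  rw [hf.map_eq_gaussianReal, h0, variance_of_integral_eq_zero hf.aemeasurable h0,
    norm_sq_Lp_eq_integral]

/-- Elements of the Gaussian space of a centered Gaussian process are centered Gaussian. -/
lemma map_eq_gaussianReal_of_mem [IsProbabilityMeasure P] (hX : IsGaussianProcess X P)
    (h0 : ∀ t, ∫ ω, X t ω ∂P = 0) {f : Lp ℝ 2 P} (hf : f ∈ gaussianSpace hX) :
    P.map f = gaussianReal 0 (‖f‖ ^ 2).toNNReal := by
  obtain ⟨g, hg, hgf⟩ := mem_closure_iff_seq_limit.1 hf
  have hmeas : ∀ g : Lp ℝ 2 P, AEMeasurable g P := fun g => (Lp.aestronglyMeasurable g).aemeasurable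
  have hP : ∀ g : Lp ℝ 2 P, IsProbabilityMeasure (P.map g) := fun g =>
    Measure.isProbabilityMeasure_map (hmeas g)
  -- `L²` convergence yields pointwise convergence of characteristic functions. Along the
  -- approximating sequence these depend only on the norms, which converge as well, and the two
  -- limits must coincide.
  have hd := ((tendstoInMeasure_of_tendsto_Lp hgf).tendstoInDistribution
    fun n => hmeas (g n)).tendsto
  replace hd := ProbabilityMeasure.tendsto_iff_tendsto_charFun.1 hd
  refine Measure.ext_of_charFun (funext fun t => ?_)
  refine tendsto_nhds_unique (hd t) ?_
  have e : ∀ n, charFun (P.map (g n)) t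
      = Complex.exp (-((((‖g n‖ ^ 2).toNNReal : ℝ) : ℂ) * t ^ 2 / 2)) := by
    intro n
    rw [map_eq_gaussianReal_of_hasGaussianLaw (hasGaussianLaw_of_mem_span hX (hg n))
      (integral_eq_zero_of_mem_gaussianSpace hX h0 (Submodule.le_topologicalClosure _ (hg n))),
      charFun_gaussianReal]
    simp
  have e2 : charFun (gaussianReal 0 (‖f‖ ^ 2).toNNReal) t
      = Complex.exp (-((((‖f‖ ^ 2).toNNReal : ℝ) : ℂ) * t ^ 2 / 2)) := by
    rw [charFun_gaussianReal]; simp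
  simp only [ProbabilityMeasure.coe_mk, e, e2, Real.coe_toNNReal _ (sq_nonneg _)]
  have hcont : Continuous fun x : Lp ℝ 2 P =>
      Complex.exp (-(((‖x‖ ^ 2 : ℝ) : ℂ) * t ^ 2 / 2)) := by fun_prop
  exact (hcont.tendsto f).comp hgf

lemma hasGaussianLaw_of_mem [IsProbabilityMeasure P] (hX : IsGaussianProcess X P)
    (h0 : ∀ t, ∫ ω, X t ω ∂P = 0) {f : Lp ℝ 2 P} (hf : f ∈ gaussianSpace hX) :
    HasGaussianLaw f P where
  isGaussian_map := by rw [map_eq_gaussianReal_of_mem hX h0 hf]; infer_instance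

/-- A family in the Gaussian space of a centered Gaussian process is a Gaussian process. -/
lemma isGaussianProcess_of_mem [IsProbabilityMeasure P] (hX : IsGaussianProcess X P)
    (h0 : ∀ t, ∫ ω, X t ω ∂P = 0) {ι : Type*} {Y : ι → Ω → ℝ} {f : ι → Lp ℝ 2 P}
    (hf : ∀ i, f i ∈ gaussianSpace hX) (hY : ∀ i, f i =ᵐ[P] Y i) : IsGaussianProcess Y P := by
  classical
  refine IsGaussianProcess.congr (X := fun i => f i) ⟨fun I => ⟨?_⟩⟩ hY
  have hm : AEMeasurable (fun ω => I.restrict fun i => f i ω) P :=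
    aemeasurable_pi_lambda _ fun i => (Lp.aestronglyMeasurable (f i)).aemeasurable
  -- Cramér–Wold: a linear functional of finitely many members is again a member of the Gaussian
  -- space, so one-dimensional Gaussianity suffices.
  refine isGaussian_of_isGaussian_map fun L => ?_
  rw [AEMeasurable.map_map_of_aemeasurable (by fun_prop) hm]
  have hmem : ∑ i : I, L (Pi.single i 1) • f i ∈ gaussianSpace hX :=
    Submodule.sum_mem _ fun i _ => Submodule.smul_mem _ _ (hf i)
  have h := hasGaussianLaw_of_mem hX h0 hmem
  refine (h.congr ?_).isGaussian_map
  have h1 : ∀ᵐ ω ∂P, ∀ i : I, (L (Pi.single i 1) • f i : Lp ℝ 2 P) ω = L (Pi.single i 1) * f i ω := by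
    rw [ae_all_iff]
    intro i
    filter_upwards [Lp.coeFn_smul (L (Pi.single i 1)) (f i)] with ω hω
    rw [hω]; rfl
  filter_upwards [h1, Lp.coeFn_finsetSum Finset.univ (fun i : I => L (Pi.single i 1) • f i)]
    with ω h1 h2
  rw [h2]
  simp only [Finset.sum_apply, Function.comp]
  rw [Finset.sum_congr rfl fun i _ => h1 i]
  conv_rhs => rw [pi_eq_sum_univ' (I.restrict fun i => f i ω)]
  rw [map_sum]
  refine Finset.sum_congr rfl fun i _ => ?_
  rw [map_smul, smul_eq_mul, mul_comm, Finset.restrict]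

end GaussianSpace

/-! ### Conditioning on the past -/

/-- This adjoins the information of `B` to the past of `W`. The sets `A ∩ B` form a π-system
generating `m₂ ⊔ m₃`, and on it the probabilities factor: first split off `B` using independence
from `mW`, then `A` from `C`. -/
lemma indep_sup_right {Ω : Type*} {m₁ m₂ m₃ mW mΩ : MeasurableSpace Ω} {P : Measure Ω}
    [IsProbabilityMeasure P] (h₁W : m₁ ≤ mW) (h₂W : m₂ ≤ mW) (hWΩ : mW ≤ mΩ) (h₃Ω : m₃ ≤ mΩ)
    (h₁₂ : Indep m₁ m₂ P) (hW₃ : Indep mW m₃ P) : Indep m₁ (m₂ ⊔ m₃) P := by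
  let p : Set (Set Ω) := {s | ∃ A B, MeasurableSet[m₂] A ∧ MeasurableSet[m₃] B ∧ s = A ∩ B}
  have hgen : m₂ ⊔ m₃ = MeasurableSpace.generateFrom p := by
    refine le_antisymm (sup_le ?_ ?_) (MeasurableSpace.generateFrom_le ?_)
    · intro s hs
      exact MeasurableSpace.measurableSet_generateFrom
        ⟨s, univ, hs, MeasurableSet.univ, (inter_univ s).symm⟩
    · intro s hs
      exact MeasurableSpace.measurableSet_generateFrom
        ⟨univ, s, MeasurableSet.univ, hs, (univ_inter s).symm⟩
    · rintro s ⟨A, B, hA, hB, rfl⟩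
      exact MeasurableSet.inter ((le_sup_left : m₂ ≤ m₂ ⊔ m₃) A hA)
        ((le_sup_right : m₃ ≤ m₂ ⊔ m₃) B hB)
  have hpi : IsPiSystem p := by
    rintro s ⟨A, B, hA, hB, rfl⟩ s' ⟨A', B', hA', hB', rfl⟩ _
    exact ⟨A ∩ A', B ∩ B', hA.inter hA', hB.inter hB', inter_inter_inter_comm A B A' B'⟩
  refine IndepSets.indep (p1 := {s | MeasurableSet[m₁] s}) (p2 := p) (h₁W.trans hWΩ)
    (sup_le (h₂W.trans hWΩ) h₃Ω) (@MeasurableSpace.isPiSystem_measurableSet Ω m₁) hpi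
    (@MeasurableSpace.generateFrom_measurableSet Ω m₁).symm hgen ?_
  rw [IndepSets_iff]
  rintro C s hC ⟨A, B, hA, hB, rfl⟩
  have e1 := (Indep_iff _ _ _).1 hW₃ (C ∩ A) B ((h₁W C hC).inter (h₂W A hA)) hB
  have e2 := (Indep_iff _ _ _).1 hW₃ A B (h₂W A hA) hB
  have e3 := (Indep_iff _ _ _).1 h₁₂ C A hC hA
  rw [← inter_assoc, e1, e2, e3, mul_assoc]

/-- The sigma-algebra generated by the whole path of `W`. -/
@[reducible] def sigmaPath {Ω : Type u} (W : ℝ → Ω → ℝ) : MeasurableSpace Ω :=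
  MeasurableSpace.comap (fun ω t => W t ω) inferInstance

section Past

variable {Ω : Type u} [MeasurableSpace Ω] {P : Measure Ω} [IsProbabilityMeasure P]
  {W : ℝ → Ω → ℝ} {B : ℝ≥0 → Ω → ℝ}

lemma past_le (hW : IsTwoSidedBrownian W P) (hBm : ∀ s, Measurable (B s)) (t : ℝ) :
    past W B t ≤ (inferInstance : MeasurableSpace Ω) :=
  sup_le (iSup₂_le fun s _ => (hW.measurable s).comap_le) (iSup₂_le fun s _ => (hBm s).comap_le)

lemma measurable_past {s t : ℝ} (hst : s ≤ t) : Measurable[past W B t] (W s) := by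
  have h1 : MeasurableSpace.comap (W s) inferInstance ≤ past W B t :=
    le_trans (le_iSup₂ (f := fun (s : ℝ) (_ : s ≤ t) => MeasurableSpace.comap (W s) inferInstance)
      s hst) le_sup_left
  exact measurable_iff_comap_le.2 h1

/-- A member of the Gaussian space of `W` which is orthogonal to `W` before time `t` is
independent of the past at time `t`. -/
lemma condExp_comp_of_orthogonal (hW : IsTwoSidedBrownian W P) (hBm : ∀ s, Measurable (B s))
    (hWB : IndepFun (fun ω t => W t ω) (fun ω s => B s ω) P) {t : ℝ} {N : Lp ℝ 2 P}
    (hN : N ∈ gaussianSpace hW.gaussian)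
    (horth : ∀ u ≤ t, inner ℝ (gaussianLp hW.gaussian u) N = 0) {h : ℝ → ℝ} (hh : Measurable h) :
    P[fun ω => h (N ω) | past W B t] =ᵐ[P] fun _ => ∫ ω, h (N ω) ∂P := by
  have hmW_le : sigmaPath W ≤ (inferInstance : MeasurableSpace Ω) :=
    (measurable_pi_lambda _ fun s => hW.measurable s).comap_le
  have hW_meas : ∀ s, Measurable[sigmaPath W] (W s) := fun s =>
    (measurable_pi_apply s).comp (comap_measurable fun ω t => W t ω)
  -- A limit of linear combinations of `W` is measurable for the path of `W` only up to a null set,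
  -- so a genuinely measurable version `N'` is used for the independence argument.
  have hNW : AEStronglyMeasurable[sigmaPath W] N P := by
    refine gaussianSpace_induction hW.gaussian (p := fun f => AEStronglyMeasurable[sigmaPath W] f P)
      (isClosed_aestronglyMeasurable hmW_le) (fun f hf => ?_) hN
    induction hf using Submodule.span_induction with
    | mem f hf =>
      obtain ⟨s, rfl⟩ := hf
      exact ⟨W s, (hW_meas s).stronglyMeasurable, coeFn_gaussianLp _ s⟩
    | zero => exact ⟨0, stronglyMeasurable_zero, Lp.coeFn_zero _ _ _⟩
    | add f g _ _ hf hg => exact (hf.add hg).congr (Lp.coeFn_add f g).symm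
    | smul c f _ hf => exact (hf.const_smul c).congr (Lp.coeFn_smul c f).symm
  obtain ⟨N', hN'm, hNN'⟩ := hNW
  have hN'meas : Measurable N' := hN'm.measurable.mono hmW_le le_rfl
  -- `N'` and `(W_s)_{s ≤ t}` are jointly Gaussian and uncorrelated, hence independent.
  have hind0 : IndepFun (fun ω (_ : Unit) => N' ω) (fun ω (s : Iic t) => W s ω) P := by
    refine IsGaussianProcess.indepFun_of_covariance_eq_zero (X := fun (_ : Unit) => N')
      (Y := fun s : Iic t => W s) ?_ (fun _ => hN'meas.aemeasurable)
      (fun s => (hW.measurable s).aemeasurable) ?_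
    · refine isGaussianProcess_of_mem hW.gaussian hW.mean_zero
        (f := Sum.elim (fun _ => N) fun s : Iic t => gaussianLp hW.gaussian s) ?_ ?_
      · rintro (_ | s)
        · exact hN
        · exact gaussianLp_mem _ _
      · rintro (_ | s)
        · exact hNN'
        · exact coeFn_gaussianLp hW.gaussian _
    · rintro _ ⟨s, hs⟩
      have hN2 : MemLp N' 2 P := (memLp_congr_ae hNN').1 (Lp.memLp N)
      have hW2 : MemLp (W s) 2 P := (hW.gaussian.hasGaussianLaw_eval s).memLp_two
      rw [covariance_eq_sub hN2 hW2, hW.mean_zero, mul_zero, sub_zero, ← horth s hs,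
        inner_Lp_eq_integral]
      refine integral_congr_ae ?_
      filter_upwards [hNN', coeFn_gaussianLp hW.gaussian s] with ω h1 h2
      simp only [Pi.mul_apply]
      rw [h1, h2, mul_comm]
  have hind1 : Indep (MeasurableSpace.comap N' inferInstance)
      (⨆ (s : ℝ) (_ : s ≤ t), MeasurableSpace.comap (W s) inferInstance) P := by
    refine indep_of_indep_of_le ((IndepFun_iff_Indep _ _ _).1 hind0) ?_ (iSup₂_le fun s hs => ?_)
    · exact measurable_iff_comap_le.1
        ((measurable_pi_apply ()).comp (comap_measurable fun ω (_ : Unit) => N' ω))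
    · exact measurable_iff_comap_le.1
        ((measurable_pi_apply (⟨s, hs⟩ : Iic t)).comp
          (comap_measurable fun ω (s : Iic t) => W s ω))
  have hind : Indep (MeasurableSpace.comap N' inferInstance) (past W B t) P := by
    refine indep_sup_right (mW := sigmaPath W) (measurable_iff_comap_le.1 hN'm.measurable)
      (iSup₂_le fun s _ => measurable_iff_comap_le.1 (hW_meas s)) hmW_le
      (iSup₂_le fun s _ => (hBm s).comap_le) hind1 ?_
    refine indep_of_indep_of_le_right ((IndepFun_iff_Indep _ _ _).1 hWB) (iSup₂_le fun s _ => ?_)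
    exact measurable_iff_comap_le.1
      ((measurable_pi_apply s).comp (comap_measurable fun ω s => B s ω))
  have hle := past_le (B := B) hW hBm t
  have hc := condExp_indep_eq (μ := P) (f := fun ω => h (N' ω)) hN'meas.comap_le hle
    ((hh.comp (comap_measurable N')).stronglyMeasurable) hind
  have hcongr : (fun ω => h (N ω)) =ᵐ[P] fun ω => h (N' ω) := by
    filter_upwards [hNN'] with ω hω
    rw [hω]
  refine (condExp_congr_ae hcongr).trans (hc.trans ?_)
  rw [integral_congr_ae hcongr]

/-- Conditional expectation given the past, as an operator on `L²(P)`. -/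
noncomputable def condPast (hW : IsTwoSidedBrownian W P) (hBm : ∀ s, Measurable (B s)) (t : ℝ) :
    Lp ℝ 2 P →L[ℝ] Lp ℝ 2 P :=
  (lpMeas ℝ ℝ (past W B t) 2 P).subtypeL ∘L condExpL2 ℝ ℝ (past_le hW hBm t)

lemma coeFn_condPast (hW : IsTwoSidedBrownian W P) (hBm : ∀ s, Measurable (B s)) (t : ℝ)
    (f : Lp ℝ 2 P) : condPast hW hBm t f =ᵐ[P] P[f | past W B t] := by
  have := (Lp.memLp f).condExpL2_ae_eq_condExp (𝕜 := ℝ) (past_le hW hBm t)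
  rwa [Lp.toLp_coeFn] at this

lemma coeFn_condPast_toLp (hW : IsTwoSidedBrownian W P) (hBm : ∀ s, Measurable (B s)) (t : ℝ)
    {X : Ω → ℝ} (hX : MemLp X 2 P) :
    condPast hW hBm t (hX.toLp X) =ᵐ[P] P[X | past W B t] :=
  (coeFn_condPast hW hBm t _).trans (condExp_congr_ae hX.coeFn_toLp)

lemma norm_condPast_le (hW : IsTwoSidedBrownian W P) (hBm : ∀ s, Measurable (B s)) (t : ℝ)
    (f : Lp ℝ 2 P) : ‖condPast hW hBm t f‖ ≤ ‖f‖ := norm_condExpL2_coe_le (𝕜 := ℝ) (past_le hW hBm t) f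

lemma inner_condPast (hW : IsTwoSidedBrownian W P) (hBm : ∀ s, Measurable (B s)) (t : ℝ)
    (f g : Lp ℝ 2 P) : inner ℝ (condPast hW hBm t f) g = inner ℝ f (condPast hW hBm t g) :=
  inner_condExpL2_left_eq_right (past_le hW hBm t)

lemma inner_gaussianLp (hW : IsTwoSidedBrownian W P) (s t : ℝ) :
    inner ℝ (gaussianLp hW.gaussian s) (gaussianLp hW.gaussian t) = (|s| + |t| - |t - s|) / 2 := by
  rw [gaussianLp, gaussianLp, inner_toLp_toLp, hW.covariance]

lemma condPast_eq_zero_of_orthogonal (hW : IsTwoSidedBrownian W P) (hBm : ∀ s, Measurable (B s))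
    (hWB : IndepFun (fun ω t => W t ω) (fun ω s => B s ω) P) {t : ℝ} {N : Lp ℝ 2 P}
    (hN : N ∈ gaussianSpace hW.gaussian)
    (horth : ∀ u ≤ t, inner ℝ (gaussianLp hW.gaussian u) N = 0) : condPast hW hBm t N = 0 := by
  have h := condExp_comp_of_orthogonal hW hBm hWB hN horth measurable_id
  simp only [id, integral_eq_zero_of_mem_gaussianSpace hW.gaussian hW.mean_zero hN] at h
  refine Lp.ext ?_
  filter_upwards [coeFn_condPast hW hBm t N, h, Lp.coeFn_zero ℝ 2 P] with ω h1 h2 h3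
  rw [h1, h2, h3]; rfl

/-- The increment of `W` after `t` is orthogonal to `W_u` for all `u ≤ t`. The assumption `0 ≤ t`
matters: since `W_0 = 0`, for `t < 0` the value `W_t` is minus the increment over `[t, 0]`, so the
past would not be orthogonal to later increments. -/
lemma condPast_gaussianLp (hW : IsTwoSidedBrownian W P) (hBm : ∀ s, Measurable (B s))
    (hWB : IndepFun (fun ω t => W t ω) (fun ω s => B s ω) P) {t : ℝ} (ht : 0 ≤ t) (b : ℝ) :
    condPast hW hBm t (gaussianLp hW.gaussian b) = gaussianLp hW.gaussian (min b t) := by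
  have h1 : condPast hW hBm t (gaussianLp hW.gaussian (min b t))
      = gaussianLp hW.gaussian (min b t) := by
    refine Lp.ext ?_
    have hm : StronglyMeasurable[past W B t] (W (min b t)) :=
      (measurable_past (min_le_right b t)).stronglyMeasurable
    have hW2 := (hW.gaussian.hasGaussianLaw_eval (min b t)).memLp_two
    refine (coeFn_condPast_toLp hW hBm t hW2).trans ?_
    rw [condExp_of_stronglyMeasurable (past_le hW hBm t) hm (hW2.integrable one_le_two)]
    exact (coeFn_gaussianLp _ _).symm
  have h2 : condPast hW hBm t (gaussianLp hW.gaussian b - gaussianLp hW.gaussian (min b t)) = 0 := by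
    refine condPast_eq_zero_of_orthogonal hW hBm hWB
      (Submodule.sub_mem _ (gaussianLp_mem _ _) (gaussianLp_mem _ _)) fun u hu => ?_
    rw [inner_sub_right, inner_gaussianLp hW, inner_gaussianLp hW]
    rcases le_total b t with h | h
    · rw [min_eq_left h, sub_self]
    · rw [min_eq_right h, abs_of_nonneg (ht.trans h), abs_of_nonneg ht,
        abs_of_nonneg (by linarith : 0 ≤ b - u), abs_of_nonneg (by linarith : 0 ≤ t - u)]
      ring
  rw [map_sub, h1, sub_eq_zero] at h2
  exact h2

/-- Conditioning is continuous and sends the generator `W_b` to the generator `W_{min b t}`. -/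
lemma condPast_mem (hW : IsTwoSidedBrownian W P) (hBm : ∀ s, Measurable (B s))
    (hWB : IndepFun (fun ω t => W t ω) (fun ω s => B s ω) P) {t : ℝ} (ht : 0 ≤ t) {f : Lp ℝ 2 P}
    (hf : f ∈ gaussianSpace hW.gaussian) : condPast hW hBm t f ∈ gaussianSpace hW.gaussian := by
  refine gaussianSpace_induction hW.gaussian
    (p := fun f => condPast hW hBm t f ∈ gaussianSpace hW.gaussian)
    ((isClosed_gaussianSpace hW.gaussian).preimage (condPast hW hBm t).continuous)
    (fun f hf => ?_) hf
  induction hf using Submodule.span_induction with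
  | mem f hf =>
    obtain ⟨s, rfl⟩ := hf
    rw [condPast_gaussianLp hW hBm hWB ht]
    exact gaussianLp_mem _ _
  | zero => rw [map_zero]; exact Submodule.zero_mem _
  | add f g _ _ hf hg => rw [map_add]; exact Submodule.add_mem _ hf hg
  | smul c f _ hf => rw [map_smul]; exact Submodule.smul_mem _ _ hf

/-- The innovation `X - E[X | past]` is independent of the past. -/
lemma condExp_comp_sub_condPast (hW : IsTwoSidedBrownian W P) (hBm : ∀ s, Measurable (B s))
    (hWB : IndepFun (fun ω t => W t ω) (fun ω s => B s ω) P) {t : ℝ} (ht : 0 ≤ t) {f : Lp ℝ 2 P}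
    (hf : f ∈ gaussianSpace hW.gaussian) {h : ℝ → ℝ} (hh : Measurable h) :
    P[fun ω => h ((f - condPast hW hBm t f : Lp ℝ 2 P) ω) | past W B t]
      =ᵐ[P] fun _ => ∫ ω, h ((f - condPast hW hBm t f : Lp ℝ 2 P) ω) ∂P := by
  refine condExp_comp_of_orthogonal hW hBm hWB
    (Submodule.sub_mem _ hf (condPast_mem hW hBm hWB ht hf)) (fun u hu => ?_) hh
  rw [inner_sub_right, ← inner_condPast, condPast_gaussianLp hW hBm hWB ht, min_eq_left hu, sub_self]

end Past

/-! ### Wiener integrals: step functions, isometry and conditioning -/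

section WienerIntegral

variable {Ω : Type u} [MeasurableSpace Ω] {P : Measure Ω} [IsProbabilityMeasure P]
  {W : ℝ → Ω → ℝ} {B : ℝ≥0 → Ω → ℝ}

/-- The step function stopped at time `t`. -/
noncomputable def StepData.trunc (t : ℝ) (φ : StepData) : StepData where
  n := φ.n
  coeff := φ.coeff
  left i := min (φ.left i) t
  right i := min (φ.right i) t
  left_le_right i := min_le_min_right t (φ.left_le_right i)

/-- The difference of two step functions. -/
def StepData.sub (φ ψ : StepData) : StepData where
  n := φ.n + ψ.n
  coeff := Fin.append φ.coeff (fun i => -ψ.coeff i)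
  left := Fin.append φ.left ψ.left
  right := Fin.append φ.right ψ.right
  left_le_right i := by
    refine Fin.addCases (fun i => ?_) (fun i => ?_) i
    · simpa using φ.left_le_right i
    · simpa using ψ.left_le_right i

lemma StepData.toFun_trunc (t : ℝ) (φ : StepData) :
    (φ.trunc t).toFun = (Iic t).indicator φ.toFun := by
  funext s
  have e : ∀ i, Ioc (min (φ.left i) t) (min (φ.right i) t) = Iic t ∩ Ioc (φ.left i) (φ.right i) := by
    intro i
    ext x
    simp only [mem_Ioc, mem_inter_iff, mem_Iic, min_lt_iff, le_min_iff]
    constructor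
    · rintro ⟨h1 | h1, h2, h3⟩
      · exact ⟨h3, h1, h2⟩
      · linarith
    · rintro ⟨h1, h2, h3⟩
      exact ⟨Or.inl h2, h3, h1⟩
  simp only [StepData.toFun, StepData.trunc, e]
  by_cases hs : s ∈ Iic t
  · rw [indicator_of_mem hs]
    refine Finset.sum_congr rfl fun i _ => ?_
    simp [indicator, mem_Iic.1 hs]
  · rw [indicator_of_notMem hs]
    refine Finset.sum_eq_zero fun i _ => indicator_of_notMem (fun h => hs h.1) _

lemma StepData.toFun_sub (φ ψ : StepData) (s : ℝ) :
    (φ.sub ψ).toFun s = φ.toFun s - ψ.toFun s := by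
  change ∑ i : Fin (φ.n + ψ.n), (Ioc (Fin.append φ.left ψ.left i)
    (Fin.append φ.right ψ.right i)).indicator
      (fun _ => Fin.append φ.coeff (fun i => -ψ.coeff i) i) s = _
  rw [Fin.sum_univ_add]
  simp only [Fin.append_left, Fin.append_right, StepData.toFun, sub_eq_add_neg, ← Finset.sum_neg_distrib]
  congr 1
  refine Finset.sum_congr rfl fun i _ => ?_
  by_cases h : s ∈ Ioc (ψ.left i) (ψ.right i)
  · rw [indicator_of_mem h, indicator_of_mem h]
  · rw [indicator_of_notMem h, indicator_of_notMem h, neg_zero]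

lemma StepData.integral_sub (φ ψ : StepData) (W : ℝ → Ω → ℝ) (ω : Ω) :
    (φ.sub ψ).integral W ω = φ.integral W ω - ψ.integral W ω := by
  change ∑ i : Fin (φ.n + ψ.n), Fin.append φ.coeff (fun i => -ψ.coeff i) i *
    (W (Fin.append φ.right ψ.right i) ω - W (Fin.append φ.left ψ.left i) ω) = _
  rw [Fin.sum_univ_add]
  simp only [Fin.append_left, Fin.append_right, StepData.integral, sub_eq_add_neg,
    ← Finset.sum_neg_distrib, neg_mul]

lemma StepData.memLp_toFun (φ : StepData) : MemLp φ.toFun 2 volume := by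
  have : φ.toFun = fun s => ∑ i, (Ioc (φ.left i) (φ.right i)).indicator (fun _ => φ.coeff i) s := rfl
  rw [this]
  refine memLp_finsetSum _ fun i _ => ?_
  exact memLp_indicator_const 2 measurableSet_Ioc _ (Or.inr (by simp))

/-- The `L²` class of the elementary integral. -/
noncomputable def StepData.integralLp (φ : StepData) (hW : IsTwoSidedBrownian W P) : Lp ℝ 2 P :=
  ∑ i, φ.coeff i • (gaussianLp hW.gaussian (φ.right i) - gaussianLp hW.gaussian (φ.left i))

lemma StepData.coeFn_integralLp (φ : StepData) (hW : IsTwoSidedBrownian W P) :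
    φ.integralLp hW =ᵐ[P] φ.integral W := by
  have h1 : ∀ᵐ ω ∂P, ∀ i, (φ.coeff i • (gaussianLp hW.gaussian (φ.right i)
      - gaussianLp hW.gaussian (φ.left i)) : Lp ℝ 2 P) ω
        = φ.coeff i * (W (φ.right i) ω - W (φ.left i) ω) := by
    rw [ae_all_iff]
    intro i
    filter_upwards [Lp.coeFn_smul (φ.coeff i) (gaussianLp hW.gaussian (φ.right i)
      - gaussianLp hW.gaussian (φ.left i)), Lp.coeFn_sub (gaussianLp hW.gaussian (φ.right i))
      (gaussianLp hW.gaussian (φ.left i)), coeFn_gaussianLp hW.gaussian (φ.right i),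
      coeFn_gaussianLp hW.gaussian (φ.left i)] with ω h1 h2 h3 h4
    rw [h1, Pi.smul_apply, h2, Pi.sub_apply, h3, h4, smul_eq_mul]
  filter_upwards [h1, Lp.coeFn_finsetSum Finset.univ (fun i => φ.coeff i •
    (gaussianLp hW.gaussian (φ.right i) - gaussianLp hW.gaussian (φ.left i)))] with ω h1 h2
  rw [StepData.integralLp, h2, Finset.sum_apply, StepData.integral]
  exact Finset.sum_congr rfl fun i _ => h1 i

lemma StepData.integralLp_mem (φ : StepData) (hW : IsTwoSidedBrownian W P) :
    φ.integralLp hW ∈ gaussianSpace hW.gaussian :=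
  Submodule.sum_mem _ fun _ _ => Submodule.smul_mem _ _
    (Submodule.sub_mem _ (gaussianLp_mem _ _) (gaussianLp_mem _ _))

/-- The right-hand side is the length of the overlap of the two intervals, which matches the `L²(ℝ)`
product of their indicators and yields the isometry on step functions. -/
lemma inner_gaussianLp_sub_sub (hW : IsTwoSidedBrownian W P) {a b c d : ℝ} (hab : a ≤ b)
    (hcd : c ≤ d) :
    inner ℝ (gaussianLp hW.gaussian b - gaussianLp hW.gaussian a)
      (gaussianLp hW.gaussian d - gaussianLp hW.gaussian c) = max (min b d - max a c) 0 := by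
  rw [inner_sub_left, inner_sub_right, inner_sub_right]
  simp only [inner_gaussianLp hW]
  grind

end WienerIntegral

section WienerIsometry

variable {Ω : Type u} [MeasurableSpace Ω] {P : Measure Ω} [IsProbabilityMeasure P]
  {W : ℝ → Ω → ℝ} {B : ℝ≥0 → Ω → ℝ}

lemma integral_indicator_Ioc_mul (a b c d x y : ℝ) :
    ∫ s, (Ioc a b).indicator (fun _ => x) s * (Ioc c d).indicator (fun _ => y) s
      = x * y * max (min b d - max a c) 0 := by
  have e : ∀ s, (Ioc a b).indicator (fun _ => x) s * (Ioc c d).indicator (fun _ => y) s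
      = (Ioc (max a c) (min b d)).indicator (fun _ => x * y) s := by
    intro s
    rw [← Ioc_inter_Ioc, ← inter_indicator_mul]
  simp_rw [e]
  rw [integral_indicator measurableSet_Ioc, setIntegral_const, smul_eq_mul, mul_comm,
    measureReal_def, Real.volume_Ioc, ENNReal.toReal_ofReal']

lemma StepData.inner_integralLp (φ ψ : StepData) (hW : IsTwoSidedBrownian W P) :
    inner ℝ (φ.integralLp hW) (ψ.integralLp hW) = ∫ s, φ.toFun s * ψ.toFun s := by
  have hi : ∀ (φ : StepData) i, MemLp ((Ioc (φ.left i) (φ.right i)).indicator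
      (fun _ => φ.coeff i)) 2 volume := fun φ i =>
    memLp_indicator_const 2 measurableSet_Ioc _ (Or.inr (by simp))
  simp only [StepData.integralLp, StepData.toFun, sum_inner, inner_sum, Finset.sum_mul_sum]
  have hint : ∀ i j, Integrable fun s => (Ioc (φ.left i) (φ.right i)).indicator
      (fun _ => φ.coeff i) s * (Ioc (ψ.left j) (ψ.right j)).indicator (fun _ => ψ.coeff j) s :=
    fun i j => (hi φ i).integrable_mul (hi ψ j)
  rw [integral_finsetSum _ fun i _ => integrable_finsetSum _ fun j _ => hint i j]
  rw [Finset.sum_comm]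
  refine Finset.sum_congr rfl fun i _ => ?_
  rw [integral_finsetSum _ fun j _ => hint i j]
  refine Finset.sum_congr rfl fun j _ => ?_
  rw [real_inner_smul_left, real_inner_smul_right,
    inner_gaussianLp_sub_sub hW (φ.left_le_right i) (ψ.left_le_right j),
    integral_indicator_Ioc_mul]
  ring

/-- On step functions, conditioning at time `t` is stopping at `t`; density carries this to every
Wiener integral. -/
lemma StepData.condPast_integralLp (φ : StepData) (hW : IsTwoSidedBrownian W P)
    (hBm : ∀ s, Measurable (B s)) (hWB : IndepFun (fun ω t => W t ω) (fun ω s => B s ω) P) {t : ℝ}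
    (ht : 0 ≤ t) : condPast hW hBm t (φ.integralLp hW) = (φ.trunc t).integralLp hW := by
  rw [StepData.integralLp, map_sum]
  refine Finset.sum_congr rfl fun i _ => ?_
  rw [map_smul, map_sub, condPast_gaussianLp hW hBm hWB ht, condPast_gaussianLp hW hBm hWB ht]
  rfl

lemma IsWienerIntegral.exists_tendsto (hW : IsTwoSidedBrownian W P) {f : ℝ → ℝ} {X : Ω → ℝ}
    (h : IsWienerIntegral P W f X) : ∃ φ : ℕ → StepData,
      Tendsto (fun n => (φ n).memLp_toFun.toLp (φ n).toFun) atTop (𝓝 (h.1.toLp f)) ∧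
      Tendsto (fun n => (φ n).integralLp hW) atTop (𝓝 (h.2.1.toLp X)) := by
  obtain ⟨φ, h1, h2⟩ := h.2.2
  refine ⟨φ, (Lp.tendsto_Lp_iff_tendsto_eLpNorm'' _ _ _ _).2 h1, ?_⟩
  rw [Lp.tendsto_Lp_iff_tendsto_eLpNorm]
  refine h2.congr fun n => eLpNorm_congr_ae ?_
  filter_upwards [(φ n).coeFn_integralLp hW] with ω hω
  rw [Pi.sub_apply, hω]

lemma isWienerIntegral_of_tendsto (hW : IsTwoSidedBrownian W P) {f : ℝ → ℝ} {X : Ω → ℝ}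
    (hf : MemLp f 2 volume) (hX : MemLp X 2 P) {φ : ℕ → StepData}
    (h1 : Tendsto (fun n => (φ n).memLp_toFun.toLp (φ n).toFun) atTop (𝓝 (hf.toLp f)))
    (h2 : Tendsto (fun n => (φ n).integralLp hW) atTop (𝓝 (hX.toLp X))) :
    IsWienerIntegral P W f X := by
  refine ⟨hf, hX, φ, (Lp.tendsto_Lp_iff_tendsto_eLpNorm'' _ _ _ _).1 h1, ?_⟩
  rw [Lp.tendsto_Lp_iff_tendsto_eLpNorm] at h2
  refine h2.congr fun n => eLpNorm_congr_ae ?_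
  filter_upwards [(φ n).coeFn_integralLp hW] with ω hω
  rw [Pi.sub_apply, hω]

lemma IsWienerIntegral.toLp_mem (hW : IsTwoSidedBrownian W P) {f : ℝ → ℝ} {X : Ω → ℝ}
    (h : IsWienerIntegral P W f X) : h.2.1.toLp X ∈ gaussianSpace hW.gaussian := by
  obtain ⟨φ, -, h2⟩ := h.exists_tendsto hW
  exact (isClosed_gaussianSpace _).mem_of_tendsto h2
    (Eventually.of_forall fun n => (φ n).integralLp_mem hW)

/-- The Wiener isometry. -/
lemma IsWienerIntegral.inner_eq (hW : IsTwoSidedBrownian W P) {f g : ℝ → ℝ} {X Y : Ω → ℝ}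
    (hX : IsWienerIntegral P W f X) (hY : IsWienerIntegral P W g Y) :
    inner ℝ (hX.2.1.toLp X) (hY.2.1.toLp Y) = ∫ s, f s * g s := by
  obtain ⟨φ, h1, h2⟩ := hX.exists_tendsto hW
  obtain ⟨ψ, h3, h4⟩ := hY.exists_tendsto hW
  refine tendsto_nhds_unique (h2.inner h4) ?_
  rw [← inner_toLp_toLp hX.1 hY.1]
  refine (h1.inner h3).congr fun n => ?_
  rw [inner_toLp_toLp, StepData.inner_integralLp]

lemma IsWienerIntegral.sub (hW : IsTwoSidedBrownian W P) {f g : ℝ → ℝ} {X Y : Ω → ℝ}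
    (hX : IsWienerIntegral P W f X) (hY : IsWienerIntegral P W g Y) :
    IsWienerIntegral P W (fun s => f s - g s) (fun ω => X ω - Y ω) := by
  obtain ⟨φ, h1, h2⟩ := hX.exists_tendsto hW
  obtain ⟨ψ, h3, h4⟩ := hY.exists_tendsto hW
  refine isWienerIntegral_of_tendsto hW (hX.1.sub hY.1) (hX.2.1.sub hY.2.1)
    (φ := fun n => (φ n).sub (ψ n)) ?_ ?_
  · refine (h1.sub h3).congr fun n => Lp.ext ?_
    filter_upwards [Lp.coeFn_sub ((φ n).memLp_toFun.toLp (φ n).toFun)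
      ((ψ n).memLp_toFun.toLp (ψ n).toFun), (φ n).memLp_toFun.coeFn_toLp,
      (ψ n).memLp_toFun.coeFn_toLp, ((φ n).sub (ψ n)).memLp_toFun.coeFn_toLp] with s h1 h2 h3 h4
    rw [h1, Pi.sub_apply, h2, h3, h4, StepData.toFun_sub]
  · refine (h2.sub h4).congr fun n => Lp.ext ?_
    filter_upwards [Lp.coeFn_sub ((φ n).integralLp hW) ((ψ n).integralLp hW),
      (φ n).coeFn_integralLp hW, (ψ n).coeFn_integralLp hW,
      ((φ n).sub (ψ n)).coeFn_integralLp hW] with ω h1 h2 h3 h4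
    rw [h1, Pi.sub_apply, h2, h3, h4, StepData.integral_sub]

/-- The conditional expectation of a Wiener integral is the integral of the stopped integrand. -/
lemma IsWienerIntegral.condPast (hW : IsTwoSidedBrownian W P) (hBm : ∀ s, Measurable (B s))
    (hWB : IndepFun (fun ω t => W t ω) (fun ω s => B s ω) P) {t : ℝ} (ht : 0 ≤ t) {f : ℝ → ℝ}
    {X : Ω → ℝ} (hX : IsWienerIntegral P W f X) :
    IsWienerIntegral P W ((Iic t).indicator f) (condPast hW hBm t (hX.2.1.toLp X)) := by
  obtain ⟨φ, h1, h2⟩ := hX.exists_tendsto hW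
  refine isWienerIntegral_of_tendsto hW (hX.1.indicator measurableSet_Iic) (Lp.memLp _)
    (φ := fun n => (φ n).trunc t) ?_ ?_
  -- Restriction to `Iic t` does not increase the `L²` norm, so the truncated step functions still
  -- converge.
  · rw [Lp.tendsto_Lp_iff_tendsto_eLpNorm''] at h1 ⊢
    refine tendsto_of_tendsto_of_tendsto_of_le_of_le tendsto_const_nhds h1
      (fun n => zero_le) fun n => ?_
    rw [StepData.toFun_trunc, ← indicator_sub']
    exact eLpNorm_indicator_le _
  · rw [Lp.toLp_coeFn]
    refine (((FractionalVol.condPast hW hBm t).continuous.tendsto _).comp h2).congr fun n => ?_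
    rw [Function.comp, StepData.condPast_integralLp _ hW hBm hWB ht]

/-- The integrands are stopped at `t` and `t'` with `t ≤ t'`, so their product lives on `Iic t`: the
earlier time alone determines the truncation. -/
lemma IsWienerIntegral.inner_condPast (hW : IsTwoSidedBrownian W P) (hBm : ∀ s, Measurable (B s))
    (hWB : IndepFun (fun ω t => W t ω) (fun ω s => B s ω) P) {t t' : ℝ} (ht : 0 ≤ t) (htt' : t ≤ t')
    {f g : ℝ → ℝ} {X Y : Ω → ℝ} (hX : IsWienerIntegral P W f X) (hY : IsWienerIntegral P W g Y) :
    inner ℝ (FractionalVol.condPast hW hBm t (hX.2.1.toLp X))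
      (FractionalVol.condPast hW hBm t' (hY.2.1.toLp Y)) = ∫ s in Iic t, f s * g s := by
  have h := (hX.condPast hW hBm hWB ht).inner_eq hW (hY.condPast hW hBm hWB (ht.trans htt'))
  rw [Lp.toLp_coeFn, Lp.toLp_coeFn] at h
  rw [h, ← integral_indicator measurableSet_Iic]
  refine integral_congr_ae (Eventually.of_forall fun s => ?_)
  by_cases hs : s ∈ Iic t
  · simp only [indicator_of_mem hs, indicator_of_mem (show s ∈ Iic t' from le_trans hs htt')]
  · simp only [indicator_of_notMem hs, zero_mul]

end WienerIsometry

/-! ### Joint measurability; Bochner integrals in `L²(P)` versus pathwise integrals -/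

section Bridge

variable {Ω : Type u} [MeasurableSpace Ω] {P : Measure Ω}

/-- A process with almost surely continuous paths is jointly measurable, up to null sets. -/
lemma aestronglyMeasurable_uncurry_of_continuous {Y : ℝ → Ω → ℝ}
    (hY : ∀ t, AEStronglyMeasurable (Y t) P) (hc : ∀ᵐ ω ∂P, Continuous fun t => Y t ω)
    (μ : Measure ℝ) [SFinite μ] [SFinite P] :
    AEStronglyMeasurable (Function.uncurry Y) (μ.prod P) := by
  obtain ⟨Y', hY'm, hY'⟩ : ∃ Y' : ℕ → ℤ → Ω → ℝ, (∀ n k, Measurable (Y' n k)) ∧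
      ∀ (n : ℕ) (k : ℤ), Y (k / ((n : ℝ) + 1)) =ᵐ[P] Y' n k :=
    ⟨fun n k => (hY (k / ((n : ℝ) + 1))).mk _,
      fun n k => (hY (k / ((n : ℝ) + 1))).stronglyMeasurable_mk.measurable,
      fun n k => (hY (k / ((n : ℝ) + 1))).ae_eq_mk⟩
  have hYn : ∀ n : ℕ, Measurable fun z : ℝ × Ω => Y' n ⌊((n : ℝ) + 1) * z.1⌋ z.2 := by
    intro n
    have h1 : Measurable fun z : ℤ × Ω => Y' n z.1 z.2 :=
      measurable_from_prod_countable_right fun k => hY'm n k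
    have h2 : Measurable fun z : ℝ × Ω => (⌊((n : ℝ) + 1) * z.1⌋, z.2) :=
      (Int.measurable_floor.comp (measurable_const.mul measurable_fst)).prodMk measurable_snd
    exact h1.comp h2
  -- Sample the process at the grid point `⌊(n+1)t⌋/(n+1)`. Countably many times occur, so
  -- measurable versions can be chosen simultaneously, and path continuity gives convergence.
  refine aestronglyMeasurable_of_tendsto_ae (u := atTop)
    (f := fun (n : ℕ) (z : ℝ × Ω) => Y' n ⌊((n : ℝ) + 1) * z.1⌋ z.2)
    (fun n => (hYn n).aestronglyMeasurable) ?_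
  have hgood : ∀ᵐ ω ∂P, (Continuous fun t => Y t ω) ∧
      ∀ (n : ℕ) (k : ℤ), Y (k / ((n : ℝ) + 1)) ω = Y' n k ω :=
    hc.and (ae_all_iff.2 fun n => ae_all_iff.2 fun k => hY' n k)
  filter_upwards [(Measure.quasiMeasurePreserving_snd (μ := μ) (ν := P)).ae hgood] with z hz
  obtain ⟨hcont, heq⟩ := hz
  simp only [← heq, Function.uncurry]
  refine (hcont.tendsto z.1).comp ?_
  have hlim : Tendsto (fun n : ℕ => z.1 - 1 / ((n : ℝ) + 1)) atTop (𝓝 z.1) := by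
    simpa using tendsto_const_nhds.sub (tendsto_one_div_add_atTop_nhds_zero_nat (𝕜 := ℝ))
  refine tendsto_of_tendsto_of_tendsto_of_le_of_le hlim tendsto_const_nhds (fun n => ?_) fun n => ?_
  · have hn : (0 : ℝ) < n + 1 := by positivity
    have := Int.lt_floor_add_one (((n : ℝ) + 1) * z.1)
    rw [le_div_iff₀ hn, sub_mul, one_div, inv_mul_cancel₀ hn.ne']
    linarith
  · have hn : (0 : ℝ) < n + 1 := by positivity
    have := Int.floor_le (((n : ℝ) + 1) * z.1)
    rw [div_le_iff₀ hn]
    linarith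

lemma integral_abs_le_norm [IsProbabilityMeasure P] (f : Lp ℝ 2 P) : ∫ ω, |f ω| ∂P ≤ ‖f‖ := by
  have h1 : MemLp (fun ω => |f ω|) 2 P := (Lp.memLp f).norm
  have h2 : MemLp (fun _ : Ω => (1 : ℝ)) 2 P := memLp_const 1
  have e1 : ‖h1.toLp _‖ = ‖f‖ := by
    rw [Lp.norm_toLp, Lp.norm_def]
    congr 1
    exact eLpNorm_norm f
  have e2 : ‖h2.toLp _‖ = 1 := by
    rw [Lp.norm_toLp, eLpNorm_const _ (by simp) (IsProbabilityMeasure.ne_zero P)]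
    simp
  have := real_inner_le_norm (h1.toLp _) (h2.toLp _)
  rw [inner_toLp_toLp, e1, e2] at this
  simpa using this

/-- The Bochner integral in `L²(P)` is the pathwise integral. -/
lemma ae_integral_eq_integral_Lp [IsProbabilityMeasure P] {μ : Measure ℝ} [SFinite μ]
    {X : ℝ → Ω → ℝ} (hX : AEStronglyMeasurable (Function.uncurry X) (μ.prod P)) {f : ℝ → Lp ℝ 2 P}
    (hf : Integrable f μ) (hfX : ∀ x, f x =ᵐ[P] X x) :
    Integrable (Function.uncurry X) (μ.prod P) ∧
      (fun ω => ∫ x, X x ω ∂μ) =ᵐ[P] (∫ x, f x ∂μ : Lp ℝ 2 P) := by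
  have hprod : Integrable (Function.uncurry X) (μ.prod P) := by
    rw [integrable_prod_iff hX]
    refine ⟨Eventually.of_forall fun x =>
      (((Lp.memLp (f x)).integrable one_le_two).congr (hfX x)), ?_⟩
    refine hf.norm.mono' hX.norm.integral_prod_right' (Eventually.of_forall fun x => ?_)
    rw [Real.norm_of_nonneg (integral_nonneg fun _ => norm_nonneg _)]
    refine le_trans (le_of_eq ?_) (integral_abs_le_norm (f x))
    refine integral_congr_ae ?_
    filter_upwards [hfX x] with ω hω
    rw [hω]; rfl
  refine ⟨hprod, ?_⟩
  -- Test both sides against indicators: the inner product commutes with the Bochner integral, and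
  -- Fubini handles the pathwise one.
  refine Integrable.ae_eq_of_forall_setIntegral_eq _ _ hprod.integral_prod_right
    ((Lp.memLp _).integrable one_le_two) fun s hs _ => ?_
  have hs' : P s ≠ ∞ := measure_ne_top P s
  rw [← L2.inner_indicatorConstLp_one hs hs', ← integral_inner hf]
  simp_rw [L2.inner_indicatorConstLp_one]
  have hr : Integrable (Function.uncurry fun ω x => X x ω) ((P.restrict s).prod μ) := by
    have h1 : Integrable (Function.uncurry fun ω x => X x ω) (P.prod μ) := hprod.swap
    refine h1.mono_measure ?_
    rw [← Measure.restrict_univ (μ := μ), Measure.prod_restrict, Measure.restrict_univ]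
    exact Measure.restrict_le_self
  rw [integral_integral_swap hr]
  refine integral_congr_ae (Eventually.of_forall fun x => ?_)
  exact integral_congr_ae (ae_restrict_of_ae (hfX x).symm)

end Bridge

/-! ### The Langevin equation along a path -/

section Path

variable {w : ℝ → ℝ} {ε H : ℝ}

lemma exp_integrableOn_Iic (hw : Continuous w)
    (hi : IntegrableOn (fun r => Real.exp (-(0 - r) / ε) * w r) (Iic 0)) (s : ℝ) :
    IntegrableOn (fun r => Real.exp (r / ε) * w r) (Iic s) := by
  have hcont : Continuous fun r => Real.exp (r / ε) * w r := by fun_prop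
  have h0 : IntegrableOn (fun r => Real.exp (r / ε) * w r) (Iic 0) := by
    simpa using hi
  have : Iic s ⊆ Iic 0 ∪ Icc 0 s := by
    intro x hx
    rcases le_total x 0 with h | h
    · exact Or.inl h
    · exact Or.inr ⟨h, hx⟩
  exact (h0.union hcont.continuousOn.integrableOn_Icc).mono_set this

/-- Factoring `e^(-s/ε)` out leaves an ordinary primitive in `s`, so the product rule and the
fundamental theorem of calculus give the derivative. -/
lemma setIntegral_exp_eq (hw : Continuous w)
    (hi : IntegrableOn (fun r => Real.exp (-(0 - r) / ε) * w r) (Iic 0)) (s : ℝ) :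
    ∫ r in Iic s, Real.exp (-(s - r) / ε) * w r
      = Real.exp (-s / ε) * ((∫ r in Iic 0, Real.exp (r / ε) * w r)
        + ∫ r in (0 : ℝ)..s, Real.exp (r / ε) * w r) := by
  have e : ∀ r, Real.exp (-(s - r) / ε) * w r = Real.exp (-s / ε) * (Real.exp (r / ε) * w r) := by
    intro r
    rw [← mul_assoc, ← Real.exp_add]
    congr 2; ring
  simp_rw [e]
  rw [integral_const_mul, ← intervalIntegral.integral_Iic_sub_Iic (exp_integrableOn_Iic hw hi 0)
    (exp_integrableOn_Iic hw hi s)]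
  ring

lemma hasDerivAt_exp_setIntegral (hw : Continuous w)
    (hi : IntegrableOn (fun r => Real.exp (-(0 - r) / ε) * w r) (Iic 0)) (s : ℝ) :
    HasDerivAt (fun s => ∫ r in Iic s, Real.exp (-(s - r) / ε) * w r)
      (w s - (∫ r in Iic s, Real.exp (-(s - r) / ε) * w r) / ε) s := by
  have hcont : Continuous fun r => Real.exp (r / ε) * w r := by fun_prop
  have h1 : HasDerivAt (fun s => (∫ r in Iic 0, Real.exp (r / ε) * w r)
        + ∫ r in (0 : ℝ)..s, Real.exp (r / ε) * w r) (Real.exp (s / ε) * w s) s :=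
    (intervalIntegral.integral_hasDerivAt_right (hcont.intervalIntegrable _ _)
      (hcont.stronglyMeasurableAtFilter _ _) hcont.continuousAt).const_add _
  have h2 : HasDerivAt (fun s : ℝ => Real.exp (-s / ε)) (Real.exp (-s / ε) * (-1 / ε)) s :=
    (((hasDerivAt_id s).neg).div_const ε).exp
  have h3 := h2.mul h1
  have hfun : (fun s => ∫ r in Iic s, Real.exp (-(s - r) / ε) * w r)
      = (fun s : ℝ => Real.exp (-s / ε)) * fun s => (∫ r in Iic 0, Real.exp (r / ε) * w r)
        + ∫ r in (0 : ℝ)..s, Real.exp (r / ε) * w r := funext fun s => setIntegral_exp_eq hw hi s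
  rw [hfun]
  refine h3.congr_deriv ?_
  have : Real.exp (-s / ε) * (Real.exp (s / ε) * w s) = w s := by
    rw [← mul_assoc, ← Real.exp_add, neg_div, neg_add_cancel, Real.exp_zero, one_mul]
  rw [this, setIntegral_exp_eq hw hi s]
  ring

variable {Ω : Type u}

lemma continuous_fOU {WH : ℝ → Ω → ℝ} {ω : Ω} (hw : Continuous fun t => WH t ω)
    (hi : IntegrableOn (fun r => Real.exp (-(0 - r) / ε) * WH r ω) (Iic 0)) :
    Continuous fun t => fOU H WH ε t ω := by
  have : Continuous fun s => ∫ r in Iic s, Real.exp (-(s - r) / ε) * WH r ω :=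
    continuous_iff_continuousAt.2 fun s => (hasDerivAt_exp_setIntegral hw hi s).continuousAt
  unfold fOU
  fun_prop

/-- The integrated Langevin equation. -/
lemma integral_fOU {WH : ℝ → Ω → ℝ} {ω : Ω} (hε : 0 < ε) (hw : Continuous fun t => WH t ω)
    (hi : IntegrableOn (fun r => Real.exp (-(0 - r) / ε) * WH r ω) (Iic 0)) (t T : ℝ) :
    ∫ s in t..T, fOU H WH ε s ω
      = ε ^ (1 - H) * (WH T ω - WH t ω) - ε * (fOU H WH ε T ω - fOU H WH ε t ω) := by
  have hcont := continuous_fOU (H := H) hw hi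
  have e1 : ε ^ (-1 - H) * ε = ε ^ (-H) := by
    rw [← Real.rpow_add_one hε.ne']; congr 1; ring
  have e2 : ε ^ (-H) * ε = ε ^ (1 - H) := by
    rw [← Real.rpow_add_one hε.ne']; congr 1; ring
  -- The process is the derivative of `ε^(-H)` times the exponential average of `WH`. The definition
  -- of `fOU` then expresses this primitive as `ε^(1-H) WH - ε fOU`.
  have hder : ∀ s ∈ uIcc t T, HasDerivAt
      (fun s => ε ^ (-H) * ∫ r in Iic s, Real.exp (-(s - r) / ε) * WH r ω) (fOU H WH ε s ω) s := by
    intro s _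
    refine ((hasDerivAt_exp_setIntegral hw hi s).const_mul (ε ^ (-H))).congr_deriv ?_
    rw [fOU, ← e1]
    field_simp
  rw [intervalIntegral.integral_eq_sub_of_hasDerivAt hder (hcont.intervalIntegrable _ _)]
  simp only [fOU]
  rw [← e2, ← e1]
  ring

end Path

/-! ### Fractional Brownian motion as a curve in `L²(P)` -/

section FractionalBrownian

variable {Ω : Type u} [MeasurableSpace Ω] {P : Measure Ω} {H : ℝ}
  {W : ℝ → Ω → ℝ} {B : ℝ≥0 → Ω → ℝ} {WH : ℝ → Ω → ℝ}

/-- The class in `L²(P)` of the fractional Brownian motion at time `t`. -/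
noncomputable def fbmLp (hWH : IsFractionalBrownian P H W WH) (t : ℝ) : Lp ℝ 2 P :=
  (hWH.wienerIntegral t).2.1.toLp (WH t)

lemma coeFn_fbmLp (hWH : IsFractionalBrownian P H W WH) (t : ℝ) : fbmLp hWH t =ᵐ[P] WH t :=
  MemLp.coeFn_toLp _

variable [IsProbabilityMeasure P]

lemma fbmLp_mem (hW : IsTwoSidedBrownian W P) (hWH : IsFractionalBrownian P H W WH) (t : ℝ) :
    fbmLp hWH t ∈ gaussianSpace hW.gaussian :=
  (hWH.wienerIntegral t).toLp_mem hW

lemma norm_sq_fbmLp_sub (hH : H ∈ Ioo (1 / 2 : ℝ) 1) (hW : IsTwoSidedBrownian W P)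
    (hWH : IsFractionalBrownian P H W WH) (s t : ℝ) :
    ‖fbmLp hWH s - fbmLp hWH t‖ ^ 2 = sigmaHSq H * |s - t| ^ (2 * H) := by
  wlog h : t ≤ s generalizing s t
  · rw [norm_sub_rev, abs_sub_comm]
    exact this t s (le_of_not_ge h)
  have h1 := (hWH.wienerIntegral s).sub hW (hWH.wienerIntegral t)
  have h2 := h1.inner_eq hW h1
  rw [real_inner_self_eq_norm_sq] at h2
  rw [abs_of_nonneg (sub_nonneg.2 h), ← integral_mandelbrotKernel_sub_sq hH h]
  simp_rw [sq (mandelbrotKernel H s _ - mandelbrotKernel H t _)]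
  exact h2

lemma norm_fbmLp_sub (hH : H ∈ Ioo (1 / 2 : ℝ) 1) (hW : IsTwoSidedBrownian W P)
    (hWH : IsFractionalBrownian P H W WH) (s t : ℝ) :
    ‖fbmLp hWH s - fbmLp hWH t‖ = √(sigmaHSq H) * |s - t| ^ H := by
  have h := norm_sq_fbmLp_sub hH hW hWH s t
  have e : |s - t| ^ (2 * H) = (|s - t| ^ H) ^ 2 := by
    rw [← Real.rpow_natCast, ← Real.rpow_mul (abs_nonneg _)]; congr 1; push_cast; ring
  rw [← Real.sqrt_sq (norm_nonneg (fbmLp hWH s - fbmLp hWH t)), h, e,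
    Real.sqrt_mul (sigmaHSq_pos hH).le, Real.sqrt_sq (by positivity)]

lemma continuous_fbmLp (hH : H ∈ Ioo (1 / 2 : ℝ) 1) (hW : IsTwoSidedBrownian W P)
    (hWH : IsFractionalBrownian P H W WH) : Continuous (fbmLp hWH) := by
  have hH0 : 0 < H := by linarith [hH.1]
  refine continuous_iff_continuousAt.2 fun t => ?_
  rw [ContinuousAt, tendsto_iff_norm_sub_tendsto_zero]
  simp_rw [norm_fbmLp_sub hH hW hWH]
  have hc : Continuous fun s : ℝ => √(sigmaHSq H) * |s - t| ^ H :=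
    continuous_const.mul ((by fun_prop : Continuous fun s : ℝ => |s - t|).rpow_const
      fun _ => Or.inr hH0.le)
  have := hc.tendsto t
  simpa [Real.zero_rpow hH0.ne'] using this

lemma inner_condPast_fbmLp_sub (hW : IsTwoSidedBrownian W P) (hBm : ∀ s, Measurable (B s))
    (hWB : IndepFun (fun ω t => W t ω) (fun ω s => B s ω) P)
    (hWH : IsFractionalBrownian P H W WH) {t t' : ℝ} (ht : 0 ≤ t) (htt' : t ≤ t')
    (r s r' s' : ℝ) :
    inner ℝ (condPast hW hBm t (fbmLp hWH s - fbmLp hWH r))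
      (condPast hW hBm t' (fbmLp hWH s' - fbmLp hWH r'))
      = ∫ v in Iic t, (mandelbrotKernel H s v - mandelbrotKernel H r v)
        * (mandelbrotKernel H s' v - mandelbrotKernel H r' v) :=
  IsWienerIntegral.inner_condPast hW hBm hWB ht htt'
    ((hWH.wienerIntegral s).sub hW (hWH.wienerIntegral r))
    ((hWH.wienerIntegral s').sub hW (hWH.wienerIntegral r'))

/-- The predictable part of an increment of fractional Brownian motion is small. -/
lemma exists_norm_condPast_fbmLp_sub_le (hH : H ∈ Ioo (1 / 2 : ℝ) 1)
    (hW : IsTwoSidedBrownian W P) (hBm : ∀ s, Measurable (B s))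
    (hWB : IndepFun (fun ω t => W t ω) (fun ω s => B s ω) P)
    (hWH : IsFractionalBrownian P H W WH) :
    ∃ K : ℝ, 0 ≤ K ∧ ∀ t s x : ℝ, 0 ≤ t → t < s → 0 < x →
      ‖condPast hW hBm t (fbmLp hWH s - fbmLp hWH (s - x))‖ ≤ K * (s - t) ^ (H - 1) * x := by
  set c := (Real.Gamma (H + 1 / 2))⁻¹ ^ 2 * (H - 1 / 2) ^ 2 / (2 - 2 * H) with hc
  have hc0 : 0 ≤ c := div_nonneg (by positivity) (by linarith [hH.2])
  have hσ := sigmaHSq_pos hH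
  -- Two regimes, cut at `x = (s-t)/2`. Below it the kernel tail bound applies with constant `c`,
  -- the distance from `s - x` to `t` being at least `(s-t)/2`. Above it, contractivity gives `σ_H²
  -- x^(2H)`, and `x^(2H-2) ≤ ((s-t)/2)^(2H-2)` because the exponent is negative.
  refine ⟨√((c + sigmaHSq H) * 2⁻¹ ^ (2 * H - 2)), Real.sqrt_nonneg _, fun t s x ht hts hx => ?_⟩
  have hst : 0 < s - t := sub_pos.2 hts
  have key : ‖condPast hW hBm t (fbmLp hWH s - fbmLp hWH (s - x))‖ ^ 2
      ≤ (c + sigmaHSq H) * (x ^ 2 * (2⁻¹ * (s - t)) ^ (2 * H - 2)) := by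
    have hp : 0 ≤ x ^ 2 * (2⁻¹ * (s - t)) ^ (2 * H - 2) := by positivity
    rcases le_total x (2⁻¹ * (s - t)) with h | h
    · have h1 := inner_condPast_fbmLp_sub hW hBm hWB hWH ht le_rfl (s - x) s (s - x) s
      rw [real_inner_self_eq_norm_sq] at h1
      rw [h1]
      simp_rw [← sq]
      have h2 := setIntegral_mandelbrotKernel_sub_sq_le hH (t := t) (r := s - x) (s := s)
        (by linarith) (by linarith)
      rw [sub_sub_cancel, ← hc] at h2
      refine h2.trans ?_
      have h3 : (s - x - t) ^ (2 * H - 2) ≤ (2⁻¹ * (s - t)) ^ (2 * H - 2) :=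
        Real.rpow_le_rpow_of_nonpos (by positivity) (by linarith) (by linarith [hH.2])
      calc c * (x ^ 2 * (s - x - t) ^ (2 * H - 2))
          ≤ c * (x ^ 2 * (2⁻¹ * (s - t)) ^ (2 * H - 2)) := by gcongr
        _ ≤ _ := by nlinarith
    · have h1 : ‖condPast hW hBm t (fbmLp hWH s - fbmLp hWH (s - x))‖ ^ 2
          ≤ ‖fbmLp hWH s - fbmLp hWH (s - x)‖ ^ 2 :=
        pow_le_pow_left₀ (norm_nonneg _) (norm_condPast_le hW hBm t _) 2
      rw [norm_sq_fbmLp_sub hH hW hWH, sub_sub_cancel, abs_of_pos hx] at h1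
      refine h1.trans ?_
      have h3 : x ^ (2 * H - 2) ≤ (2⁻¹ * (s - t)) ^ (2 * H - 2) :=
        Real.rpow_le_rpow_of_nonpos (by positivity) h (by linarith [hH.2])
      have e : x ^ (2 * H) = x ^ 2 * x ^ (2 * H - 2) := by
        rw [← Real.rpow_natCast, ← Real.rpow_add hx]; congr 1; push_cast; ring
      rw [e]
      calc sigmaHSq H * (x ^ 2 * x ^ (2 * H - 2))
          ≤ sigmaHSq H * (x ^ 2 * (2⁻¹ * (s - t)) ^ (2 * H - 2)) := by gcongr
        _ ≤ _ := by nlinarith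
  refine le_of_sq_le_sq ?_ (by positivity)
  refine key.trans (le_of_eq ?_)
  have e : (s - t) ^ (2 * H - 2) = ((s - t) ^ (H - 1)) ^ 2 := by
    rw [← Real.rpow_natCast, ← Real.rpow_mul hst.le]; congr 1; push_cast; ring
  rw [mul_pow, mul_pow, Real.sq_sqrt (by positivity), Real.mul_rpow (by positivity) hst.le, e]
  ring

end FractionalBrownian

/-! ### The fractional Ornstein–Uhlenbeck process: representation, predictable part, variance -/

section OrnsteinUhlenbeck

variable {Ω : Type u} [MeasurableSpace Ω] {P : Measure Ω} [IsProbabilityMeasure P] {H : ℝ}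
  {W : ℝ → Ω → ℝ} {B : ℝ≥0 → Ω → ℝ} {WH : ℝ → Ω → ℝ}

lemma integrableOn_exp_neg_mul_Ioi {r : ℝ} (hr : 0 < r) :
    IntegrableOn (fun x : ℝ => Real.exp (-(r * x))) (Ioi 0) := by
  simpa using exp_neg_integrableOn_Ioi 0 hr

lemma integrableOn_rpow_mul_exp_neg_mul {p r : ℝ} (hp : 0 ≤ p) (hr : 0 < r) :
    IntegrableOn (fun x : ℝ => x ^ p * Real.exp (-(r * x))) (Ioi 0) := by
  have := integrableOn_rpow_mul_exp_neg_mul_rpow (p := 1) (s := p) (by linarith) one_pos hr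
  simpa using this

lemma integrableOn_exp_smul_fbmLp_sub (hH : H ∈ Ioo (1 / 2 : ℝ) 1) (hW : IsTwoSidedBrownian W P)
    (hWH : IsFractionalBrownian P H W WH) {r : ℝ} (hr : 0 < r) (s : ℝ) :
    IntegrableOn (fun x : ℝ => Real.exp (-(r * x)) • (fbmLp hWH s - fbmLp hWH (s - x))) (Ioi 0) := by
  have hcont := continuous_fbmLp hH hW hWH
  have hm : Continuous fun x : ℝ => Real.exp (-(r * x)) • (fbmLp hWH s - fbmLp hWH (s - x)) := by
    fun_prop
  refine ((integrableOn_rpow_mul_exp_neg_mul (p := H) (by linarith [hH.1]) hr).const_mul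
    (√(sigmaHSq H))).mono' hm.aestronglyMeasurable ?_
  filter_upwards [ae_restrict_mem measurableSet_Ioi] with x hx
  have hx : (0 : ℝ) < x := hx
  rw [norm_smul, norm_fbmLp_sub hH hW hWH, Real.norm_of_nonneg (Real.exp_pos _).le, sub_sub_cancel,
    abs_of_pos hx]
  exact le_of_eq (by ring)

lemma integrableOn_exp_smul_fbmLp (hH : H ∈ Ioo (1 / 2 : ℝ) 1) (hW : IsTwoSidedBrownian W P)
    (hWH : IsFractionalBrownian P H W WH) {r : ℝ} (hr : 0 < r) (s : ℝ) :
    IntegrableOn (fun x : ℝ => Real.exp (-(r * x)) • fbmLp hWH (s - x)) (Ioi 0) := by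
  have h1 := (integrableOn_exp_neg_mul_Ioi hr).smul_const (fbmLp hWH s)
  have h2 := h1.sub (integrableOn_exp_smul_fbmLp_sub hH hW hWH hr s)
  refine h2.congr (Eventually.of_forall fun x => ?_)
  simp only [Pi.sub_apply, smul_sub, sub_sub_cancel]

/-- The fractional Ornstein--Uhlenbeck process as a Bochner integral in `L²(P)`. -/
noncomputable def fouLp (hWH : IsFractionalBrownian P H W WH) (ε s : ℝ) : Lp ℝ 2 P :=
  ε ^ (-1 - H) • ∫ x in Ioi (0 : ℝ), Real.exp (-(ε⁻¹ * x)) • (fbmLp hWH s - fbmLp hWH (s - x))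

lemma measurePreserving_sub_Iic (s : ℝ) :
    MeasurePreserving (fun x : ℝ => s - x) (volume.restrict (Ioi 0)) (volume.restrict (Iic s)) := by
  have h := (Measure.measurePreserving_sub_left volume s).restrict_preimage_emb
    (Homeomorph.subLeft s).measurableEmbedding (Iic s)
  have hpre : (fun v : ℝ => s - v) ⁻¹' (Iic s) = Ici 0 := by
    ext v; simp
  rw [hpre] at h
  rwa [← restrict_Ioi_eq_restrict_Ici] at h

lemma integral_exp_neg_mul_Ioi' {r : ℝ} (hr : 0 < r) :
    ∫ x in Ioi (0 : ℝ), Real.exp (-(r * x)) = r⁻¹ := by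
  have := Real.integral_rpow_mul_exp_neg_mul_Ioi one_pos hr
  simpa using this

/-- Since `∫_0^∞ e^(-x/ε) dx = ε`, the constant term `W^H_s` inside `fouLp` contributes `ε^(-H)
W^H_s`, and the rest is the exponential average. The almost sure integrability is the input needed
by the pathwise Langevin equation. -/
lemma ae_fOU (hH : H ∈ Ioo (1 / 2 : ℝ) 1) (hW : IsTwoSidedBrownian W P)
    (hWH : IsFractionalBrownian P H W WH) {ε : ℝ} (hε : 0 < ε) (s : ℝ) :
    (∀ᵐ ω ∂P, IntegrableOn (fun r => Real.exp (-(s - r) / ε) * WH r ω) (Iic s)) ∧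
      fouLp hWH ε s =ᵐ[P] fOU H WH ε s := by
  have hr : 0 < ε⁻¹ := inv_pos.2 hε
  have hemb : MeasurableEmbedding fun x : ℝ => s - x :=
    (Homeomorph.subLeft s).measurableEmbedding
  set f : ℝ → Lp ℝ 2 P := fun r => Real.exp (-(s - r) / ε) • fbmLp hWH r with hf
  have hfe : ∀ x, f (s - x) = Real.exp (-(ε⁻¹ * x)) • fbmLp hWH (s - x) := by
    intro x
    simp only [hf, sub_sub_cancel]
    congr 2; rw [div_eq_inv_mul]; ring
  have hfi : Integrable f (volume.restrict (Iic s)) := by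
    rw [← (measurePreserving_sub_Iic s).integrable_comp_emb hemb]
    refine (integrableOn_exp_smul_fbmLp hH hW hWH hr s).congr (Eventually.of_forall fun x => ?_)
    exact (hfe x).symm
  have hfint : ∫ r in Iic s, f r = ∫ x in Ioi (0 : ℝ), Real.exp (-(ε⁻¹ * x)) • fbmLp hWH (s - x) := by
    rw [← (measurePreserving_sub_Iic s).integral_comp hemb]
    exact integral_congr_ae (Eventually.of_forall hfe)
  have hjoint := aestronglyMeasurable_uncurry_of_continuous
    (fun t => (hWH.wienerIntegral t).2.1.aestronglyMeasurable) hWH.continuous_paths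
    (volume.restrict (Iic s))
  have hX : AEStronglyMeasurable
      (Function.uncurry fun r ω => Real.exp (-(s - r) / ε) * WH r ω)
      ((volume.restrict (Iic s)).prod P) := by
    refine AEStronglyMeasurable.mul ?_ hjoint
    exact Measurable.aestronglyMeasurable
      (f := fun z : ℝ × Ω => Real.exp (-(s - z.1) / ε)) (by fun_prop)
  have hfX : ∀ r, f r =ᵐ[P] fun ω => Real.exp (-(s - r) / ε) * WH r ω := by
    intro r
    filter_upwards [Lp.coeFn_smul (Real.exp (-(s - r) / ε)) (fbmLp hWH r), coeFn_fbmLp hWH r]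
      with ω h1 h2
    rw [hf]
    simp only
    rw [h1, Pi.smul_apply, h2, smul_eq_mul]
  obtain ⟨h1, h2⟩ := ae_integral_eq_integral_Lp hX hfi hfX
  refine ⟨h1.prod_left_ae, ?_⟩
  have e : fouLp hWH ε s = ε ^ (-H) • fbmLp hWH s - ε ^ (-1 - H) • ∫ r in Iic s, f r := by
    have e1 : ε ^ (-1 - H) * ε = ε ^ (-H) := by
      rw [← Real.rpow_add_one hε.ne']; congr 1; ring
    rw [fouLp, hfint]
    simp_rw [smul_sub]
    rw [integral_sub ((integrableOn_exp_neg_mul_Ioi hr).smul_const _)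
      (integrableOn_exp_smul_fbmLp hH hW hWH hr s), integral_smul_const,
      integral_exp_neg_mul_Ioi' hr, inv_inv, smul_sub, smul_smul, e1]
  rw [e]
  filter_upwards [Lp.coeFn_sub (ε ^ (-H) • fbmLp hWH s) (ε ^ (-1 - H) • ∫ r in Iic s, f r),
    Lp.coeFn_smul (ε ^ (-H)) (fbmLp hWH s), Lp.coeFn_smul (ε ^ (-1 - H)) (∫ r in Iic s, f r),
    coeFn_fbmLp hWH s, h2] with ω a1 a2 a3 a4 a5
  rw [a1, Pi.sub_apply, a2, a3, Pi.smul_apply, Pi.smul_apply, a4, ← a5, fOU, smul_eq_mul, smul_eq_mul]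

/-- The integrand takes values in a closed subspace, so the integral can be computed inside it. -/
lemma fouLp_mem (hW : IsTwoSidedBrownian W P) (hWH : IsFractionalBrownian P H W WH) (ε s : ℝ) :
    fouLp hWH ε s ∈ gaussianSpace hW.gaussian := by
  refine Submodule.smul_mem _ _ ?_
  have hcl := isClosed_gaussianSpace hW.gaussian
  have : CompleteSpace (gaussianSpace hW.gaussian) := hcl.completeSpace_coe
  let f : ℝ → gaussianSpace hW.gaussian := fun x =>
    ⟨Real.exp (-(ε⁻¹ * x)) • (fbmLp hWH s - fbmLp hWH (s - x)), Submodule.smul_mem _ _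
      (Submodule.sub_mem _ (fbmLp_mem hW hWH _) (fbmLp_mem hW hWH _))⟩
  have := (gaussianSpace hW.gaussian).subtypeₗᵢ.integral_comp_comm (μ := volume.restrict (Ioi 0)) f
  simp only [f, Submodule.coe_subtypeₗᵢ, Submodule.subtype_apply] at this
  rw [this]
  exact Submodule.coe_mem _

/-- The predictable part of the Ornstein--Uhlenbeck process. -/
lemma exists_norm_condPast_fouLp_le (hH : H ∈ Ioo (1 / 2 : ℝ) 1)
    (hW : IsTwoSidedBrownian W P) (hBm : ∀ s, Measurable (B s))
    (hWB : IndepFun (fun ω t => W t ω) (fun ω s => B s ω) P)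
    (hWH : IsFractionalBrownian P H W WH) :
    ∃ K : ℝ, 0 ≤ K ∧ ∀ ε t s : ℝ, 0 < ε → 0 ≤ t → t < s →
      ‖condPast hW hBm t (fouLp hWH ε s)‖ ≤ K * ε ^ (1 - H) * (s - t) ^ (H - 1) := by
  obtain ⟨K, hK, hb⟩ := exists_norm_condPast_fbmLp_sub_le hH hW hBm hWB hWH
  refine ⟨K, hK, fun ε t s hε ht hts => ?_⟩
  have hr : 0 < ε⁻¹ := inv_pos.2 hε
  have hi := integrableOn_exp_smul_fbmLp_sub hH hW hWH hr s
  rw [fouLp, map_smul, ← ContinuousLinearMap.integral_comp_comm _ hi, norm_smul,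
    Real.norm_of_nonneg (by positivity)]
  have h1 : ‖∫ x in Ioi (0 : ℝ), condPast hW hBm t
      (Real.exp (-(ε⁻¹ * x)) • (fbmLp hWH s - fbmLp hWH (s - x)))‖
      ≤ ∫ x in Ioi (0 : ℝ), K * (s - t) ^ (H - 1) * (x ^ ((2 : ℝ) - 1) * Real.exp (-(ε⁻¹ * x))) := by
    refine norm_integral_le_of_norm_le
      ((integrableOn_rpow_mul_exp_neg_mul (by norm_num) hr).const_mul _) ?_
    filter_upwards [ae_restrict_mem measurableSet_Ioi] with x hx
    have hx : (0 : ℝ) < x := hx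
    rw [map_smul, norm_smul, Real.norm_of_nonneg (Real.exp_pos _).le]
    have := mul_le_mul_of_nonneg_left (hb t s x ht hts hx) (Real.exp_pos (-(ε⁻¹ * x))).le
    refine this.trans (le_of_eq ?_)
    rw [show (2 : ℝ) - 1 = 1 by norm_num, Real.rpow_one]
    ring
  -- The bound on predictable increments is linear in `x`, so the weight enters through `∫ x
  -- e^(-x/ε) dx = ε² Γ(2) = ε²`, which turns the prefactor `ε^(-1-H)` into `ε^(1-H)`.
  rw [integral_const_mul, Real.integral_rpow_mul_exp_neg_mul_Ioi two_pos hr,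
    show Real.Gamma 2 = 1 by simp, one_div, inv_inv, mul_one] at h1
  have e : ε ^ (-1 - H) * ε ^ (2 : ℝ) = ε ^ (1 - H) := by
    rw [← Real.rpow_add hε]; congr 1; ring
  calc _ ≤ ε ^ (-1 - H) * (K * (s - t) ^ (H - 1) * ε ^ (2 : ℝ)) := by gcongr
    _ = _ := by rw [← e]; ring

/-- Polarization of the increment variance. The term `|x-y|^(2H)` is split into positive parts so
that each half becomes a shifted Gamma integral against an exponential. -/
lemma inner_fbmLp_sub_sub (hH : H ∈ Ioo (1 / 2 : ℝ) 1) (hW : IsTwoSidedBrownian W P)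
    (hWH : IsFractionalBrownian P H W WH) (s : ℝ) {x y : ℝ} (hx : 0 < x) (hy : 0 < y) :
    inner ℝ (fbmLp hWH s - fbmLp hWH (s - x)) (fbmLp hWH s - fbmLp hWH (s - y))
      = sigmaHSq H / 2 * (x ^ (2 * H) + y ^ (2 * H)
        - (max (x - y) 0 ^ (2 * H) + max (y - x) 0 ^ (2 * H))) := by
  have hH0 : 2 * H ≠ 0 := by linarith [hH.1]
  have h1 := norm_sq_fbmLp_sub hH hW hWH s (s - x)
  have h2 := norm_sq_fbmLp_sub hH hW hWH s (s - y)
  have h3 := norm_sq_fbmLp_sub hH hW hWH (s - y) (s - x)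
  have e : fbmLp hWH (s - y) - fbmLp hWH (s - x)
      = (fbmLp hWH s - fbmLp hWH (s - x)) - (fbmLp hWH s - fbmLp hWH (s - y)) := by abel
  rw [e, norm_sub_sq_real, h1, h2] at h3
  rw [sub_sub_cancel, abs_of_pos hx, sub_sub_cancel, abs_of_pos hy] at h3
  have e2 : |s - y - (s - x)| ^ (2 * H) = max (x - y) 0 ^ (2 * H) + max (y - x) 0 ^ (2 * H) := by
    rw [show s - y - (s - x) = x - y by ring]
    rcases le_total x y with h | h
    · rw [abs_of_nonpos (by linarith), max_eq_right (by linarith), max_eq_left (by linarith),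
        Real.zero_rpow hH0]
      ring_nf
    · rw [abs_of_nonneg (by linarith), max_eq_left (by linarith), max_eq_right (by linarith),
        Real.zero_rpow hH0, add_zero]
  rw [e2] at h3
  linarith

/-- `∫₀^∞ e^{-ry} (y-x)_+^p dy` -/
lemma integral_exp_neg_mul_posPart_rpow {p r x : ℝ} (hp : 0 < p) (hr : 0 < r) (hx : 0 < x) :
    ∫ y in Ioi (0 : ℝ), Real.exp (-(r * y)) * max (y - x) 0 ^ p
      = Real.exp (-(r * x)) * ((1 / r) ^ (p + 1) * Real.Gamma (p + 1)) := by
  have h1 : ∫ y in Ioi (0 : ℝ), Real.exp (-(r * y)) * max (y - x) 0 ^ p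
      = ∫ y in Ioi x, Real.exp (-(r * y)) * max (y - x) 0 ^ p := by
    refine setIntegral_eq_of_subset_of_forall_sdiff_eq_zero measurableSet_Ioi
      (Ioi_subset_Ioi hx.le) fun y hy => ?_
    have : y ≤ x := not_lt.1 hy.2
    rw [max_eq_right (by linarith), Real.zero_rpow hp.ne', mul_zero]
  have h2 := (measurePreserving_add_right volume x).setIntegral_preimage_emb
    (Homeomorph.addRight x).measurableEmbedding
    (fun y => Real.exp (-(r * y)) * max (y - x) 0 ^ p) (Ioi x)
  rw [show (fun y : ℝ => y + x) ⁻¹' Ioi x = Ioi 0 by ext; simp] at h2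
  rw [h1, ← h2, ← Real.integral_rpow_mul_exp_neg_mul_Ioi (by linarith) hr, ← integral_const_mul]
  refine setIntegral_congr_fun measurableSet_Ioi fun z hz => ?_
  have hz : (0 : ℝ) < z := hz
  rw [add_sub_cancel_right, add_sub_cancel_right, max_eq_left hz.le,
    show -(r * (z + x)) = -(r * x) + -(r * z) by ring, Real.exp_add]
  ring

lemma integral_add_sub_sub {α : Type*} [MeasurableSpace α] {μ : Measure α} {f g h k : α → ℝ}
    (hf : Integrable f μ) (hg : Integrable g μ) (hh : Integrable h μ) (hk : Integrable k μ) :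
    ∫ x, (f x + g x - h x - k x) ∂μ = ∫ x, f x ∂μ + ∫ x, g x ∂μ - ∫ x, h x ∂μ - ∫ x, k x ∂μ := by
  have h1 : ∫ x, (f x + g x) ∂μ = _ := integral_add hf hg
  have h2 : ∫ x, (f x + g x - h x) ∂μ = _ := integral_sub (hf.add hg) hh
  have h3 : ∫ x, (f x + g x - h x - k x) ∂μ = _ := integral_sub ((hf.add hg).sub hh) hk
  rw [h3, h2, h1]

/-- Expand the square as a double integral of covariances. With `A = Γ(2H+1) / r^(2H+1)`, the terms
`x^(2H)` and `y^(2H)` give `A/r` each and the two halves of `|x-y|^(2H)` remove `A/(2r)` each,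
leaving `A/r`. -/
lemma norm_sq_integral_exp_smul_fbmLp_sub (hH : H ∈ Ioo (1 / 2 : ℝ) 1)
    (hW : IsTwoSidedBrownian W P) (hWH : IsFractionalBrownian P H W WH) {r : ℝ} (hr : 0 < r)
    (s : ℝ) :
    ‖∫ x in Ioi (0 : ℝ), Real.exp (-(r * x)) • (fbmLp hWH s - fbmLp hWH (s - x))‖ ^ 2
      = sigmaHSq H / 2 * ((1 / r) ^ (2 * H + 1) * Real.Gamma (2 * H + 1)) * r⁻¹ := by
  have hp : 0 < 2 * H := by linarith [hH.1]
  set A := (1 / r) ^ (2 * H + 1) * Real.Gamma (2 * H + 1) with hA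
  have hi := integrableOn_exp_smul_fbmLp_sub hH hW hWH hr s
  have he := integrableOn_exp_neg_mul_Ioi hr
  have hpow := integrableOn_rpow_mul_exp_neg_mul hp.le hr
  have hpowA : ∫ x in Ioi (0 : ℝ), x ^ (2 * H) * Real.exp (-(r * x)) = A := by
    have := Real.integral_rpow_mul_exp_neg_mul_Ioi (a := 2 * H + 1) (by linarith) hr
    rwa [add_sub_cancel_right] at this
  have hk : Integrable (fun z : ℝ × ℝ => Real.exp (-(r * z.1)) *
      (Real.exp (-(r * z.2)) * max (z.1 - z.2) 0 ^ (2 * H)))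
      ((volume.restrict (Ioi 0)).prod (volume.restrict (Ioi 0))) := by
    have hc : Continuous fun z : ℝ × ℝ => max (z.1 - z.2) 0 ^ (2 * H) :=
      (by fun_prop : Continuous fun z : ℝ × ℝ => max (z.1 - z.2) 0).rpow_const
        fun _ => Or.inr hp.le
    refine (hpow.mul_prod he).mono'
      (by fun_prop : Continuous fun z : ℝ × ℝ => Real.exp (-(r * z.1)) *
      (Real.exp (-(r * z.2)) * max (z.1 - z.2) 0 ^ (2 * H))).aestronglyMeasurable ?_
    rw [Measure.prod_restrict]
    filter_upwards [ae_restrict_mem (measurableSet_Ioi.prod measurableSet_Ioi)] with z hz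
    obtain ⟨hz1, hz2⟩ : (0 : ℝ) < z.1 ∧ (0 : ℝ) < z.2 := hz
    have h0 : (0 : ℝ) ≤ max (z.1 - z.2) 0 := le_max_right _ _
    rw [Real.norm_of_nonneg (by positivity)]
    have h1 : max (z.1 - z.2) 0 ^ (2 * H) ≤ z.1 ^ (2 * H) :=
      Real.rpow_le_rpow h0 (max_le (by linarith) hz1.le) hp.le
    calc _ = Real.exp (-(r * z.1)) * Real.exp (-(r * z.2)) * max (z.1 - z.2) 0 ^ (2 * H) := by ring
      _ ≤ Real.exp (-(r * z.1)) * Real.exp (-(r * z.2)) * z.1 ^ (2 * H) := by gcongr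
      _ = _ := by ring
  have hJi := hk.integral_prod_left
  have hJ : ∫ x in Ioi (0 : ℝ), (∫ y in Ioi (0 : ℝ), Real.exp (-(r * x)) *
      (Real.exp (-(r * y)) * max (x - y) 0 ^ (2 * H))) = A * (2 * r)⁻¹ := by
    rw [integral_integral_swap hk]
    have : ∀ y ∈ Ioi (0 : ℝ), ∫ x in Ioi (0 : ℝ), Real.exp (-(r * x)) *
      (Real.exp (-(r * y)) * max (x - y) 0 ^ (2 * H)) = A * Real.exp (-(2 * r * y)) := by
      intro y hy
      have h1 := integral_exp_neg_mul_posPart_rpow hp hr hy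
      rw [← hA] at h1
      have : ∀ x : ℝ, Real.exp (-(r * x)) * (Real.exp (-(r * y)) * max (x - y) 0 ^ (2 * H))
        = Real.exp (-(r * y)) * (Real.exp (-(r * x)) * max (x - y) 0 ^ (2 * H)) := fun x => by ring
      simp_rw [this]
      rw [integral_const_mul, h1, show -(2 * r * y) = -(r * y) + -(r * y) by ring, Real.exp_add]
      ring
    rw [setIntegral_congr_fun measurableSet_Ioi this, integral_const_mul,
      integral_exp_neg_mul_Ioi' (by positivity)]
  have hin : ∀ x ∈ Ioi (0 : ℝ), inner ℝ (Real.exp (-(r * x)) • (fbmLp hWH s - fbmLp hWH (s - x)))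
      (∫ y in Ioi (0 : ℝ), Real.exp (-(r * y)) • (fbmLp hWH s - fbmLp hWH (s - y)))
      = sigmaHSq H / 2 * (r⁻¹ * (x ^ (2 * H) * Real.exp (-(r * x))) + A * Real.exp (-(r * x))
        - (∫ y in Ioi (0 : ℝ), Real.exp (-(r * x)) *
          (Real.exp (-(r * y)) * max (x - y) 0 ^ (2 * H))) - A * Real.exp (-(2 * r * x))) := by
    intro x hx
    have hJx : IntegrableOn (fun y => Real.exp (-(r * y)) * max (x - y) 0 ^ (2 * H)) (Ioi 0) := by
      have hc : Continuous fun y : ℝ => max (x - y) 0 ^ (2 * H) :=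
        (by fun_prop : Continuous fun y : ℝ => max (x - y) 0).rpow_const fun _ => Or.inr hp.le
      refine (he.mul_const (x ^ (2 * H))).mono' (by fun_prop :
        Continuous fun y => Real.exp (-(r * y)) * max (x - y) 0 ^ (2 * H)).aestronglyMeasurable ?_
      filter_upwards [ae_restrict_mem measurableSet_Ioi] with y hy
      have hy : (0 : ℝ) < y := hy
      have hx : (0 : ℝ) < x := hx
      have h0 : (0 : ℝ) ≤ max (x - y) 0 := le_max_right _ _
      rw [Real.norm_of_nonneg (by positivity)]
      gcongr
      exact max_le (by linarith) hx.le
    have hJ'x : IntegrableOn (fun y => Real.exp (-(r * y)) * max (y - x) 0 ^ (2 * H)) (Ioi 0) := by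
      have hc : Continuous fun y : ℝ => max (y - x) 0 ^ (2 * H) :=
        (by fun_prop : Continuous fun y : ℝ => max (y - x) 0).rpow_const fun _ => Or.inr hp.le
      refine hpow.mono' (by fun_prop :
        Continuous fun y => Real.exp (-(r * y)) * max (y - x) 0 ^ (2 * H)).aestronglyMeasurable ?_
      filter_upwards [ae_restrict_mem measurableSet_Ioi] with y hy
      have hy : (0 : ℝ) < y := hy
      have hx : (0 : ℝ) < x := hx
      have h0 : (0 : ℝ) ≤ max (y - x) 0 := le_max_right _ _
      rw [Real.norm_of_nonneg (by positivity), mul_comm]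
      gcongr
      exact max_le (by linarith) hy.le
    rw [← integral_inner hi]
    have : ∀ y ∈ Ioi (0 : ℝ), inner ℝ (Real.exp (-(r * x)) • (fbmLp hWH s - fbmLp hWH (s - x)))
        (Real.exp (-(r * y)) • (fbmLp hWH s - fbmLp hWH (s - y)))
        = sigmaHSq H / 2 * Real.exp (-(r * x)) * (x ^ (2 * H) * Real.exp (-(r * y))
          + y ^ (2 * H) * Real.exp (-(r * y)) - Real.exp (-(r * y)) * max (x - y) 0 ^ (2 * H)
          - Real.exp (-(r * y)) * max (y - x) 0 ^ (2 * H)) := by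
      intro y hy
      rw [real_inner_smul_left, real_inner_smul_right, inner_fbmLp_sub_sub hH hW hWH s hx hy]
      ring
    rw [setIntegral_congr_fun measurableSet_Ioi this, integral_const_mul,
      integral_add_sub_sub (he.const_mul _) hpow hJx hJ'x,
      integral_const_mul, integral_exp_neg_mul_Ioi' hr, hpowA,
      integral_exp_neg_mul_posPart_rpow hp hr hx, ← hA, integral_const_mul,
      show -(2 * r * x) = -(r * x) + -(r * x) by ring, Real.exp_add]
    ring
  have he2 : IntegrableOn (fun x : ℝ => Real.exp (-(2 * r * x))) (Ioi 0) :=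
    integrableOn_exp_neg_mul_Ioi (by positivity)
  rw [← real_inner_self_eq_norm_sq]
  rw [← integral_inner hi, setIntegral_congr_fun measurableSet_Ioi
    (fun x _ => real_inner_comm (Real.exp (-(r * x)) • (fbmLp hWH s - fbmLp hWH (s - x))) _),
    setIntegral_congr_fun measurableSet_Ioi hin, integral_const_mul,
    integral_add_sub_sub (hpow.const_mul _) (he.const_mul _) hJi (he2.const_mul _), integral_const_mul, integral_const_mul,
    integral_const_mul, hJ, hpowA, integral_exp_neg_mul_Ioi' hr,
    integral_exp_neg_mul_Ioi' (by positivity)]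
  field_simp
  ring

lemma sigmaOU_sq (hH : H ∈ Ioo (1 / 2 : ℝ) 1) :
    sigmaOU H ^ 2 = 1 / 2 * Real.Gamma (2 * H + 1) * sigmaHSq H := by
  have := Real.Gamma_pos_of_pos (s := 2 * H + 1) (by linarith [hH.1])
  have := sigmaHSq_pos hH
  exact Real.sq_sqrt (by positivity)

/-- The fractional Ornstein--Uhlenbeck process has stationary variance. -/
lemma norm_sq_fouLp (hH : H ∈ Ioo (1 / 2 : ℝ) 1) (hW : IsTwoSidedBrownian W P)
    (hWH : IsFractionalBrownian P H W WH) {ε : ℝ} (hε : 0 < ε) (s : ℝ) :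
    ‖fouLp hWH ε s‖ ^ 2 = sigmaOU H ^ 2 := by
  rw [fouLp, norm_smul, mul_pow, norm_sq_integral_exp_smul_fbmLp_sub hH hW hWH (inv_pos.2 hε),
    sigmaOU_sq hH, Real.norm_of_nonneg (by positivity), one_div, inv_inv]
  have e : (ε ^ (-1 - H)) ^ 2 * (ε ^ (2 * H + 1) * ε) = 1 := by
    rw [← Real.rpow_add_one hε.ne', ← Real.rpow_natCast, ← Real.rpow_mul hε.le,
      ← Real.rpow_add hε]
    convert Real.rpow_zero ε using 2
    push_cast
    ring
  linear_combination (sigmaHSq H / 2 * Real.Gamma (2 * H + 1)) * e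

end OrnsteinUhlenbeck

/-! ### Fourth moments and Minkowski's inequality -/

section FourthMoment

variable {Ω : Type*} {m mΩ : MeasurableSpace Ω} {P : Measure Ω}

lemma integrable_pow_four {X : Ω → ℝ} (hX : MemLp X 4 P) : Integrable (fun ω => X ω ^ 4) P := by
  have := hX.integrable_norm_pow (p := 4) (by norm_num)
  simpa [Even.pow_abs (by decide : Even 4)] using this

lemma memLp_four_of_integrable {X : Ω → ℝ} (hX : AEStronglyMeasurable X P)
    (h : Integrable (fun ω => X ω ^ 4) P) : MemLp X 4 P := by
  refine (integrable_norm_rpow_iff hX (by norm_num) (by norm_num)).1 (h.congr ?_)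
  refine Eventually.of_forall fun ω => ?_
  simp only [ENNReal.toReal_ofNat, Real.norm_eq_abs]
  rw [show (4 : ℝ) = ((4 : ℕ) : ℝ) by norm_num, Real.rpow_natCast, Even.pow_abs (by decide)]

/-- Young's inequality with exponents `4/3` and `4`; the difference of the sides is `(a-c)² (2a² +
(a+c)²)`. -/
lemma four_mul_pow_three_mul_le (a c : ℝ) : 4 * (a ^ 3 * c) ≤ 3 * a ^ 4 + c ^ 4 := by
  nlinarith [mul_nonneg (sq_nonneg (a - c)) (add_nonneg (mul_nonneg two_pos.le (sq_nonneg a))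
    (sq_nonneg (a + c)))]

lemma abs_pow_three_mul_le (a c : ℝ) : |a ^ 3 * c| ≤ a ^ 4 + c ^ 4 := by
  have h1 := four_mul_pow_three_mul_le a c
  have h2 := four_mul_pow_three_mul_le a (-c)
  have h3 : (0 : ℝ) ≤ a ^ 4 := by positivity
  have h4 : (0 : ℝ) ≤ c ^ 4 := by positivity
  rw [abs_le]
  constructor <;> nlinarith

lemma add_pow_four_le (a b : ℝ) : (a + b) ^ 4 ≤ 8 * (a ^ 4 + b ^ 4) := by
  have h1 : (a + b) ^ 2 ≤ 2 * (a ^ 2 + b ^ 2) := by nlinarith [sq_nonneg (a - b)]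
  have h2 : ((a + b) ^ 2) ^ 2 ≤ (2 * (a ^ 2 + b ^ 2)) ^ 2 := pow_le_pow_left₀ (sq_nonneg _) h1 2
  nlinarith [sq_nonneg (a ^ 2 - b ^ 2)]

lemma integrable_pow_three_mul {X Y : Ω → ℝ} (hX : MemLp X 4 P) (hY : MemLp Y 4 P) :
    Integrable (fun ω => X ω ^ 3 * Y ω) P := by
  refine ((integrable_pow_four hX).add (integrable_pow_four hY)).mono'
    ((hX.aestronglyMeasurable.pow 3).mul hY.aestronglyMeasurable)
    (Eventually.of_forall fun ω => abs_pow_three_mul_le _ _)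

/-- The square of the second moment is at most the fourth moment. -/
lemma sq_integral_sq_le [IsProbabilityMeasure P] {X : Ω → ℝ} (hX : MemLp X 4 P) :
    (∫ ω, X ω ^ 2 ∂P) ^ 2 ≤ ∫ ω, X ω ^ 4 ∂P := by
  set c := ∫ ω, X ω ^ 2 ∂P
  have h2 : Integrable (fun ω => X ω ^ 2) P :=
    (hX.mono_exponent (q := 4) (p := 2) (by norm_num)).integrable_sq
  have h1 : ∫ ω, (2 * c * X ω ^ 2 - c ^ 2) ∂P ≤ ∫ ω, X ω ^ 4 ∂P := by
    refine integral_mono ((h2.const_mul _).sub (integrable_const _)) (integrable_pow_four hX)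
      fun ω => ?_
    nlinarith [sq_nonneg (X ω ^ 2 - c)]
  rw [integral_sub (h2.const_mul _) (integrable_const _), integral_const_mul] at h1
  simp only [integral_const, probReal_univ, one_smul] at h1
  nlinarith

lemma integral_pow_three_mul_condExp [IsProbabilityMeasure P] (hm : m ≤ mΩ) {U X : Ω → ℝ}
    (hU : MemLp U 4 P) (hUm : AEStronglyMeasurable[m] U P) (hX : MemLp X 4 P) :
    ∫ ω, U ω ^ 3 * X ω ∂P = ∫ ω, U ω ^ 3 * P[X | m] ω ∂P := by
  have h := condExp_mul_of_aestronglyMeasurable_left (m := m) (f := fun ω => U ω ^ 3) (g := X)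
    (hUm.pow 3) (integrable_pow_three_mul hU hX) (hX.integrable (by norm_num))
  rw [← integral_condExp hm]
  exact integral_congr_ae h

/-- Minkowski's integral inequality in `L⁴` for the conditional expectation of an integral. -/
lemma integral_condExp_integral_pow_four_le [IsProbabilityMeasure P] (hm : m ≤ mΩ)
    {α : Type*} [MeasurableSpace α] {μ : Measure α} [IsFiniteMeasure μ] {X : α → Ω → ℝ}
    (hX : AEStronglyMeasurable (Function.uncurry X) (μ.prod P)) {I : Ω → ℝ}
    (hI : I =ᵐ[P] fun ω => ∫ x, X x ω ∂μ) (hI4 : MemLp I 4 P) (hX4 : ∀ x, MemLp (X x) 4 P)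
    {A : ℝ} (hA : ∀ x, ∫ ω, X x ω ^ 4 ∂P ≤ A) {r : α → ℝ} (hr : Integrable r μ) {R : ℝ}
    (hR : 0 < R) (hrR : ∫ x, r x ∂μ ≤ R) (hr0 : ∀ᵐ x ∂μ, 0 < r x)
    (hc : ∀ᵐ x ∂μ, ∫ ω, P[X x | m] ω ^ 4 ∂P ≤ r x ^ 4) :
    ∫ ω, P[I | m] ω ^ 4 ∂P ≤ R ^ 4 := by
  -- Duality with `D³`: the `m`-measurable factor passes through conditional expectations, so `E D⁴`
  -- becomes the `x`-integral of `E[D³ E[X_x | m]]`.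
  set D := P[I | m] with hD
  have hD4 : MemLp D 4 P := hI4.condExp (by norm_num)
  have hDm : AEStronglyMeasurable[m] D P := stronglyMeasurable_condExp.aestronglyMeasurable
  set V := ∫ ω, D ω ^ 4 ∂P with hV
  have hV0 : 0 ≤ V := integral_nonneg fun ω => by positivity
  have hX4i : Integrable (fun z : α × Ω => X z.1 z.2 ^ 4) (μ.prod P) := by
    refine (integrable_prod_iff (hX.pow 4)).2 ?_
    refine ⟨Eventually.of_forall fun x => integrable_pow_four (hX4 x), ?_⟩
    refine (integrable_const A).mono' (hX.pow 4).norm.integral_prod_right'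
      (Eventually.of_forall fun x => ?_)
    rw [Real.norm_of_nonneg (integral_nonneg fun _ => norm_nonneg _)]
    refine le_trans (le_of_eq (integral_congr_ae (Eventually.of_forall fun ω => ?_))) (hA x)
    exact Real.norm_of_nonneg (by positivity : (0 : ℝ) ≤ X x ω ^ 4)
  have hDX : Integrable (Function.uncurry fun x ω => D ω ^ 3 * X x ω) (μ.prod P) := by
    have hD' : AEStronglyMeasurable (fun z : α × Ω => D z.2) (μ.prod P) :=
      hD4.aestronglyMeasurable.comp_snd
    refine (((integrable_pow_four hD4).comp_snd μ).add hX4i).mono' ((hD'.pow 3).mul hX)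
      (Eventually.of_forall fun z => abs_pow_three_mul_le _ _)
  have e1 : V = ∫ x, (∫ ω, D ω ^ 3 * P[X x | m] ω ∂P) ∂μ := by
    have h1 : V = ∫ ω, D ω ^ 3 * I ω ∂P := by
      rw [integral_pow_three_mul_condExp hm hD4 hDm hI4, hV]
      exact integral_congr_ae (Eventually.of_forall fun ω => by simp only [← hD]; ring)
    rw [h1]
    have h2 : ∫ ω, D ω ^ 3 * I ω ∂P = ∫ ω, (∫ x, D ω ^ 3 * X x ω ∂μ) ∂P := by
      refine integral_congr_ae ?_
      filter_upwards [hI] with ω hω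
      rw [hω, integral_const_mul]
    rw [h2, ← integral_integral_swap hDX]
    exact integral_congr_ae (Eventually.of_forall fun x =>
      integral_pow_three_mul_condExp hm hD4 hDm (hX4 x))
  have hle : ∀ᵐ x ∂μ, ∫ ω, D ω ^ 3 * P[X x | m] ω ∂P
      ≤ r x * (3 / 4 * V / R) + r x * (R ^ 3 / 4) := by
    filter_upwards [hr0, hc] with x hx0 hcx
    have hC4 : MemLp (P[X x | m]) 4 P := (hX4 x).condExp (by norm_num)
    -- Young's inequality weighted by `r x / R`: after integration in `x` the total is `V ≤ 3V/4 +
    -- R⁴/4`, that is `V ≤ R⁴`.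
    set w := r x / R with hw
    have hw0 : 0 < w := by positivity
    have h1 : ∫ ω, D ω ^ 3 * P[X x | m] ω ∂P
        ≤ ∫ ω, (3 / 4 * w * D ω ^ 4 + (4 * w ^ 3)⁻¹ * P[X x | m] ω ^ 4) ∂P := by
      refine integral_mono (integrable_pow_three_mul hD4 hC4)
        (((integrable_pow_four hD4).const_mul _).add ((integrable_pow_four hC4).const_mul _))
        fun ω => ?_
      have h := mul_le_mul_of_nonneg_left
        (four_mul_pow_three_mul_le (D ω) (P[X x | m] ω / w)) hw0.le
      have e1 : w * (4 * (D ω ^ 3 * (P[X x | m] ω / w))) = 4 * (D ω ^ 3 * P[X x | m] ω) := by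
        field_simp
      have e2 : w * (3 * D ω ^ 4 + (P[X x | m] ω / w) ^ 4)
          = 4 * (3 / 4 * w * D ω ^ 4 + (4 * w ^ 3)⁻¹ * P[X x | m] ω ^ 4) := by
        field_simp
      rw [e1, e2] at h
      linarith
    rw [integral_add ((integrable_pow_four hD4).const_mul _)
      ((integrable_pow_four hC4).const_mul _), integral_const_mul, integral_const_mul, ← hV] at h1
    refine h1.trans ?_
    have h2 : (4 * w ^ 3)⁻¹ * ∫ ω, P[X x | m] ω ^ 4 ∂P ≤ (4 * w ^ 3)⁻¹ * r x ^ 4 := by gcongr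
    have e3 : (4 * w ^ 3)⁻¹ * r x ^ 4 = r x * (R ^ 3 / 4) := by rw [hw]; field_simp
    have e4 : 3 / 4 * w * V = r x * (3 / 4 * V / R) := by rw [hw]; field_simp
    rw [e3] at h2
    rw [e4]
    linarith
  have hint : Integrable (fun x => ∫ ω, D ω ^ 3 * P[X x | m] ω ∂P) μ :=
    hDX.integral_prod_left.congr (Eventually.of_forall fun x =>
      integral_pow_three_mul_condExp hm hD4 hDm (hX4 x))
  have h3 := integral_mono_ae hint ((hr.mul_const _).add (hr.mul_const _)) hle
  have e5 : ∫ x, (r x * (3 / 4 * V / R) + r x * (R ^ 3 / 4)) ∂μ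
      = (∫ x, r x ∂μ) * (3 / 4 * V / R) + (∫ x, r x ∂μ) * (R ^ 3 / 4) := by
    rw [integral_add (hr.mul_const _) (hr.mul_const _), integral_mul_const, integral_mul_const]
  rw [← e1] at h3
  have h4 : V ≤ (∫ x, r x ∂μ) * (3 / 4 * V / R) + (∫ x, r x ∂μ) * (R ^ 3 / 4) := h3.trans e5.le
  have h5 : (∫ x, r x ∂μ) * (3 / 4 * V / R) ≤ R * (3 / 4 * V / R) := by gcongr
  have h6 : (∫ x, r x ∂μ) * (R ^ 3 / 4) ≤ R * (R ^ 3 / 4) := by gcongr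
  have e6 : R * (3 / 4 * V / R) = 3 / 4 * V := by field_simp
  nlinarith

end FourthMoment

/-! ### Conditional first-order expansion -/

section Taylor

variable {Ω : Type*} {m mΩ : MeasurableSpace Ω} {P : Measure Ω} {g g' g'' : ℝ → ℝ} {C : ℝ}

lemma abs_sub_le_of_hasDerivAt (hg : ∀ x, HasDerivAt g (g' x) x) (hC : ∀ x, |g' x| ≤ C) (x y : ℝ) :
    |g y - g x| ≤ C * |y - x| :=
  Convex.norm_image_sub_le_of_norm_hasDerivWithin_le (s := univ)
    (fun x _ => (hg x).hasDerivWithinAt) (fun x _ => hC x) convex_univ (mem_univ x) (mem_univ y)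

/-- Mean value inequality for `u ↦ g u - g' x * u` on the segment, where its derivative is at most
`C |y|`; the factor `1/2` is not needed. -/
lemma abs_taylor_le (hg : ∀ x, HasDerivAt g (g' x) x) (hg' : ∀ x, HasDerivAt g' (g'' x) x)
    (hC : ∀ x, |g'' x| ≤ C) (x y : ℝ) : |g (x + y) - g x - g' x * y| ≤ C * y ^ 2 := by
  have hC0 : 0 ≤ C := (abs_nonneg _).trans (hC 0)
  have h := Convex.norm_image_sub_le_of_norm_hasDerivWithin_le (s := uIcc x (x + y))
    (f := fun u => g u - g' x * u) (f' := fun u => g' u - g' x) (C := C * |y|) (x := x) (y := x + y)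
    (fun u _ => ((hg u).sub (by simpa using (hasDerivAt_id u).const_mul (g' x))).hasDerivWithinAt)
    (fun u hu => ?_) (convex_uIcc _ _) left_mem_uIcc right_mem_uIcc
  · simp only [Real.norm_eq_abs, add_sub_cancel_left] at h
    rw [mul_assoc, ← abs_mul, ← sq, abs_of_nonneg (sq_nonneg y)] at h
    refine le_trans (le_of_eq ?_) h
    congr 1; ring
  · refine (abs_sub_le_of_hasDerivAt hg' hC x u).trans ?_
    have := abs_sub_left_of_mem_uIcc hu
    rw [add_sub_cancel_left] at this
    gcongr

/-- First-order expansion of a conditional expectation `E[g(N + M) | m]`, with `M` known given `m`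
and `N` independent of `m`. -/
lemma ae_abs_condExp_comp_add_sub_le [IsProbabilityMeasure P] (hm : m ≤ mΩ) {M N : Ω → ℝ}
    (hM : MemLp M 2 P) (hMm : AEStronglyMeasurable[m] M P) (hN : AEMeasurable N P)
    (hNm : ∀ h : ℝ → ℝ, Measurable h → P[fun ω => h (N ω) | m] =ᵐ[P] fun _ => ∫ ω, h (N ω) ∂P)
    (hM0 : ∫ ω, M ω ∂P = 0) (hg : ∀ x, HasDerivAt g (g' x) x)
    (hg' : ∀ x, HasDerivAt g' (g'' x) x) (hC0 : ∀ x, |g x| ≤ C) (hC1 : ∀ x, |g' x| ≤ C)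
    (hC2 : ∀ x, |g'' x| ≤ C) (h0 : ∫ ω, g (N ω + M ω) ∂P = 0) :
    ∀ᵐ ω ∂P, |P[fun ω => g (N ω + M ω) | m] ω - (∫ ω, g' (N ω + M ω) ∂P) * M ω|
      ≤ 2 * C * (M ω ^ 2 + ∫ ω, M ω ^ 2 ∂P) := by
  have hC : 0 ≤ C := (abs_nonneg _).trans (hC2 0)
  have hgc : Continuous g := continuous_iff_continuousAt.2 fun x => (hg x).continuousAt
  have hgc' : Continuous g' := continuous_iff_continuousAt.2 fun x => (hg' x).continuousAt
  have hMa : AEMeasurable M P := hM.aestronglyMeasurable.aemeasurable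
  have hM1 : Integrable M P := hM.integrable one_le_two
  have hM2 : Integrable (fun ω => M ω ^ 2) P := hM.integrable_sq
  have hZ : AEMeasurable (fun ω => N ω + M ω) P := hN.add hMa
  have bdd : ∀ {f : ℝ → ℝ} {X : Ω → ℝ}, Continuous f → (∀ x, |f x| ≤ C) → AEMeasurable X P →
      Integrable (fun ω => f (X ω)) P := fun hf hb hX =>
    (integrable_const C).mono' (hf.measurable.comp_aemeasurable hX).aestronglyMeasurable
      (Eventually.of_forall fun ω => hb _)
  have hgN := bdd hgc hC0 hN
  have hgN' := bdd hgc' hC1 hN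
  have hgZ := bdd hgc hC0 hZ
  have hgZ' := bdd hgc' hC1 hZ
  have hgM : Integrable (fun ω => g' (N ω) * M ω) P :=
    hM1.bdd_mul hgN'.aestronglyMeasurable (Eventually.of_forall fun ω => hC1 _)
  set R : Ω → ℝ := fun ω => g (N ω + M ω) - g (N ω) - g' (N ω) * M ω with hRdef
  have hR : Integrable R P := (hgZ.sub hgN).sub hgM
  have hRle : ∀ ω, |R ω| ≤ C * M ω ^ 2 := fun ω => abs_taylor_le hg hg' hC2 _ _
  set a := ∫ ω, g (N ω) ∂P with ha
  set b := ∫ ω, g' (N ω) ∂P with hb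
  set κ := ∫ ω, g' (N ω + M ω) ∂P with hκ
  set v := ∫ ω, M ω ^ 2 ∂P with hv
  have hbM : P[fun ω => g' (N ω) * M ω | m] =ᵐ[P] fun ω => b * M ω := by
    refine (condExp_mul_of_aestronglyMeasurable_right hMm hgM hgN').trans ?_
    filter_upwards [hNm g' hgc'.measurable] with ω hω
    rw [Pi.mul_apply, hω]
  -- Since `E g(N+M) = 0` and `E[g'(N) M] = b E M = 0`, the remainder has mean `-a`. Hence `a`
  -- inherits the quadratic bound.
  have hIR : ∫ ω, R ω ∂P = -a := by
    have hgM0 : ∫ ω, g' (N ω) * M ω ∂P = 0 := by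
      rw [← integral_condExp hm, integral_congr_ae hbM, integral_const_mul, hM0, mul_zero]
    have h1 : ∫ ω, R ω ∂P = ∫ ω, (g (N ω + M ω) - g (N ω)) ∂P - ∫ ω, g' (N ω) * M ω ∂P :=
      integral_sub (hgZ.sub hgN) hgM
    rw [h1, integral_sub hgZ hgN, h0, hgM0]
    ring
  have hav : |a| ≤ C * v := by
    rw [← abs_neg, ← hIR, hv, ← integral_const_mul]
    exact (abs_integral_le_integral_abs).trans (integral_mono hR.abs (hM2.const_mul C) hRle)
  have hM1v : (∫ ω, |M ω| ∂P) ^ 2 ≤ v := by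
    have h := variance_nonneg (fun ω => |M ω|) P
    rw [variance_eq_sub (X := fun ω => |M ω|) hM.norm] at h
    simp only [Pi.pow_apply, sq_abs] at h
    linarith
  -- Replacing `b` by `κ` costs one order in `M`; multiplied by the linear factor `M` this is again
  -- quadratic.
  have hbκ : |b - κ| ≤ C * ∫ ω, |M ω| ∂P := by
    rw [hb, hκ, ← integral_sub hgN' hgZ', ← integral_const_mul]
    refine abs_integral_le_integral_abs.trans
      (integral_mono (hgN'.sub hgZ').abs (hM1.abs.const_mul C) fun ω => ?_)
    have := abs_sub_le_of_hasDerivAt hg' hC2 (N ω + M ω) (N ω)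
    simpa using this
  have hsum : P[fun ω => g (N ω + M ω) | m] =ᵐ[P] fun ω => a + b * M ω + P[R | m] ω := by
    have e : (fun ω => g (N ω + M ω))
        = ((fun ω => g (N ω)) + fun ω => g' (N ω) * M ω) + R := by
      ext ω; simp only [hRdef, Pi.add_apply]; ring
    rw [e]
    filter_upwards [condExp_add (hgN.add hgM) hR m, condExp_add hgN hgM m, hNm g hgc.measurable,
      hbM] with ω h1 h2 h3 h4
    rw [h1, Pi.add_apply, h2, Pi.add_apply, h3, h4]
  have hsq : P[fun ω => C * M ω ^ 2 | m] =ᵐ[P] fun ω => C * M ω ^ 2 :=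
    condExp_of_aestronglyMeasurable' hm ((hMm.pow 2).const_mul C) (hM2.const_mul C)
  have hsq' : P[fun ω => -(C * M ω ^ 2) | m] =ᵐ[P] fun ω => -(C * M ω ^ 2) :=
    condExp_of_aestronglyMeasurable' hm ((hMm.pow 2).const_mul C).neg (hM2.const_mul C).neg
  have hup := condExp_mono (m := m) hR (hM2.const_mul C)
    (Eventually.of_forall fun ω => (abs_le.1 (hRle ω)).2)
  have hlo := condExp_mono (m := m) (hM2.const_mul C).neg hR
    (Eventually.of_forall fun ω => (abs_le.1 (hRle ω)).1)
  filter_upwards [hsum, hsq, hsq', hup, hlo] with ω h1 h2 h3 h4 h5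
  rw [h1]
  have h6 : |P[R | m] ω| ≤ C * M ω ^ 2 := by
    rw [abs_le]
    exact ⟨h3.symm.le.trans h5, h4.trans h2.le⟩
  have h7 : |(b - κ) * M ω| ≤ C * (v + M ω ^ 2) := by
    rw [abs_mul]
    have h8 : |b - κ| * |M ω| ≤ C * (∫ ω, |M ω| ∂P) * |M ω| := by gcongr
    have h9 : (∫ ω, |M ω| ∂P) * |M ω| ≤ v + M ω ^ 2 := by
      nlinarith [sq_nonneg ((∫ ω, |M ω| ∂P) - |M ω|), sq_abs (M ω), sq_nonneg (M ω),
        sq_nonneg (∫ ω, |M ω| ∂P)]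
    calc _ ≤ _ := h8
      _ = C * ((∫ ω, |M ω| ∂P) * |M ω|) := by ring
      _ ≤ _ := by gcongr
  calc |a + b * M ω + P[R | m] ω - κ * M ω| = |a + (b - κ) * M ω + P[R | m] ω| := by
        congr 1; ring
    _ ≤ |a| + |(b - κ) * M ω| + |P[R | m] ω| := abs_add_three _ _ _
    _ ≤ C * v + C * (v + M ω ^ 2) + C * M ω ^ 2 := by gcongr
    _ = _ := by ring

end Taylor

/-! ### Moments of centered Gaussian variables -/

section GaussianMoments

variable {Ω : Type*} {mΩ : MeasurableSpace Ω} {P : Measure Ω}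

lemma integrable_pow_gaussianReal (k : ℕ) (v : ℝ≥0) :
    Integrable (fun x : ℝ => x ^ k) (gaussianReal 0 v) := by
  rcases Nat.eq_zero_or_pos k with rfl | hk
  · simp
  have := (memLp_id_gaussianReal' (μ := 0) (v := v) k (by simp)).integrable_norm_pow hk.ne'
  refine this.mono' (by fun_prop) (Eventually.of_forall fun x => ?_)
  simp

lemma gaussianReal_sq_eq_map (c : ℝ) :
    gaussianReal 0 (c ^ 2).toNNReal = (gaussianReal 0 1).map (fun x => c * x) := by
  rw [gaussianReal_map_const_mul, mul_zero, mul_one]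
  congr 1
  exact Real.toNNReal_of_nonneg (sq_nonneg c)

/-- A centered Gaussian variable of variance `c²` has the law of `c` times a standard one. -/
lemma integral_comp_of_map_eq_gaussianReal {X : Ω → ℝ} (hX : AEMeasurable X P) {c : ℝ}
    (h : P.map X = gaussianReal 0 (c ^ 2).toNNReal) {f : ℝ → ℝ} (hf : Continuous f) :
    ∫ ω, f (X ω) ∂P = ∫ x, f (c * x) ∂gaussianReal 0 1 := by
  rw [← integral_map hX hf.aestronglyMeasurable, h, gaussianReal_sq_eq_map,
    integral_map (by fun_prop) hf.aestronglyMeasurable]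

lemma integrable_pow_of_map_eq_gaussianReal {X : Ω → ℝ} (hX : AEMeasurable X P) {v : ℝ≥0}
    (h : P.map X = gaussianReal 0 v) (k : ℕ) : Integrable (fun ω => X ω ^ k) P := by
  have := integrable_pow_gaussianReal k v
  rw [← h] at this
  exact this.comp_aemeasurable hX

lemma integral_pow_of_map_eq_gaussianReal {X : Ω → ℝ} (hX : AEMeasurable X P) {c : ℝ}
    (h : P.map X = gaussianReal 0 (c ^ 2).toNNReal) (k : ℕ) :
    ∫ ω, X ω ^ k ∂P = c ^ k * ∫ x, x ^ k ∂gaussianReal 0 1 := by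
  rw [integral_comp_of_map_eq_gaussianReal hX h (continuous_pow k), ← integral_const_mul]
  simp_rw [mul_pow]

end GaussianMoments

/-! ### The volatility function and its derivatives -/

section Volatility

variable {H : ℝ} {F : ℝ → ℝ}

lemma IsVolatilityFunction.hasDerivAt (hF : IsVolatilityFunction H F) (x : ℝ) :
    HasDerivAt F (deriv F x) x :=
  (hF.smooth.differentiable (by simp) x).hasDerivAt

lemma IsVolatilityFunction.hasDerivAt_deriv (hF : IsVolatilityFunction H F) (x : ℝ) :
    HasDerivAt (deriv F) (deriv (deriv F) x) x := by
  have h : ContDiff ℝ 2 F := by exact_mod_cast contDiff_infty.1 hF.smooth 2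
  have h1 := (h.differentiable_iteratedDeriv 1 (by norm_num)) x
  rw [iteratedDeriv_one] at h1
  exact h1.hasDerivAt

lemma IsVolatilityFunction.hasDerivAt_G (hF : IsVolatilityFunction H F) (x : ℝ) :
    HasDerivAt (G H F) (F x * deriv F x) x := by
  have h := (((hF.hasDerivAt x).pow 2).sub_const (sigmaBarSq H F)).const_mul (1 / 2 : ℝ)
  refine h.congr_deriv ?_
  push_cast
  ring

lemma IsVolatilityFunction.hasDerivAt_mul_deriv (hF : IsVolatilityFunction H F) (x : ℝ) :
    HasDerivAt (fun x => F x * deriv F x) (deriv F x * deriv F x + F x * deriv (deriv F) x) x :=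
  (hF.hasDerivAt x).mul (hF.hasDerivAt_deriv x)

/-- `G` and its first two derivatives are bounded. -/
lemma IsVolatilityFunction.exists_bound (hF : IsVolatilityFunction H F) :
    ∃ C : ℝ, (∀ x, |G H F x| ≤ C) ∧ (∀ x, |F x * deriv F x| ≤ C) ∧
      ∀ x, |deriv F x * deriv F x + F x * deriv (deriv F) x| ≤ C := by
  obtain ⟨C0, h0⟩ := hF.bounded 0
  obtain ⟨C1, h1⟩ := hF.bounded 1
  obtain ⟨C2, h2⟩ := hF.bounded 2
  simp only [iteratedDeriv_zero] at h0
  simp only [iteratedDeriv_one] at h1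
  simp only [iteratedDeriv_succ, iteratedDeriv_zero] at h2
  have p0 : 0 ≤ C0 := (abs_nonneg _).trans (h0 0)
  have p1 : 0 ≤ C1 := (abs_nonneg _).trans (h1 0)
  have p2 : 0 ≤ C2 := (abs_nonneg _).trans (h2 0)
  have q1 : ∀ x, |F x * deriv F x| ≤ C0 * C1 := fun x => by
    rw [abs_mul]; exact mul_le_mul (h0 x) (h1 x) (abs_nonneg _) p0
  have q2 : ∀ x, |deriv F x * deriv F x + F x * deriv (deriv F) x| ≤ C1 * C1 + C0 * C2 := fun x => by
    refine (abs_add_le _ _).trans (add_le_add ?_ ?_) <;> rw [abs_mul]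
    · exact mul_le_mul (h1 x) (h1 x) (abs_nonneg _) p1
    · exact mul_le_mul (h0 x) (h2 x) (abs_nonneg _) p0
  have q0 : ∀ x, |G H F x| ≤ C0 ^ 2 + |sigmaBarSq H F| := fun x => by
    have e1 : |F x ^ 2| ≤ C0 ^ 2 := by rw [abs_pow]; exact pow_le_pow_left₀ (abs_nonneg _) (h0 x) 2
    have e2 := abs_sub (F x ^ 2) (sigmaBarSq H F)
    rw [G, abs_mul, abs_of_pos (by norm_num : (0 : ℝ) < 1 / 2)]
    nlinarith [abs_nonneg (F x ^ 2 - sigmaBarSq H F)]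
  have r0 : 0 ≤ C0 ^ 2 + |sigmaBarSq H F| := by positivity
  have r1 : 0 ≤ C0 * C1 := by positivity
  have r2 : 0 ≤ C1 * C1 + C0 * C2 := by positivity
  refine ⟨(C0 ^ 2 + |sigmaBarSq H F|) + C0 * C1 + (C1 * C1 + C0 * C2), fun x => ?_, fun x => ?_,
    fun x => ?_⟩
  · linarith [q0 x]
  · linarith [q1 x]
  · linarith [q2 x]

lemma IsVolatilityFunction.continuous_G (hF : IsVolatilityFunction H F) : Continuous (G H F) :=
  continuous_iff_continuousAt.2 fun x => (hF.hasDerivAt_G x).continuousAt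

lemma IsVolatilityFunction.integral_G_gaussianReal (hF : IsVolatilityFunction H F) :
    ∫ x, G H F (sigmaOU H * x) ∂gaussianReal 0 1 = 0 := by
  obtain ⟨C, hC⟩ := hF.bounded 0
  simp only [iteratedDeriv_zero] at hC
  have hc : Continuous F := hF.smooth.continuous
  have hi : Integrable (fun x => F (sigmaOU H * x) ^ 2) (gaussianReal 0 1) := by
    refine (integrable_const (C ^ 2)).mono' (by fun_prop) (Eventually.of_forall fun x => ?_)
    rw [Real.norm_eq_abs, abs_pow]
    exact pow_le_pow_left₀ (abs_nonneg _) (hC _) 2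
  simp only [G]
  rw [integral_const_mul, integral_sub hi (integrable_const _)]
  simp [sigmaBarSq]

end Volatility

/-! ### The volatility process and its conditional linearization -/

section VolatilityProcess

variable {Ω : Type u} [MeasurableSpace Ω] {P : Measure Ω} [IsProbabilityMeasure P] {H : ℝ}
  {F : ℝ → ℝ} {W : ℝ → Ω → ℝ} {B : ℝ≥0 → Ω → ℝ} {WH : ℝ → Ω → ℝ}

lemma memLp_four_of_mem (hW : IsTwoSidedBrownian W P) {f : Lp ℝ 2 P}
    (hf : f ∈ gaussianSpace hW.gaussian) : MemLp f 4 P :=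
  memLp_four_of_integrable (Lp.aestronglyMeasurable f)
    (integrable_pow_of_map_eq_gaussianReal (Lp.aestronglyMeasurable f).aemeasurable
      (map_eq_gaussianReal_of_mem hW.gaussian hW.mean_zero hf) 4)

lemma integral_pow_of_mem (hW : IsTwoSidedBrownian W P) {f : Lp ℝ 2 P}
    (hf : f ∈ gaussianSpace hW.gaussian) (k : ℕ) :
    ∫ ω, f ω ^ k ∂P = ‖f‖ ^ k * ∫ x, x ^ k ∂gaussianReal 0 1 :=
  integral_pow_of_map_eq_gaussianReal (Lp.aestronglyMeasurable f).aemeasurable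
    (map_eq_gaussianReal_of_mem hW.gaussian hW.mean_zero hf) k

lemma integral_comp_fouLp (hH : H ∈ Ioo (1 / 2 : ℝ) 1) (hW : IsTwoSidedBrownian W P)
    (hWH : IsFractionalBrownian P H W WH) {ε : ℝ} (hε : 0 < ε) (s : ℝ) {f : ℝ → ℝ}
    (hf : Continuous f) :
    ∫ ω, f (fouLp hWH ε s ω) ∂P = ∫ x, f (sigmaOU H * x) ∂gaussianReal 0 1 := by
  refine integral_comp_of_map_eq_gaussianReal (Lp.aestronglyMeasurable _).aemeasurable ?_ hf
  rw [map_eq_gaussianReal_of_mem hW.gaussian hW.mean_zero (fouLp_mem hW hWH ε s),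
    norm_sq_fouLp hH hW hWH hε]

lemma norm_fouLp (hH : H ∈ Ioo (1 / 2 : ℝ) 1) (hW : IsTwoSidedBrownian W P)
    (hWH : IsFractionalBrownian P H W WH) {ε : ℝ} (hε : 0 < ε) (s : ℝ) :
    ‖fouLp hWH ε s‖ = sigmaOU H :=
  (pow_left_inj₀ (norm_nonneg _) (Real.sqrt_nonneg _) two_ne_zero).1
    (norm_sq_fouLp hH hW hWH hε s)

lemma ae_continuous_fOU (hH : H ∈ Ioo (1 / 2 : ℝ) 1) (hW : IsTwoSidedBrownian W P)
    (hWH : IsFractionalBrownian P H W WH) {ε : ℝ} (hε : 0 < ε) :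
    ∀ᵐ ω ∂P, Continuous fun t => fOU H WH ε t ω := by
  filter_upwards [hWH.continuous_paths, (ae_fOU hH hW hWH hε 0).1] with ω h1 h2
  exact continuous_fOU h1 h2

lemma aestronglyMeasurable_uncurry_fOU (hH : H ∈ Ioo (1 / 2 : ℝ) 1) (hW : IsTwoSidedBrownian W P)
    (hWH : IsFractionalBrownian P H W WH) {ε : ℝ} (hε : 0 < ε) (μ : Measure ℝ) [SFinite μ] :
    AEStronglyMeasurable (Function.uncurry fun s ω => fOU H WH ε s ω) (μ.prod P) :=
  aestronglyMeasurable_uncurry_of_continuous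
    (fun s => (Lp.aestronglyMeasurable _).congr (ae_fOU hH hW hWH hε s).2)
    (ae_continuous_fOU hH hW hWH hε) μ

lemma integrable_uncurry_G_fOU (hH : H ∈ Ioo (1 / 2 : ℝ) 1) (hF : IsVolatilityFunction H F)
    (hW : IsTwoSidedBrownian W P)
    (hWH : IsFractionalBrownian P H W WH) {ε : ℝ} (hε : 0 < ε) (μ : Measure ℝ) [IsFiniteMeasure μ] :
    Integrable (Function.uncurry fun s ω => G H F (fOU H WH ε s ω)) (μ.prod P) := by
  obtain ⟨C, hC, -, -⟩ := hF.exists_bound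
  refine (integrable_const C).mono' ?_ (Eventually.of_forall fun z => hC _)
  exact hF.continuous_G.comp_aestronglyMeasurable
    (aestronglyMeasurable_uncurry_fOU hH hW hWH hε μ)

lemma intG_eq_setIntegral {ε t T : ℝ} (htT : t ≤ T) :
    intG H F WH ε t T = fun ω => ∫ s in Ioc t T, G H F (fOU H WH ε s ω) := by
  ext ω
  rw [intG, intervalIntegral.integral_of_le htT]

lemma integrable_intG (hH : H ∈ Ioo (1 / 2 : ℝ) 1) (hF : IsVolatilityFunction H F)
    (hW : IsTwoSidedBrownian W P) (hWH : IsFractionalBrownian P H W WH) {ε : ℝ} (hε : 0 < ε)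
    {t T : ℝ} (htT : t ≤ T) : Integrable (intG H F WH ε t T) P := by
  rw [intG_eq_setIntegral htT]
  exact (integrable_uncurry_G_fOU hH hF hW hWH hε (volume.restrict (Ioc t T))).integral_prod_right

/-- Fubini reduces this to fixed times, where the law is `N(0, σ_ou²)` and `G` has mean zero by the
choice of `sigmaBarSq`. -/
lemma integral_intG (hH : H ∈ Ioo (1 / 2 : ℝ) 1) (hF : IsVolatilityFunction H F)
    (hW : IsTwoSidedBrownian W P) (hWH : IsFractionalBrownian P H W WH) {ε : ℝ} (hε : 0 < ε)
    {t T : ℝ} (htT : t ≤ T) : ∫ ω, intG H F WH ε t T ω ∂P = 0 := by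
  rw [intG_eq_setIntegral htT, ← integral_integral_swap
    (integrable_uncurry_G_fOU hH hF hW hWH hε (volume.restrict (Ioc t T)))]
  have : ∀ s, ∫ ω, G H F (fOU H WH ε s ω) ∂P = 0 := by
    intro s
    rw [← hF.integral_G_gaussianReal, ← integral_comp_fouLp hH hW hWH hε s hF.continuous_G]
    refine integral_congr_ae ?_
    filter_upwards [(ae_fOU hH hW hWH hε s).2] with ω hω
    rw [hω]
  simp [this]

lemma abs_intG_le {C : ℝ} (hC : ∀ x, |G H F x| ≤ C) (ε t T : ℝ) (ω : Ω) :
    |intG H F WH ε t T ω| ≤ C * |T - t| := by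
  rw [intG, ← Real.norm_eq_abs]
  exact intervalIntegral.norm_integral_le_of_norm_le_const fun _ _ => hC _

lemma ae_abs_phi_le {C : ℝ} (hC : ∀ x, |G H F x| ≤ C) (ε t T : ℝ) :
    ∀ᵐ ω ∂P, |phi P H F W B WH ε t T ω| ≤ C * |T - t| :=
  ae_bdd_abs_condExp_of_ae_bdd_abs (Eventually.of_forall fun ω => abs_intG_le hC ε t T ω)

lemma aestronglyMeasurable_phi (hW : IsTwoSidedBrownian W P) (hBm : ∀ s, Measurable (B s))
    (ε t T : ℝ) : AEStronglyMeasurable (phi P H F W B WH ε t T) P :=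
  (stronglyMeasurable_condExp.mono (past_le hW hBm t)).aestronglyMeasurable

lemma memLp_phi (hF : IsVolatilityFunction H F) (hW : IsTwoSidedBrownian W P)
    (hBm : ∀ s, Measurable (B s)) (p : ℝ≥0∞) (ε t T : ℝ) :
    MemLp (phi P H F W B WH ε t T) p P := by
  obtain ⟨C, hC, -, -⟩ := hF.exists_bound
  exact MemLp.of_bound (aestronglyMeasurable_phi hW hBm ε t T) _ (ae_abs_phi_le hC ε t T)

lemma integral_phi (hH : H ∈ Ioo (1 / 2 : ℝ) 1) (hF : IsVolatilityFunction H F)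
    (hW : IsTwoSidedBrownian W P) (hBm : ∀ s, Measurable (B s))
    (hWH : IsFractionalBrownian P H W WH) {ε : ℝ} (hε : 0 < ε) {t T : ℝ} (htT : t ≤ T) :
    ∫ ω, phi P H F W B WH ε t T ω ∂P = 0 := by
  rw [phi, integral_condExp (past_le hW hBm t), integral_intG hH hF hW hWH hε htT]

/-- Conditional linearization: given the past at time `t`, the centered volatility at a later time
is a multiple of the predicted Ornstein--Uhlenbeck process, up to a quadratic error. -/
lemma ae_abs_condExp_G_sub_le (hH : H ∈ Ioo (1 / 2 : ℝ) 1) (hF : IsVolatilityFunction H F)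
    (hW : IsTwoSidedBrownian W P) (hBm : ∀ s, Measurable (B s))
    (hWB : IndepFun (fun ω t => W t ω) (fun ω s => B s ω) P)
    (hWH : IsFractionalBrownian P H W WH) :
    ∃ C : ℝ, 0 ≤ C ∧ ∀ ε t s : ℝ, 0 < ε → 0 ≤ t →
      ∀ᵐ ω ∂P, |P[fun ω => G H F (fOU H WH ε s ω) - meanFF' H F * fOU H WH ε s ω | past W B t] ω|
        ≤ C * (condPast hW hBm t (fouLp hWH ε s) ω ^ 2
          + ‖condPast hW hBm t (fouLp hWH ε s)‖ ^ 2) := by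
  obtain ⟨C, hC0, hC1, hC2⟩ := hF.exists_bound
  have hCnn : 0 ≤ C := (abs_nonneg _).trans (hC0 0)
  refine ⟨2 * C, by positivity, fun ε t s hε ht => ?_⟩
  have hZ := fouLp_mem hW hWH ε s
  set Z := fouLp hWH ε s with hZdef
  set M := condPast hW hBm t Z with hM
  set N := Z - M with hN
  have hM_mem : M ∈ gaussianSpace hW.gaussian := condPast_mem hW hBm hWB ht hZ
  have hZ_eq : Z =ᵐ[P] fOU H WH ε s := (ae_fOU hH hW hWH hε s).2
  have hNM : (fun ω => N ω + M ω) =ᵐ[P] Z := by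
    filter_upwards [Lp.coeFn_sub Z M] with ω hω
    rw [hN, hω, Pi.sub_apply, sub_add_cancel]
  have hMm : AEStronglyMeasurable[past W B t] M P :=
    ⟨_, stronglyMeasurable_condExp, coeFn_condPast hW hBm t Z⟩
  have hcong : ∀ f : ℝ → ℝ, (fun ω => f (N ω + M ω)) =ᵐ[P] fun ω => f (Z ω) := fun f => by
    filter_upwards [hNM] with ω hω
    rw [hω]
  have h0 : ∫ ω, G H F (N ω + M ω) ∂P = 0 := by
    rw [integral_congr_ae (hcong _), hZdef, integral_comp_fouLp hH hW hWH hε s hF.continuous_G,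
      hF.integral_G_gaussianReal]
  -- The slope is averaged over the full variable `N + M`, whose law does not depend on `ε` or `s`.
  -- This is why the coefficient is exactly `⟨FF'⟩`.
  have hκ : ∫ ω, F (N ω + M ω) * deriv F (N ω + M ω) ∂P = meanFF' H F := by
    have hc : Continuous fun x => F x * deriv F x :=
      continuous_iff_continuousAt.2 fun x => (hF.hasDerivAt_mul_deriv x).continuousAt
    rw [integral_congr_ae (hcong fun x => F x * deriv F x), hZdef,
      integral_comp_fouLp hH hW hWH hε s hc, meanFF']
  have key := ae_abs_condExp_comp_add_sub_le (past_le hW hBm t) (Lp.memLp M) hMm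
    (Lp.aestronglyMeasurable N).aemeasurable
    (fun h hh => condExp_comp_sub_condPast hW hBm hWB ht hZ hh)
    (integral_eq_zero_of_mem_gaussianSpace hW.gaussian hW.mean_zero hM_mem)
    hF.hasDerivAt_G hF.hasDerivAt_mul_deriv hC0 hC1 hC2 h0
  rw [hκ, ← norm_sq_Lp_eq_integral] at key
  have hGint : Integrable (fun ω => G H F (fOU H WH ε s ω)) P :=
    (integrable_const C).mono' (hF.continuous_G.comp_aestronglyMeasurable
      ((Lp.aestronglyMeasurable Z).congr hZ_eq)) (Eventually.of_forall fun ω => hC0 _)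
  have hZint : Integrable (fOU H WH ε s) P := ((Lp.memLp Z).integrable one_le_two).congr hZ_eq
  have e1 : P[fun ω => G H F (N ω + M ω) | past W B t]
      =ᵐ[P] P[fun ω => G H F (fOU H WH ε s ω) | past W B t] := by
    refine condExp_congr_ae ?_
    filter_upwards [hcong (G H F), hZ_eq] with ω h1 h2
    rw [h1, h2]
  have e2 : P[fOU H WH ε s | past W B t] =ᵐ[P] M :=
    (condExp_congr_ae hZ_eq.symm).trans (coeFn_condPast hW hBm t Z).symm
  have e3 := condExp_sub hGint (hZint.const_mul (meanFF' H F)) (past W B t)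
  have e4 := condExp_smul (μ := P) (meanFF' H F) (fOU H WH ε s) (past W B t)
  filter_upwards [key, e1, e2, e3, e4] with ω h1 h2 h3 h4 h5
  have h6 : P[fun ω => G H F (fOU H WH ε s ω) - meanFF' H F * fOU H WH ε s ω | past W B t] ω
      = P[fun ω => G H F (N ω + M ω) | past W B t] ω - meanFF' H F * M ω := by
    refine h4.trans ?_
    have h5' : P[fun ω => meanFF' H F * fOU H WH ε s ω | past W B t] ω
        = meanFF' H F * P[fOU H WH ε s | past W B t] ω := h5
    rw [Pi.sub_apply, h5', h3, h2]
  rw [h6]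
  exact h1

end VolatilityProcess

/-! ### Fourth-moment approximation of `φ` by a Gaussian variable -/

section Approximation

variable {Ω : Type u} [MeasurableSpace Ω] {P : Measure Ω} [IsProbabilityMeasure P] {H : ℝ}
  {F : ℝ → ℝ} {W : ℝ → Ω → ℝ} {B : ℝ≥0 → Ω → ℝ} {WH : ℝ → Ω → ℝ}

/-- The integral of the fractional Ornstein--Uhlenbeck process over `[t, T]`, as an element of
`L²(P)`. -/
noncomputable def fouIntLp (hWH : IsFractionalBrownian P H W WH) (ε t T : ℝ) : Lp ℝ 2 P :=
  ε ^ (1 - H) • (fbmLp hWH T - fbmLp hWH t) - ε • (fouLp hWH ε T - fouLp hWH ε t)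

lemma fouIntLp_mem (hW : IsTwoSidedBrownian W P) (hWH : IsFractionalBrownian P H W WH)
    (ε t T : ℝ) : fouIntLp hWH ε t T ∈ gaussianSpace hW.gaussian :=
  Submodule.sub_mem _
    (Submodule.smul_mem _ _ (Submodule.sub_mem _ (fbmLp_mem hW hWH _) (fbmLp_mem hW hWH _)))
    (Submodule.smul_mem _ _ (Submodule.sub_mem _ (fouLp_mem hW hWH _ _) (fouLp_mem hW hWH _ _)))

lemma coeFn_fouIntLp (hH : H ∈ Ioo (1 / 2 : ℝ) 1) (hW : IsTwoSidedBrownian W P)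
    (hWH : IsFractionalBrownian P H W WH) {ε : ℝ} (hε : 0 < ε) (t T : ℝ) :
    fouIntLp hWH ε t T =ᵐ[P] fun ω => ∫ s in t..T, fOU H WH ε s ω := by
  filter_upwards [Lp.coeFn_sub (ε ^ (1 - H) • (fbmLp hWH T - fbmLp hWH t))
      (ε • (fouLp hWH ε T - fouLp hWH ε t)),
    Lp.coeFn_smul (ε ^ (1 - H)) (fbmLp hWH T - fbmLp hWH t),
    Lp.coeFn_smul ε (fouLp hWH ε T - fouLp hWH ε t),
    Lp.coeFn_sub (fbmLp hWH T) (fbmLp hWH t), Lp.coeFn_sub (fouLp hWH ε T) (fouLp hWH ε t),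
    coeFn_fbmLp hWH T, coeFn_fbmLp hWH t, (ae_fOU hH hW hWH hε T).2, (ae_fOU hH hW hWH hε t).2,
    hWH.continuous_paths, (ae_fOU hH hW hWH hε 0).1] with ω h1 h2 h3 h4 h5 h6 h7 h8 h9 h10 h11
  rw [fouIntLp, h1, Pi.sub_apply, h2, h3, Pi.smul_apply, Pi.smul_apply, h4, h5, Pi.sub_apply,
    Pi.sub_apply, h6, h7, h8, h9, integral_fOU hε h10 h11, smul_eq_mul, smul_eq_mul]

lemma integrableOn_sub_rpow {p t T : ℝ} (hp : -1 < p) (htT : t ≤ T) :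
    IntegrableOn (fun s => (s - t) ^ p) (Ioc t T) := by
  have h : IntervalIntegrable (fun x : ℝ => x ^ p) volume 0 (T - t) :=
    intervalIntegral.intervalIntegrable_rpow' hp
  have h2 := h.comp_sub_right t
  rw [zero_add, sub_add_cancel] at h2
  exact (intervalIntegrable_iff_integrableOn_Ioc_of_le htT).1 h2

lemma setIntegral_sub_rpow {p t T : ℝ} (hp : -1 < p) (htT : t ≤ T) :
    ∫ s in Ioc t T, (s - t) ^ p = (T - t) ^ (p + 1) / (p + 1) := by
  rw [← intervalIntegral.integral_of_le htT,
    intervalIntegral.integral_comp_sub_right (fun x => x ^ p) t, sub_self,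
    integral_rpow (Or.inl hp), Real.zero_rpow (by linarith), sub_zero]

lemma memLp_four_fOU (hH : H ∈ Ioo (1 / 2 : ℝ) 1) (hW : IsTwoSidedBrownian W P)
    (hWH : IsFractionalBrownian P H W WH) {ε : ℝ} (hε : 0 < ε) (s : ℝ) :
    MemLp (fOU H WH ε s) 4 P :=
  (memLp_congr_ae (ae_fOU hH hW hWH hε s).2).1 (memLp_four_of_mem hW (fouLp_mem hW hWH ε s))

lemma memLp_G_fOU (hH : H ∈ Ioo (1 / 2 : ℝ) 1) (hF : IsVolatilityFunction H F)
    (hW : IsTwoSidedBrownian W P) (hWH : IsFractionalBrownian P H W WH) {ε : ℝ} (hε : 0 < ε)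
    (s : ℝ) (p : ℝ≥0∞) : MemLp (fun ω => G H F (fOU H WH ε s ω)) p P := by
  obtain ⟨C, hC, -, -⟩ := hF.exists_bound
  exact MemLp.of_bound (hF.continuous_G.comp_aestronglyMeasurable
    (memLp_four_fOU hH hW hWH hε s).aestronglyMeasurable) C (Eventually.of_forall fun ω => hC _)

/-- Fourth moment of the conditional expectation of the linearization error at a fixed time. -/
lemma exists_integral_condExp_G_sub_pow_four_le (hH : H ∈ Ioo (1 / 2 : ℝ) 1)
    (hF : IsVolatilityFunction H F)
    (hW : IsTwoSidedBrownian W P) (hBm : ∀ s, Measurable (B s))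
    (hWB : IndepFun (fun ω t => W t ω) (fun ω s => B s ω) P)
    (hWH : IsFractionalBrownian P H W WH) :
    ∃ L : ℝ, 0 < L ∧ ∀ ε t s : ℝ, 0 < ε → 0 ≤ t → t < s →
      ∫ ω, P[fun ω => G H F (fOU H WH ε s ω) - meanFF' H F * fOU H WH ε s ω | past W B t] ω ^ 4 ∂P
        ≤ (L * ε ^ (2 - 2 * H) * (s - t) ^ (2 * H - 2)) ^ 4 := by
  obtain ⟨C, hC, hlin⟩ := ae_abs_condExp_G_sub_le hH hF hW hBm hWB hWH
  obtain ⟨K, hK, hbd⟩ := exists_norm_condPast_fouLp_le hH hW hBm hWB hWH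
  set A := ∫ x, x ^ 8 ∂gaussianReal 0 1 with hA
  have hA0 : 0 ≤ A := integral_nonneg fun x => by positivity
  -- Here `E M⁸ = ‖M‖⁸ A` since `M` is Gaussian. The final `+ 1` ensures `L ≥ 1`, so `L ≤ L⁴`
  -- replaces extracting a fourth root.
  set L := 8 * C ^ 4 * (A + 1) + 1 with hL
  have hL1 : 1 ≤ L := by
    have : 0 ≤ 8 * C ^ 4 * (A + 1) := by positivity
    linarith
  have hL4 : L ≤ L ^ 4 := le_self_pow₀ hL1 (by norm_num)
  refine ⟨L * (K + 1) ^ 2, by positivity, fun ε t s hε ht hts => ?_⟩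
  set X := P[fun ω => G H F (fOU H WH ε s ω) - meanFF' H F * fOU H WH ε s ω | past W B t] with hX
  have hX4 : MemLp X 4 P :=
    ((memLp_G_fOU hH hF hW hWH hε s 4).sub ((memLp_four_fOU hH hW hWH hε s).const_mul _)).condExp
      (by norm_num)
  set M := condPast hW hBm t (fouLp hWH ε s) with hM
  have hMmem : M ∈ gaussianSpace hW.gaussian := condPast_mem hW hBm hWB ht (fouLp_mem hW hWH ε s)
  set v := ‖M‖ ^ 2 with hv
  have hM8 : ∫ ω, M ω ^ 8 ∂P = v ^ 4 * A := by
    rw [integral_pow_of_mem hW hMmem, hv, ← pow_mul]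
  have hM8i : Integrable (fun ω => M ω ^ 8) P :=
    integrable_pow_of_map_eq_gaussianReal (Lp.aestronglyMeasurable M).aemeasurable
      (map_eq_gaussianReal_of_mem hW.gaussian hW.mean_zero hMmem) 8
  have h1 : ∫ ω, X ω ^ 4 ∂P ≤ ∫ ω, (8 * C ^ 4 * M ω ^ 8 + 8 * C ^ 4 * v ^ 4) ∂P := by
    refine integral_mono_ae (integrable_pow_four hX4) ((hM8i.const_mul _).add (integrable_const _)) ?_
    filter_upwards [hlin ε t s hε ht] with ω hω
    calc X ω ^ 4 = |X ω| ^ 4 := (Even.pow_abs (by decide) _).symm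
      _ ≤ (C * (M ω ^ 2 + v)) ^ 4 := pow_le_pow_left₀ (abs_nonneg _) hω 4
      _ = C ^ 4 * (M ω ^ 2 + v) ^ 4 := by ring
      _ ≤ C ^ 4 * (8 * ((M ω ^ 2) ^ 4 + v ^ 4)) := by gcongr; exact add_pow_four_le _ _
      _ = _ := by ring
  rw [integral_add (hM8i.const_mul _) (integrable_const _), integral_const_mul, hM8] at h1
  simp only [integral_const, probReal_univ, one_smul] at h1
  have hst : 0 < s - t := sub_pos.2 hts
  have hvle : v ≤ (K + 1) ^ 2 * (ε ^ (2 - 2 * H) * (s - t) ^ (2 * H - 2)) := by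
    have e1 : ε ^ (2 - 2 * H) = (ε ^ (1 - H)) ^ 2 := by
      rw [← Real.rpow_natCast, ← Real.rpow_mul hε.le]; congr 1; push_cast; ring
    have e2 : (s - t) ^ (2 * H - 2) = ((s - t) ^ (H - 1)) ^ 2 := by
      rw [← Real.rpow_natCast, ← Real.rpow_mul hst.le]; congr 1; push_cast; ring
    have h2 := pow_le_pow_left₀ (norm_nonneg _) (hbd ε t s hε ht hts) 2
    rw [← hM, ← hv, mul_pow, mul_pow, ← e1, ← e2] at h2
    have : K ^ 2 ≤ (K + 1) ^ 2 := by nlinarith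
    calc v ≤ _ := h2
      _ ≤ (K + 1) ^ 2 * ε ^ (2 - 2 * H) * (s - t) ^ (2 * H - 2) := by gcongr
      _ = _ := by ring
  have hv0 : 0 ≤ v := by positivity
  calc ∫ ω, X ω ^ 4 ∂P ≤ 8 * C ^ 4 * (A + 1) * v ^ 4 := by linarith
    _ ≤ L ^ 4 * v ^ 4 := by
      have : 8 * C ^ 4 * (A + 1) ≤ L ^ 4 := by linarith
      gcongr
    _ ≤ L ^ 4 * ((K + 1) ^ 2 * (ε ^ (2 - 2 * H) * (s - t) ^ (2 * H - 2))) ^ 4 := by gcongr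
    _ = _ := by ring

/-- Minkowski's inequality applied to the fixed-time linearization errors; `∫_t^T (s-t)^(2H-2) ds`
is finite because `2H - 2 > -1`. -/
lemma exists_integral_phi_sub_condPast_pow_four_le (hH : H ∈ Ioo (1 / 2 : ℝ) 1)
    (hF : IsVolatilityFunction H F)
    (hW : IsTwoSidedBrownian W P) (hBm : ∀ s, Measurable (B s))
    (hWB : IndepFun (fun ω t => W t ω) (fun ω s => B s ω) P)
    (hWH : IsFractionalBrownian P H W WH) {T : ℝ} (hT : 0 ≤ T) :
    ∃ K : ℝ, ∀ ε t : ℝ, 0 < ε → t ∈ Icc 0 T →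
      ∫ ω, (phi P H F W B WH ε t T ω
        - meanFF' H F * condPast hW hBm t (fouIntLp hWH ε t T) ω) ^ 4 ∂P
        ≤ (K * ε ^ (2 - 2 * H)) ^ 4 := by
  obtain ⟨L, hL, hfix⟩ := exists_integral_condExp_G_sub_pow_four_le hH hF hW hBm hWB hWH
  obtain ⟨C, hC, -, -⟩ := hF.exists_bound
  have hH1 : 0 < 2 * H - 1 := by linarith [hH.1]
  -- The `+ 1` keeps the bound strictly positive, as Minkowski's inequality requires, even when `T =
  -- 0`.
  refine ⟨L * (T ^ (2 * H - 1) / (2 * H - 1) + 1), fun ε t hε ht => ?_⟩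
  set κ := meanFF' H F with hκ
  set J := fouIntLp hWH ε t T with hJ
  have hJ4 : MemLp J 4 P := memLp_four_of_mem hW (fouIntLp_mem hW hWH ε t T)
  have hintG := integrable_intG hH hF hW hWH hε ht.2
  have hintG4 : MemLp (intG H F WH ε t T) 4 P :=
    MemLp.of_bound hintG.aestronglyMeasurable _ (Eventually.of_forall fun ω => abs_intG_le hC ε t T ω)
  set X : ℝ → Ω → ℝ := fun s ω => G H F (fOU H WH ε s ω) - κ * fOU H WH ε s ω with hX
  have hXm : AEStronglyMeasurable (Function.uncurry X) ((volume.restrict (Ioc t T)).prod P) :=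
    (hF.continuous_G.sub (continuous_const.mul continuous_id)).comp_aestronglyMeasurable
      (aestronglyMeasurable_uncurry_fOU hH hW hWH hε _)
  have hI : (fun ω => intG H F WH ε t T ω - κ * J ω)
      =ᵐ[P] fun ω => ∫ s in Ioc t T, X s ω := by
    filter_upwards [coeFn_fouIntLp hH hW hWH hε t T, ae_continuous_fOU hH hW hWH hε] with ω h1 h2
    have h3 : Continuous fun s => G H F (fOU H WH ε s ω) := hF.continuous_G.comp h2
    rw [hJ, h1, intG, ← intervalIntegral.integral_of_le ht.2, ← intervalIntegral.integral_const_mul]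
    exact (intervalIntegral.integral_sub (h3.intervalIntegrable _ _)
      ((continuous_const.mul h2).intervalIntegrable _ _)).symm
  have hX4 : ∀ s, MemLp (X s) 4 P := fun s =>
    (memLp_G_fOU hH hF hW hWH hε s 4).sub ((memLp_four_fOU hH hW hWH hε s).const_mul _)
  -- Only uniformity in `s` matters: this bound secures integrability on the product space and does
  -- not enter the final estimate.
  have hA : ∀ s, ∫ ω, X s ω ^ 4 ∂P
      ≤ 8 * C ^ 4 + 8 * κ ^ 4 * (sigmaOU H ^ 4 * ∫ x, x ^ 4 ∂gaussianReal 0 1) := by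
    intro s
    have hi := integrable_pow_four (memLp_four_fOU hH hW hWH hε s)
    have h1 : ∫ ω, X s ω ^ 4 ∂P ≤ ∫ ω, (8 * C ^ 4 + 8 * κ ^ 4 * fOU H WH ε s ω ^ 4) ∂P := by
      refine integral_mono (integrable_pow_four (hX4 s))
        ((integrable_const _).add (hi.const_mul _)) fun ω => ?_
      have h2 := add_pow_four_le (G H F (fOU H WH ε s ω)) (-(κ * fOU H WH ε s ω))
      have h3 : G H F (fOU H WH ε s ω) ^ 4 ≤ C ^ 4 := by
        rw [← Even.pow_abs (by decide : Even 4)]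
        exact pow_le_pow_left₀ (abs_nonneg _) (hC _) 4
      have h4 : (-(κ * fOU H WH ε s ω)) ^ 4 = κ ^ 4 * fOU H WH ε s ω ^ 4 := by ring
      rw [h4, ← sub_eq_add_neg] at h2
      simp only [hX]
      linarith
    rw [integral_add (integrable_const _) (hi.const_mul _)] at h1
    simp only [integral_const, probReal_univ, one_smul] at h1
    have h5 : ∫ ω, fOU H WH ε s ω ^ 4 ∂P = sigmaOU H ^ 4 * ∫ x, x ^ 4 ∂gaussianReal 0 1 := by
      rw [← norm_fouLp hH hW hWH hε s, ← integral_pow_of_mem hW (fouLp_mem hW hWH ε s)]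
      refine integral_congr_ae ?_
      filter_upwards [(ae_fOU hH hW hWH hε s).2] with ω hω
      rw [hω]
    rwa [integral_const_mul, h5] at h1
  have hp : -1 < 2 * H - 2 := by linarith
  have hri := (integrableOn_sub_rpow hp ht.2).const_mul (L * ε ^ (2 - 2 * H))
  have hTt : (T - t) ^ (2 * H - 1) ≤ T ^ (2 * H - 1) :=
    Real.rpow_le_rpow (by linarith [ht.2]) (by linarith [ht.1]) hH1.le
  have key := integral_condExp_integral_pow_four_le (past_le hW hBm t) hXm hI
    (hintG4.sub (hJ4.const_mul _)) hX4 hA hri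
    (R := L * (T ^ (2 * H - 1) / (2 * H - 1) + 1) * ε ^ (2 - 2 * H)) (by positivity) ?_ ?_ ?_
  · refine le_trans (le_of_eq (integral_congr_ae ?_)) key
    have e1 := condExp_sub hintG ((hJ4.integrable (by norm_num)).const_mul κ) (past W B t)
    have e2 := condExp_smul (μ := P) κ J (past W B t)
    filter_upwards [e1, e2, coeFn_condPast hW hBm t J] with ω h1 h2 h3
    have h2' : P[fun ω => κ * J ω | past W B t] ω = κ * P[J | past W B t] ω := h2
    have h1' : P[fun ω => intG H F WH ε t T ω - κ * J ω | past W B t] ω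
      = phi P H F W B WH ε t T ω - P[fun ω => κ * J ω | past W B t] ω := h1
    rw [h1', h2', h3]
  · rw [integral_const_mul, setIntegral_sub_rpow hp ht.2, show 2 * H - 2 + 1 = 2 * H - 1 by ring]
    have : (T - t) ^ (2 * H - 1) / (2 * H - 1) ≤ T ^ (2 * H - 1) / (2 * H - 1) + 1 := by
      have : (T - t) ^ (2 * H - 1) / (2 * H - 1) ≤ T ^ (2 * H - 1) / (2 * H - 1) := by gcongr
      linarith
    calc _ ≤ L * ε ^ (2 - 2 * H) * (T ^ (2 * H - 1) / (2 * H - 1) + 1) := by gcongr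
      _ = _ := by ring
  · filter_upwards [ae_restrict_mem measurableSet_Ioc] with s hs
    have := sub_pos.2 hs.1
    positivity
  · filter_upwards [ae_restrict_mem measurableSet_Ioc] with s hs
    exact hfix ε t s hε ht.1 hs.1

/-- The fourth moment of the distance between `φ` and its Gaussian approximation. -/
lemma exists_integral_phi_sub_fbmLp_pow_four_le (hH : H ∈ Ioo (1 / 2 : ℝ) 1)
    (hF : IsVolatilityFunction H F)
    (hW : IsTwoSidedBrownian W P) (hBm : ∀ s, Measurable (B s))
    (hWB : IndepFun (fun ω t => W t ω) (fun ω s => B s ω) P)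
    (hWH : IsFractionalBrownian P H W WH) {T : ℝ} (hT : 0 ≤ T) :
    ∃ K : ℝ, 0 ≤ K ∧ ∀ ε t : ℝ, 0 < ε → t ∈ Icc 0 T →
      ∫ ω, (phi P H F W B WH ε t T ω - meanFF' H F * ε ^ (1 - H) *
        condPast hW hBm t (fbmLp hWH T - fbmLp hWH t) ω) ^ 4 ∂P
        ≤ K * (ε ^ (8 - 8 * H) + ε ^ (4 : ℝ)) := by
  obtain ⟨K, hK⟩ := exists_integral_phi_sub_condPast_pow_four_le hH hF hW hBm hWB hWH hT
  set κ := meanFF' H F with hκ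
  set A := ∫ x, x ^ 4 ∂gaussianReal 0 1 with hA
  have hA0 : 0 ≤ A := integral_nonneg fun x => by positivity
  refine ⟨8 * K ^ 4 + 8 * κ ^ 4 * ((2 * sigmaOU H) ^ 4 * A), by positivity, fun ε t hε ht => ?_⟩
  set Y := condPast hW hBm t (fbmLp hWH T - fbmLp hWH t) with hY
  set U := condPast hW hBm t (fouLp hWH ε T - fouLp hWH ε t) with hU
  set V := condPast hW hBm t (fouIntLp hWH ε t T) with hV
  have hUmem : U ∈ gaussianSpace hW.gaussian := condPast_mem hW hBm hWB ht.1
    (Submodule.sub_mem _ (fouLp_mem hW hWH _ _) (fouLp_mem hW hWH _ _))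
  have hVmem : V ∈ gaussianSpace hW.gaussian := condPast_mem hW hBm hWB ht.1 (fouIntLp_mem hW hWH _ _ _)
  have hVe : V = ε ^ (1 - H) • Y - ε • U := by
    rw [hV, fouIntLp, map_sub, map_smul, map_smul]
  have hU4 := memLp_four_of_mem hW hUmem
  have hφ := memLp_phi (WH := WH) hF hW hBm 4 ε t T
  have hd4 : MemLp (fun ω => phi P H F W B WH ε t T ω - κ * V ω) 4 P :=
    hφ.sub ((memLp_four_of_mem hW hVmem).const_mul _)
  have hYmem : Y ∈ gaussianSpace hW.gaussian := condPast_mem hW hBm hWB ht.1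
    (Submodule.sub_mem _ (fbmLp_mem hW hWH _) (fbmLp_mem hW hWH _))
  have hd4' : MemLp (fun ω => phi P H F W B WH ε t T ω - κ * ε ^ (1 - H) * Y ω) 4 P :=
    hφ.sub ((memLp_four_of_mem hW hYmem).const_mul _)
  have h1 : ∫ ω, (phi P H F W B WH ε t T ω - κ * ε ^ (1 - H) * Y ω) ^ 4 ∂P
      ≤ ∫ ω, (8 * (phi P H F W B WH ε t T ω - κ * V ω) ^ 4 + 8 * (κ * ε) ^ 4 * U ω ^ 4) ∂P := by
    refine integral_mono_ae (integrable_pow_four hd4')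
      (((integrable_pow_four hd4).const_mul _).add ((integrable_pow_four hU4).const_mul _)) ?_
    filter_upwards [Lp.coeFn_sub (ε ^ (1 - H) • Y) (ε • U), Lp.coeFn_smul (ε ^ (1 - H)) Y,
      Lp.coeFn_smul ε U] with ω a1 a2 a3
    have a4 : V ω = ε ^ (1 - H) * Y ω - ε * U ω := by
      rw [hVe, a1, Pi.sub_apply, a2, a3]; rfl
    have h2 := add_pow_four_le (phi P H F W B WH ε t T ω - κ * V ω) (-(κ * ε * U ω))
    have e : phi P H F W B WH ε t T ω - κ * V ω + -(κ * ε * U ω)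
        = phi P H F W B WH ε t T ω - κ * ε ^ (1 - H) * Y ω := by rw [a4]; ring
    rw [e] at h2
    refine h2.trans (le_of_eq ?_)
    ring
  rw [integral_add ((integrable_pow_four hd4).const_mul _) ((integrable_pow_four hU4).const_mul _),
    integral_const_mul, integral_const_mul, integral_pow_of_mem hW hUmem, ← hA] at h1
  -- The boundary term `ε (Z_T - Z_t)` is of order `ε` by contractivity and stationarity of the
  -- variance, which accounts for the `ε ^ 4` in the bound.
  have hUn : ‖U‖ ≤ 2 * sigmaOU H := by
    refine (norm_condPast_le hW hBm t _).trans ((norm_sub_le _ _).trans ?_)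
    rw [norm_fouLp hH hW hWH hε, norm_fouLp hH hW hWH hε]
    linarith
  have e1 : (K * ε ^ (2 - 2 * H)) ^ 4 = K ^ 4 * ε ^ (8 - 8 * H) := by
    rw [mul_pow, ← Real.rpow_natCast (ε ^ _), ← Real.rpow_mul hε.le]; congr 2; push_cast; ring
  have e2 : ε ^ (4 : ℝ) = ε ^ 4 := by
    rw [← Real.rpow_natCast]; norm_num
  have h3 := hK ε t hε ht
  rw [e1] at h3
  have h4 : 8 * (κ * ε) ^ 4 * (‖U‖ ^ 4 * A) ≤ 8 * (κ * ε) ^ 4 * ((2 * sigmaOU H) ^ 4 * A) := by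
    gcongr
  have p1 : 0 ≤ 8 * K ^ 4 * ε ^ (4 : ℝ) := by positivity
  have p2 : 0 ≤ 8 * κ ^ 4 * ((2 * sigmaOU H) ^ 4 * A) * ε ^ (8 - 8 * H) := by positivity
  have e3 : 8 * (κ * ε) ^ 4 * ((2 * sigmaOU H) ^ 4 * A)
      = 8 * κ ^ 4 * ((2 * sigmaOU H) ^ 4 * A) * ε ^ (4 : ℝ) := by rw [e2]; ring
  rw [e3] at h4
  calc _ ≤ _ := h1
    _ ≤ 8 * (K ^ 4 * ε ^ (8 - 8 * H)) + 8 * κ ^ 4 * ((2 * sigmaOU H) ^ 4 * A) * ε ^ (4 : ℝ) := by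
        gcongr
    _ ≤ _ := by linarith

end Approximation

/-! ### Passage to the limit and uniform moment bounds -/

section Limits

variable {Ω : Type u} [MeasurableSpace Ω] {P : Measure Ω} [IsProbabilityMeasure P] {H : ℝ}
  {F : ℝ → ℝ} {W : ℝ → Ω → ℝ} {B : ℝ≥0 → Ω → ℝ} {WH : ℝ → Ω → ℝ}

/-- The process `φ` in `L²(P)`. -/
noncomputable def phiLp (hF : IsVolatilityFunction H F) (hW : IsTwoSidedBrownian W P)
    (hBm : ∀ s, Measurable (B s)) (WH : ℝ → Ω → ℝ) (ε t T : ℝ) : Lp ℝ 2 P :=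
  (memLp_phi (WH := WH) hF hW hBm 2 ε t T).toLp (phi P H F W B WH ε t T)

/-- The Gaussian limit of the rescaled `φ`, in `L²(P)`. -/
noncomputable def phiLimLp (F : ℝ → ℝ) (hW : IsTwoSidedBrownian W P)
    (hBm : ∀ s, Measurable (B s)) (hWH : IsFractionalBrownian P H W WH) (t T : ℝ) : Lp ℝ 2 P :=
  meanFF' H F • condPast hW hBm t (fbmLp hWH T - fbmLp hWH t)

lemma coeFn_phiLp (hF : IsVolatilityFunction H F) (hW : IsTwoSidedBrownian W P)
    (hBm : ∀ s, Measurable (B s)) (ε t T : ℝ) :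
    phiLp hF hW hBm WH ε t T =ᵐ[P] phi P H F W B WH ε t T := MemLp.coeFn_toLp _

lemma phiLimLp_mem (hW : IsTwoSidedBrownian W P) (hBm : ∀ s, Measurable (B s))
    (hWB : IndepFun (fun ω t => W t ω) (fun ω s => B s ω) P)
    (hWH : IsFractionalBrownian P H W WH) {t : ℝ} (ht : 0 ≤ t) (T : ℝ) :
    phiLimLp F hW hBm hWH t T ∈ gaussianSpace hW.gaussian :=
  Submodule.smul_mem _ _ (condPast_mem hW hBm hWB ht
    (Submodule.sub_mem _ (fbmLp_mem hW hWH _) (fbmLp_mem hW hWH _)))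

lemma inner_phiLimLp (hH : H ∈ Ioo (1 / 2 : ℝ) 1) (hW : IsTwoSidedBrownian W P)
    (hBm : ∀ s, Measurable (B s)) (hWB : IndepFun (fun ω t => W t ω) (fun ω s => B s ω) P)
    (hWH : IsFractionalBrownian P H W WH) {t t' T T' : ℝ} (ht : 0 ≤ t) (htt' : t ≤ t')
    (htT : t ≤ T) (htT' : t' ≤ T') :
    inner ℝ (phiLimLp F hW hBm hWH t T) (phiLimLp F hW hBm hWH t' T') = limitCov H F t t' T T' := by
  rw [phiLimLp, phiLimLp, real_inner_smul_left, real_inner_smul_right,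
    inner_condPast_fbmLp_sub hW hBm hWB hWH ht htt', limitCov_eq hH F htt' htT htT']
  ring

lemma norm_pow_four_le (f : Lp ℝ 2 P) (hf : MemLp f 4 P) : ‖f‖ ^ 4 ≤ ∫ ω, f ω ^ 4 ∂P := by
  have := sq_integral_sq_le hf
  rwa [← norm_sq_Lp_eq_integral, ← pow_mul] at this

/-- `L²` convergence of the rescaled `φ` to its Gaussian limit. -/
lemma tendsto_phiLp (hH : H ∈ Ioo (1 / 2 : ℝ) 1) (hF : IsVolatilityFunction H F)
    (hW : IsTwoSidedBrownian W P) (hBm : ∀ s, Measurable (B s))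
    (hWB : IndepFun (fun ω t => W t ω) (fun ω s => B s ω) P)
    (hWH : IsFractionalBrownian P H W WH) {t T : ℝ} (ht : 0 ≤ t) (htT : t ≤ T) :
    Tendsto (fun ε : ℝ => ε ^ (H - 1) • phiLp hF hW hBm WH ε t T) (𝓝[>] 0)
      (𝓝 (phiLimLp F hW hBm hWH t T)) := by
  obtain ⟨K, hK, hb⟩ := exists_integral_phi_sub_fbmLp_pow_four_le hH hF hW hBm hWB hWH
    (ht.trans htT)
  rw [tendsto_iff_norm_sub_tendsto_zero]
  -- Rescaling multiplies the fourth-moment error by `ε^(4H-4)`, leaving the exponents `4 - 4H` and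
  -- `4H`, both positive for `0 < H < 1`.
  have hlim : Tendsto (fun ε : ℝ => (K * (ε ^ (4 - 4 * H) + ε ^ (4 * H))) ^ (1 / 4 : ℝ)) (𝓝[>] 0)
      (𝓝 0) := by
    have hc : ContinuousAt (fun ε : ℝ => (K * (ε ^ (4 - 4 * H) + ε ^ (4 * H))) ^ (1 / 4 : ℝ)) 0 := by
      refine ContinuousAt.rpow_const (continuousAt_const.mul (ContinuousAt.add ?_ ?_))
        (Or.inr (by norm_num))
      · exact Real.continuousAt_rpow_const _ _ (Or.inr (by linarith [hH.2]))
      · exact Real.continuousAt_rpow_const _ _ (Or.inr (by linarith [hH.1]))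
    have h := hc.tendsto
    rw [Real.zero_rpow (by linarith [hH.2]), Real.zero_rpow (by linarith [hH.1]), add_zero,
      mul_zero, Real.zero_rpow (by norm_num)] at h
    exact h.mono_left nhdsWithin_le_nhds
  refine squeeze_zero' (Eventually.of_forall fun _ => norm_nonneg _) ?_ hlim
  filter_upwards [self_mem_nhdsWithin] with ε hε
  have hε : (0 : ℝ) < ε := hε
  set Y := condPast hW hBm t (fbmLp hWH T - fbmLp hWH t) with hY
  set D := ε ^ (H - 1) • phiLp hF hW hBm WH ε t T - phiLimLp F hW hBm hWH t T with hD
  have hDe : D =ᵐ[P] fun ω => ε ^ (H - 1) *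
      (phi P H F W B WH ε t T ω - meanFF' H F * ε ^ (1 - H) * Y ω) := by
    have e : ε ^ (H - 1) * ε ^ (1 - H) = 1 := by
      rw [← Real.rpow_add hε]; simp
    filter_upwards [Lp.coeFn_sub (ε ^ (H - 1) • phiLp hF hW hBm WH ε t T)
      (phiLimLp F hW hBm hWH t T), Lp.coeFn_smul (ε ^ (H - 1)) (phiLp hF hW hBm WH ε t T),
      Lp.coeFn_smul (meanFF' H F) Y, coeFn_phiLp (WH := WH) hF hW hBm ε t T] with ω h1 h2 h3 h4
    have h3' : phiLimLp F hW hBm hWH t T ω = meanFF' H F * Y ω := h3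
    rw [hD, h1, Pi.sub_apply, h2, Pi.smul_apply, h4, h3', smul_eq_mul]
    linear_combination meanFF' H F * Y ω * e
  have hY4 : MemLp Y 4 P := memLp_four_of_mem hW (condPast_mem hW hBm hWB ht
    (Submodule.sub_mem _ (fbmLp_mem hW hWH _) (fbmLp_mem hW hWH _)))
  have hD4 : MemLp D 4 P := (memLp_congr_ae hDe).2
    (((memLp_phi hF hW hBm 4 ε t T).sub (hY4.const_mul _)).const_mul _)
  have h1 := norm_pow_four_le D hD4
  have h2 : ∫ ω, D ω ^ 4 ∂P = (ε ^ (H - 1)) ^ 4 *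
      ∫ ω, (phi P H F W B WH ε t T ω - meanFF' H F * ε ^ (1 - H) * Y ω) ^ 4 ∂P := by
    rw [← integral_const_mul]
    refine integral_congr_ae ?_
    filter_upwards [hDe] with ω hω
    rw [hω, mul_pow]
  have h3 : ‖D‖ ^ 4 ≤ K * (ε ^ (4 - 4 * H) + ε ^ (4 * H)) := by
    refine h1.trans (h2.le.trans ?_)
    have e : (ε ^ (H - 1)) ^ 4 = ε ^ (4 * H - 4) := by
      rw [← Real.rpow_natCast, ← Real.rpow_mul hε.le]; congr 1; push_cast; ring
    have e1 : ε ^ (4 * H - 4) * ε ^ (8 - 8 * H) = ε ^ (4 - 4 * H) := by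
      rw [← Real.rpow_add hε]; congr 1; ring
    have e2 : ε ^ (4 * H - 4) * ε ^ (4 : ℝ) = ε ^ (4 * H) := by
      rw [← Real.rpow_add hε]; congr 1; ring
    rw [e, ← e1, ← e2]
    calc _ ≤ ε ^ (4 * H - 4) * (K * (ε ^ (8 - 8 * H) + ε ^ (4 : ℝ))) := by
          gcongr; exact hb ε t hε ⟨ht, htT⟩
      _ = _ := by ring
  calc ‖D‖ = (‖D‖ ^ 4) ^ (1 / 4 : ℝ) := by
        rw [← Real.rpow_natCast, ← Real.rpow_mul (norm_nonneg _)]; norm_num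
    _ ≤ _ := by gcongr

lemma tendsto_integral_phi_mul_phi (hH : H ∈ Ioo (1 / 2 : ℝ) 1) (hF : IsVolatilityFunction H F)
    (hW : IsTwoSidedBrownian W P) (hBm : ∀ s, Measurable (B s))
    (hWB : IndepFun (fun ω t => W t ω) (fun ω s => B s ω) P)
    (hWH : IsFractionalBrownian P H W WH) {t t' T T' : ℝ} (ht : 0 ≤ t) (htt' : t ≤ t')
    (htT : t ≤ T) (htT' : t' ≤ T') :
    Tendsto (fun ε : ℝ => ε ^ (2 * H - 2) *
        ∫ ω, phi P H F W B WH ε t T ω * phi P H F W B WH ε t' T' ω ∂P)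
      (𝓝[>] 0) (𝓝 (limitCov H F t t' T T')) := by
  rw [← inner_phiLimLp hH hW hBm hWB hWH ht htt' htT htT']
  refine ((tendsto_phiLp hH hF hW hBm hWB hWH ht htT).inner
    (tendsto_phiLp hH hF hW hBm hWB hWH (ht.trans htt') htT')).congr' ?_
  filter_upwards [self_mem_nhdsWithin] with ε hε
  have hε : (0 : ℝ) < ε := hε
  rw [real_inner_smul_left, real_inner_smul_right, phiLp, phiLp, inner_toLp_toLp, ← mul_assoc,
    ← Real.rpow_add hε]
  congr 2
  ring

/-- For equal pairs with `t < T` one has `q = 0` and `r = s = 1`, so numerator and denominator of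
`corrPhi` coincide. -/
lemma limitCov_self (hH : H ∈ Ioo (1 / 2 : ℝ) 1) (F : ℝ → ℝ) {t T : ℝ} (htT : t ≤ T) :
    limitCov H F t t T T = sigmaPhiSq H F * (T - t) ^ (2 * H) := by
  have hH0 : H ≠ 0 := by linarith [hH.1]
  rcases htT.eq_or_lt with rfl | h
  · rw [limitCov, sub_self, Real.zero_rpow hH0, Real.zero_rpow (by simpa using hH0)]
    ring
  have h0 : 0 < T - t := sub_pos.2 h
  have hc : corrPhi H t t T T = 1 := by
    have hs : √(T - t) ≠ 0 := (Real.sqrt_pos.2 h0).ne'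
    simp only [corrPhi, sub_self, zero_div, Real.sqrt_mul_self h0.le, div_self hs, div_self h0.ne',
      add_zero]
    simp_rw [add_comm _ (1 : ℝ), ← sq]
    exact div_self (setIntegral_Ioi_unit_kernel_sq_pos hH).ne'
  rw [limitCov, hc, mul_one, mul_assoc, ← Real.rpow_add h0, two_mul]

/-- Union bound over the coordinates, for the sup norm on `Fin n → ℝ`. -/
lemma tendstoInMeasure_pi {ι : Type*} {n : ℕ} {X : ι → Fin n → Ω → ℝ} {Y : Fin n → Ω → ℝ}
    {l : Filter ι} (h : ∀ i, TendstoInMeasure P (fun k => X k i) l (Y i)) :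
    TendstoInMeasure P (fun k ω i => X k i ω) l (fun ω i => Y i ω) := by
  rw [tendstoInMeasure_iff_norm]
  intro δ hδ
  have hs : Tendsto (fun k => ∑ i, P {ω | δ ≤ ‖X k i ω - Y i ω‖}) l (𝓝 0) := by
    have := tendsto_finsetSum Finset.univ fun i _ => tendstoInMeasure_iff_norm.1 (h i) δ hδ
    simpa using this
  refine tendsto_of_tendsto_of_tendsto_of_le_of_le tendsto_const_nhds hs (fun _ => zero_le)
    fun k => ?_
  refine le_trans (measure_mono fun ω hω => ?_) (measure_iUnion_fintype_le P _)
  by_contra hcon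
  simp only [mem_iUnion, mem_ofPred_eq, not_exists, not_le] at hcon
  exact absurd ((pi_norm_lt_iff hδ).2 hcon) (not_lt.2 hω)

/-- Prelimit and limit share one probability space, so coordinatewise `L²` convergence gives joint
convergence in measure, hence in law. -/
lemma tendstoInDistribution_phi (hH : H ∈ Ioo (1 / 2 : ℝ) 1) (hF : IsVolatilityFunction H F)
    (hW : IsTwoSidedBrownian W P) (hBm : ∀ s, Measurable (B s))
    (hWB : IndepFun (fun ω t => W t ω) (fun ω s => B s ω) P)
    (hWH : IsFractionalBrownian P H W WH) (n : ℕ) (τ : Fin n → TimeMaturity) :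
    TendstoInDistribution
      (fun (ε : ℝ) (ω : Ω) (i : Fin n) => ε ^ (H - 1) * phi P H F W B WH ε (τ i).t (τ i).T ω)
      (𝓝[>] 0) (fun (ω : Ω) (i : Fin n) => phiLimLp F hW hBm hWH (τ i).t (τ i).T ω)
      (fun _ => P) P := by
  refine TendstoInMeasure.tendstoInDistribution
    (tendstoInMeasure_pi (X := fun ε i ω => ε ^ (H - 1) * phi P H F W B WH ε (τ i).t (τ i).T ω)
      (Y := fun i => phiLimLp F hW hBm hWH (τ i).t (τ i).T) fun i => ?_) fun ε => ?_
  · refine (tendstoInMeasure_of_tendsto_Lp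
      (tendsto_phiLp hH hF hW hBm hWB hWH (τ i).2.1 (τ i).2.2)).congr_left fun ε => ?_
    filter_upwards [Lp.coeFn_smul (ε ^ (H - 1)) (phiLp hF hW hBm WH ε (τ i).t (τ i).T),
      coeFn_phiLp (WH := WH) hF hW hBm ε (τ i).t (τ i).T] with ω h1 h2
    exact h1.trans (by rw [Pi.smul_apply, h2, smul_eq_mul])
  · exact aemeasurable_pi_lambda _ fun i =>
      ((aestronglyMeasurable_phi hW hBm ε (τ i).t (τ i).T).aemeasurable.const_mul _)

/-- Uniform bound of the fourth moments. -/
lemma exists_integral_phi_pow_four_le (hH : H ∈ Ioo (1 / 2 : ℝ) 1) (hF : IsVolatilityFunction H F)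
    (hW : IsTwoSidedBrownian W P) (hBm : ∀ s, Measurable (B s))
    (hWB : IndepFun (fun ω t => W t ω) (fun ω s => B s ω) P)
    (hWH : IsFractionalBrownian P H W WH) {T : ℝ} (hT : 0 ≤ T) :
    ∃ K : ℝ, 0 ≤ K ∧ ∀ ε t : ℝ, 0 < ε → t ∈ Icc 0 T →
      ∫ ω, phi P H F W B WH ε t T ω ^ 4 ∂P ≤ K * ε ^ (4 - 4 * H) := by
  obtain ⟨K, hK, hb⟩ := exists_integral_phi_sub_fbmLp_pow_four_le hH hF hW hBm hWB hWH hT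
  obtain ⟨C, hC, -, -⟩ := hF.exists_bound
  have hC0 : 0 ≤ C := (abs_nonneg _).trans (hC 0)
  set κ := meanFF' H F with hκ
  set A := ∫ x, x ^ 4 ∂gaussianReal 0 1 with hA
  have hA0 : 0 ≤ A := integral_nonneg fun x => by positivity
  have hH0 : 0 < H := by linarith [hH.1]
  set S := √(sigmaHSq H) * T ^ H with hS
  have hS0 : 0 ≤ S := by positivity
  have hq1 : 0 ≤ (C * T) ^ 4 := by positivity
  have hq2 : 0 ≤ 16 * K + 8 * κ ^ 4 * (S ^ 4 * A) := by positivity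
  refine ⟨(C * T) ^ 4 + (16 * K + 8 * κ ^ 4 * (S ^ 4 * A)), by positivity, fun ε t hε ht => ?_⟩
  have hφ := memLp_phi (WH := WH) hF hW hBm 4 ε t T
  have hεp : 0 ≤ ε ^ (4 - 4 * H) := by positivity
  -- For `ε ≤ 1` the error exponents `8 - 8H` and `4` both exceed `4 - 4H`, so the Gaussian
  -- approximation dominates. For `ε ≥ 1` the crude bound `|φ| ≤ C T` suffices, because `ε^(4-4H) ≥
  -- 1`.
  rcases le_total ε 1 with h1 | h1
  · set Y := condPast hW hBm t (fbmLp hWH T - fbmLp hWH t) with hY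
    have hYmem : Y ∈ gaussianSpace hW.gaussian := condPast_mem hW hBm hWB ht.1
      (Submodule.sub_mem _ (fbmLp_mem hW hWH _) (fbmLp_mem hW hWH _))
    have hY4 := memLp_four_of_mem hW hYmem
    have hd4 : MemLp (fun ω => phi P H F W B WH ε t T ω - κ * ε ^ (1 - H) * Y ω) 4 P :=
      hφ.sub (hY4.const_mul _)
    have h2 : ∫ ω, phi P H F W B WH ε t T ω ^ 4 ∂P
        ≤ ∫ ω, (8 * (phi P H F W B WH ε t T ω - κ * ε ^ (1 - H) * Y ω) ^ 4
          + 8 * (κ * ε ^ (1 - H)) ^ 4 * Y ω ^ 4) ∂P := by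
      refine integral_mono (integrable_pow_four hφ)
        (((integrable_pow_four hd4).const_mul _).add ((integrable_pow_four hY4).const_mul _))
        fun ω => ?_
      have h3 := add_pow_four_le (phi P H F W B WH ε t T ω - κ * ε ^ (1 - H) * Y ω)
        (κ * ε ^ (1 - H) * Y ω)
      rw [sub_add_cancel] at h3
      refine h3.trans (le_of_eq ?_)
      ring
    rw [integral_add ((integrable_pow_four hd4).const_mul _)
      ((integrable_pow_four hY4).const_mul _), integral_const_mul, integral_const_mul,
      integral_pow_of_mem hW hYmem, ← hA] at h2
    have hYn : ‖Y‖ ≤ S := by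
      refine (norm_condPast_le hW hBm t _).trans ?_
      rw [norm_fbmLp_sub hH hW hWH, abs_of_nonneg (sub_nonneg.2 ht.2), hS]
      gcongr
      · linarith [ht.2]
      · linarith [ht.1]
    have e : (κ * ε ^ (1 - H)) ^ 4 = κ ^ 4 * ε ^ (4 - 4 * H) := by
      rw [mul_pow, ← Real.rpow_natCast (ε ^ _), ← Real.rpow_mul hε.le]
      congr 2; push_cast; ring
    have h4 : ε ^ (8 - 8 * H) ≤ ε ^ (4 - 4 * H) :=
      Real.rpow_le_rpow_of_exponent_ge hε h1 (by linarith [hH.2])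
    have h5 : ε ^ (4 : ℝ) ≤ ε ^ (4 - 4 * H) :=
      Real.rpow_le_rpow_of_exponent_ge hε h1 (by linarith)
    have h6 := hb ε t hε ht
    rw [e] at h2
    have h7 : K * (ε ^ (8 - 8 * H) + ε ^ (4 : ℝ)) ≤ K * (ε ^ (4 - 4 * H) + ε ^ (4 - 4 * H)) := by
      gcongr
    have h8 : 8 * (κ ^ 4 * ε ^ (4 - 4 * H)) * (‖Y‖ ^ 4 * A)
        ≤ 8 * (κ ^ 4 * ε ^ (4 - 4 * H)) * (S ^ 4 * A) := by gcongr
    nlinarith [mul_nonneg hq1 hεp]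
  · have hone : (1 : ℝ) ≤ ε ^ (4 - 4 * H) := Real.one_le_rpow h1 (by linarith [hH.2])
    have h2 : ∫ ω, phi P H F W B WH ε t T ω ^ 4 ∂P ≤ ∫ _, (C * T) ^ 4 ∂P := by
      refine integral_mono_ae (integrable_pow_four hφ) (integrable_const _) ?_
      filter_upwards [ae_abs_phi_le (P := P) (W := W) (B := B) (WH := WH) hC ε t T] with ω hω
      rw [← Even.pow_abs (by decide : Even 4)]
      refine pow_le_pow_left₀ (abs_nonneg _) (hω.trans ?_) 4
      rw [abs_of_nonneg (sub_nonneg.2 ht.2)]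
      gcongr
      linarith [ht.1]
    simp only [integral_const, probReal_univ, one_smul] at h2
    nlinarith [mul_nonneg hq2 hεp]

end Limits

end FractionalVol

/-! ### The main theorem -/

theorem lemmaB3 {Ω : Type u} [MeasurableSpace Ω] (P : Measure Ω) [IsProbabilityMeasure P]
    (H : ℝ) (hH : H ∈ Ioo (1 / 2 : ℝ) 1)
    (F : ℝ → ℝ) (hF : IsVolatilityFunction H F)
    (W : ℝ → Ω → ℝ) (hW : IsTwoSidedBrownian W P)
    (B : ℝ≥0 → Ω → ℝ) (hB : IsBrownianReal B P) (hBm : ∀ s, Measurable (B s))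
    (hWB : IndepFun (fun ω t => W t ω) (fun ω s => B s ω) P)
    (WH : ℝ → Ω → ℝ) (hWH : IsFractionalBrownian P H W WH) :
    -- first item: zero mean and variance
    (∀ t T : ℝ, 0 ≤ t → t ≤ T →
      (∀ ε : ℝ, 0 < ε →
        Integrable (intG H F WH ε t T) P ∧
        MemLp (phi P H F W B WH ε t T) 2 P ∧
        ∫ ω, phi P H F W B WH ε t T ω ∂P = 0) ∧
      Tendsto (fun ε : ℝ => ε ^ (2 * H - 2) * ∫ ω, phi P H F W B WH ε t T ω ^ 2 ∂P)
        (𝓝[>] 0) (𝓝 (sigmaPhiSq H F * (T - t) ^ (2 * H)))) ∧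
    -- second item: covariance
    (∀ t t' T T' : ℝ, 0 ≤ t → t ≤ t' → t ≤ T → t' ≤ T' →
      Tendsto
        (fun ε : ℝ => ε ^ (2 * H - 2) *
          ∫ ω, phi P H F W B WH ε t T ω * phi P H F W B WH ε t' T' ω ∂P)
        (𝓝[>] 0) (𝓝 (limitCov H F t t' T T'))) ∧
    -- third item: convergence of the finite-dimensional distributions
    (∃ (Ω' : Type u) (_ : MeasurableSpace Ω') (P' : Measure Ω') (_ : IsProbabilityMeasure P')
        (Φ : TimeMaturity → Ω' → ℝ),
      IsGaussianProcess Φ P' ∧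
      (∀ τ, ∫ ω, Φ τ ω ∂P' = 0) ∧
      (∀ τ τ' : TimeMaturity, τ.t ≤ τ'.t →
        ∫ ω, Φ τ ω * Φ τ' ω ∂P' = limitCov H F τ.t τ'.t τ.T τ'.T) ∧
      ∀ (n : ℕ) (τ : Fin n → TimeMaturity),
        TendstoInDistribution
          (fun (ε : ℝ) (ω : Ω) (i : Fin n) =>
            ε ^ (H - 1) * phi P H F W B WH ε (τ i).t (τ i).T ω)
          (𝓝[>] 0)
          (fun (ω : Ω') (i : Fin n) => Φ (τ i) ω)
          (fun _ => P) P') ∧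
    -- fourth item: uniform bound of the fourth moments
    (∀ T : ℝ, 0 ≤ T → ∃ K : ℝ, ∀ ε : ℝ, 0 < ε → ∀ t ∈ Icc 0 T,
      MemLp (phi P H F W B WH ε t T) 4 P ∧
      (∫ ω, phi P H F W B WH ε t T ω ^ 4 ∂P) ^ (1 / 4 : ℝ) ≤ K * ε ^ (1 - H)) := by
  refine ⟨fun t T ht htT => ⟨fun ε hε => ⟨integrable_intG hH hF hW hWH hε htT,
    memLp_phi hF hW hBm 2 ε t T, integral_phi hH hF hW hBm hWH hε htT⟩, ?_⟩,
    fun t t' T T' ht htt' htT htT' =>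
      tendsto_integral_phi_mul_phi hH hF hW hBm hWB hWH ht htt' htT htT',
    -- The limit field is realized on `Ω` itself, as `⟨FF'⟩` times the predicted increments of
    -- fractional Brownian motion.
    ⟨Ω, inferInstance, P, inferInstance, fun τ => phiLimLp F hW hBm hWH τ.t τ.T, ?_, ?_, ?_,
      tendstoInDistribution_phi hH hF hW hBm hWB hWH⟩, fun T hT => ?_⟩
  · rw [← limitCov_self hH F htT]
    simp_rw [sq]
    exact tendsto_integral_phi_mul_phi hH hF hW hBm hWB hWH ht le_rfl htT htT
  · exact isGaussianProcess_of_mem hW.gaussian hW.mean_zero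
      (fun τ : TimeMaturity => phiLimLp_mem hW hBm hWB hWH τ.2.1 τ.T) fun _ => EventuallyEq.rfl
  · exact fun τ => integral_eq_zero_of_mem_gaussianSpace hW.gaussian hW.mean_zero
      (phiLimLp_mem hW hBm hWB hWH τ.2.1 τ.T)
  · intro τ τ' h
    rw [← inner_Lp_eq_integral]
    exact inner_phiLimLp hH hW hBm hWB hWH τ.2.1 h τ.2.2 τ'.2.2
  · obtain ⟨K, hK, hb⟩ := exists_integral_phi_pow_four_le hH hF hW hBm hWB hWH hT
    refine ⟨K ^ (1 / 4 : ℝ), fun ε hε t ht => ⟨memLp_phi hF hW hBm 4 ε t T, ?_⟩⟩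
    have h0 : 0 ≤ ∫ ω, phi P H F W B WH ε t T ω ^ 4 ∂P := integral_nonneg fun ω => by positivity
    calc _ ≤ (K * ε ^ (4 - 4 * H)) ^ (1 / 4 : ℝ) := by gcongr; exact hb ε t hε ht
      _ = _ := by
        rw [Real.mul_rpow hK (by positivity), ← Real.rpow_mul hε.le]
        congr 2
        ring
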